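/- Let $\mathbb M=\mathbb R^4$ be Minkowski spacetime with metric $\mathrm{diag}(+1,-1,-1,-1)$, let $m\ge 0$, and let $\mathcal A(\mathbb M)$ be the unital $*$-algebra generated by the smeared fields $\phi(f)$, $f\in\mathcal D(\mathbb R^4)$, which are complex linear in $f$ and satisfy $\phi(f)^*=\phi(\bar f)$, $\phi((\Box+m^2)f)=0$ and $[\phi(f),\phi(g)]=iE(f,g)\mathbf 1$, where $E$ is the advanced minus the retarded fundamental solution of the Klein-Gordon operator $\Box+m^2$. For $a\in\mathbb R^4$ let $\tau_a$ be the translation with $\tau_a\phi(f)=\phi(f(\cdot-a))$. A state is a normalized positive linear functional on $\mathcal A(\mathbb M)$ whose $n$-point functions are distributions. Let $\beta>0$, let $e$ be a future-directed timelike unit vector, and let $\omega$ be a $\beta e$-KMS state on $\mathcal A(\mathbb M)$. That is, $\omega$ is a state such that for all $A,B\in\mathcal A(\mathbb M)$ there is a function $F_{A,B}$, analytic on $\{0<\operatorname{Im} s<\beta\}$ and continuous on $\{0\le\operatorname{Im} s\le\beta\}$, with $F_{A,B}(t)=\omega(A\,\tau_{te}(B))$ and $F_{A,B}(t+i\beta)=\omega(\tau_{te}(B)A)$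 for all $t\in\mathbb R$, and $\omega$ is invariant under all space-time translations $\tau_a$. Then there is a tempered distribution $w_\beta\in\mathcal S'(\mathbb R^4)$ which, for every $q\in\mathbb R^4$, is the relative-variable two-point function of $\omega$ at $q$, i.e. the pullback $\kappa_q^*\omega_2$ of the two-point distribution under $\kappa_q(z)=(q-\tfrac z2,q+\tfrac z2)$ (formally $w_\beta(z)=\omega(\phi(q-\tfrac z2)\phi(q+\tfrac z2))$); and there is a complex function $F_\beta$ with the following properties. (i) $F_\beta$ is defined and holomorphic in the flat tube $\mathcal T_\beta=\{\zeta\in\mathbb C^4:\operatorname{Im}\zeta=\sigma e,\ 0<\sigma<\beta\}$ (that is, complex analytic in a neighbourhood in $\mathbb C^4$ of each point of $\mathcal T_\beta$). (ii) For every compact $K\subset(0,\beta)$ there are constants $C_K>0$ and $N_K\in\mathbb N_0$ such that $$|F_\beta(z+i\sigma e)|\le C_K(1+|z+i\sigma e|)^{N_K}\qquad(z\in\mathbb R^4,\ \sigma\in K).$$ (iii) In the sense of tempered distributions, $F_\beta(z+i\sigma e)\to w_\beta(z)$ as $\sigma\to0^+$ and $F_\beta(z+i(\beta-\eta)e)\to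 w_\beta(-z)$ as $\eta\to0^+$; that is, for every $h\in\mathcal S(\mathbb R^4)$, $$\int F_\beta(z+i\sigma e)h(z)\,d^4z\to w_\beta(h),\qquad \int F_\beta(z+i(\beta-\eta)e)h(z)\,d^4z\to w_\beta(h^-),\quad h^-(z)=h(-z).$$ -/

import Mathlib

open scoped Distributions SchwartzMap LineDeriv Topology ComplexOrder
open MeasureTheory Filter TopologicalSpace

noncomputable section

namespace KleinGordon

/-! ### Minkowski spacetime -/

/-- Minkowski spacetime `ℝ⁴`; the coordinate `0` is time. -/
abbrev Spacetime : Type := EuclideanSpace ℝ (Fin 4)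

/-- The complexified spacetime `ℂ⁴`. -/
abbrev ComplexSpacetime : Type := EuclideanSpace ℂ (Fin 4)

/-- The Lorentzian product with signature `(+,-,-,-)`. -/
def minkowski (x y : Spacetime) : ℝ :=
  x 0 * y 0 - x 1 * y 1 - x 2 * y 2 - x 3 * y 3

/-- The open forward light cone `V₊`. -/
def forwardCone : Set Spacetime := {x | 0 < x 0 ∧ 0 < minkowski x x}

/-- The time directions `V₊¹`: future-directed timelike unit vectors. -/
def timeDirections : Set Spacetime := {e | e ∈ forwardCone ∧ minkowski e e = 1}

/-- The closed forward light cone. -/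
def closedForwardCone : Set Spacetime := {x | 0 ≤ x 0 ∧ 0 ≤ minkowski x x}

/-- The closed backward light cone. -/
def closedBackwardCone : Set Spacetime := {x | x 0 ≤ 0 ∧ 0 ≤ minkowski x x}

/-- The standard basis vectors of spacetime. -/
abbrev basisVec (μ : Fin 4) : Spacetime := EuclideanSpace.single μ 1

/-! ### Test functions -/

/-- Complex-valued smooth compactly supported test functions on spacetime. -/
abbrev Test : Type := 𝓓((⊤ : Opens Spacetime), ℂ)

section TestFunctions

variable {V : Type*} [NormedAddCommGroup V] [NormedSpace ℝ V]
  {F : Type*} [NormedAddCommGroup F] [NormedSpace ℝ F]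

/-- The translate `y ↦ f (y - a)`. -/
def translate (a : V) (f : 𝓓((⊤ : Opens V), F)) : 𝓓((⊤ : Opens V), F) where
  toFun := fun y => f (y - a)
  contDiff' := f.contDiff.comp (contDiff_id.sub contDiff_const)
  hasCompactSupport' := f.hasCompactSupport.comp_homeomorph (Homeomorph.subRight a)
  tsupport_subset' := fun _ _ => trivial

/-- The reflected translate `y ↦ f (x - y)`. -/
def reflect (x : V) (f : 𝓓((⊤ : Opens V), F)) : 𝓓((⊤ : Opens V), F) where
  toFun := fun y => f (x - y)
  contDiff' := f.contDiff.comp (contDiff_const.sub contDiff_id)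
  hasCompactSupport' := f.hasCompactSupport.comp_homeomorph (Homeomorph.subLeft x)
  tsupport_subset' := fun _ _ => trivial

/-- The real part of a complex test function. -/
def rePart (f : 𝓓((⊤ : Opens V), ℂ)) : 𝓓((⊤ : Opens V), ℝ) :=
  TestFunction.postcompCLM (𝕜 := ℝ) Complex.reCLM f

/-- The imaginary part of a complex test function. -/
def imPart (f : 𝓓((⊤ : Opens V), ℂ)) : 𝓓((⊤ : Opens V), ℝ) :=
  TestFunction.postcompCLM (𝕜 := ℝ) Complex.imCLM f

/-- The complex conjugate of a complex test function. -/
def conj (f : 𝓓((⊤ : Opens V), ℂ)) : 𝓓((⊤ : Opens V), ℂ) :=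
  TestFunction.postcompCLM (𝕜 := ℝ) (Complex.conjCLE : ℂ →L[ℝ] ℂ) f

/-- The tensor product `f₁ ⊗ ⋯ ⊗ fₙ : (x₁, …, xₙ) ↦ f₁(x₁) ⋯ fₙ(xₙ)`. -/
def tensor {n : ℕ} (f : Fin n → 𝓓((⊤ : Opens V), ℂ)) :
    𝓓((⊤ : Opens (Fin n → V)), ℂ) where
  toFun := fun x => ∏ i, f i (x i)
  contDiff' := contDiff_prod fun i _ => (f i).contDiff.comp (contDiff_apply ℝ V i)
  hasCompactSupport' := by
    refine HasCompactSupport.intro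
      (isCompact_univ_pi fun i => (f i).hasCompactSupport.isCompact) fun x hx => ?_
    simp only [Set.mem_pi, Set.mem_univ, true_implies, not_forall] at hx
    obtain ⟨i, hi⟩ := hx
    exact Finset.prod_eq_zero (Finset.mem_univ i) (image_eq_zero_of_notMem_tsupport hi)
  tsupport_subset' := fun _ _ => trivial

end TestFunctions

/-! ### The Klein-Gordon operator and the causal propagator -/

/-- The Klein-Gordon operator `□ + m² = ∂₀² - ∂₁² - ∂₂² - ∂₃² + m²`, acting on test functions or
on distributions. -/
def kleinGordon {W : Type*} [AddCommGroup W] [Module ℝ W] [LineDeriv Spacetime W W]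
    (m : ℝ) (u : W) : W :=
  ∂_{basisVec 0} (∂_{basisVec 0} u) - ∂_{basisVec 1} (∂_{basisVec 1} u)
    - ∂_{basisVec 2} (∂_{basisVec 2} u) - ∂_{basisVec 3} (∂_{basisVec 3} u) + m ^ 2 • u

/-- The retarded fundamental solution of the Klein-Gordon operator: the unique (real) distribution
`G` with `(□ + m²) G = δ₀` that is supported in the closed forward cone. -/
def retarded (m : ℝ) : 𝓓'((⊤ : Opens Spacetime), ℝ) :=
  Classical.epsilon fun G =>
    kleinGordon m G = Distribution.delta 0 ∧ Distribution.dsupport G ⊆ closedForwardCone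

/-- The advanced fundamental solution of the Klein-Gordon operator: the unique (real) distribution
`G` with `(□ + m²) G = δ₀` that is supported in the closed backward cone. -/
def advanced (m : ℝ) : 𝓓'((⊤ : Opens Spacetime), ℝ) :=
  Classical.epsilon fun G =>
    kleinGordon m G = Distribution.delta 0 ∧ Distribution.dsupport G ⊆ closedBackwardCone

/-- The convolution `(G * g)(x) = G (y ↦ g (x - y))` of a real distribution with a complex test
function, a real distribution acting `ℂ`-linearly on complex test functions. -/
def convolve (G : 𝓓'((⊤ : Opens Spacetime), ℝ)) (g : Test) (x : Spacetime) : ℂ :=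
  (G (rePart (reflect x g)) : ℂ) + (G (imPart (reflect x g)) : ℂ) * Complex.I

/-- The causal propagator `E`, advanced minus retarded, as a bilinear form on test functions. -/
def causalPropagator (m : ℝ) (f g : Test) : ℂ :=
  ∫ x, f x * (convolve (advanced m) g x - convolve (retarded m) g x)

theorem causalPropagator_translate (m : ℝ) (a : Spacetime) (f g : Test) :
    causalPropagator m (translate a f) (translate a g) = causalPropagator m f g := by
  have h : ∀ x, reflect x (translate a g) = reflect (x - a) g := fun x => by
    ext y
    change g (x - y - a) = g (x - a - y)
    congr 1
    abel
  have h2 : ∀ (G : 𝓓'((⊤ : Opens Spacetime), ℝ)) x,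
      convolve G (translate a g) x = convolve G g (x - a) := fun G x => by
    simp only [convolve, h]
  unfold causalPropagator
  simp only [h2]
  exact integral_sub_right_eq_self
    (fun x => f x * (convolve (advanced m) g x - convolve (retarded m) g x)) a

theorem causalPropagator_conj (m : ℝ) (f g : Test) :
    causalPropagator m (conj f) (conj g) = (starRingEnd ℂ) (causalPropagator m f g) := by
  have h : ∀ (G : 𝓓'((⊤ : Opens Spacetime), ℝ)) x,
      convolve G (conj g) x = (starRingEnd ℂ) (convolve G g x) := fun G x => by
    have h1 : rePart (reflect x (conj g)) = rePart (reflect x g) := by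
      ext y
      exact Complex.conj_re _
    have h2 : imPart (reflect x (conj g)) = - imPart (reflect x g) := by
      ext y
      exact Complex.conj_im _
    simp only [convolve, h1, h2, map_neg, map_add, map_mul, Complex.conj_ofReal, Complex.conj_I,
      Complex.ofReal_neg]
    ring
  unfold causalPropagator
  rw [← integral_conj]
  refine integral_congr_ae (Eventually.of_forall fun x => ?_)
  simp only [h, map_mul, map_sub]
  rfl

theorem lineDeriv_apply (v : Spacetime) (f : Test) (x : Spacetime) :
    (∂_{v} f : Test) x = lineDeriv ℝ f x v := by
  rw [TestFunction.lineDerivOp_eq_lineDerivCLM ℝ, TestFunction.lineDerivCLM_apply]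
  simp

theorem lineDeriv_translate (v a : Spacetime) (f : Test) :
    ∂_{v} (translate a f) = translate a (∂_{v} f) := by
  ext x
  change _ = (∂_{v} f : Test) (x - a)
  rw [lineDeriv_apply, lineDeriv_apply]
  change lineDeriv ℝ (fun y => f (y - a)) x v = _
  simp only [lineDeriv, add_sub_right_comm]

theorem lineDeriv_conj (v : Spacetime) (f : Test) :
    ∂_{v} (conj f) = conj (∂_{v} f) := by
  ext x
  change _ = Complex.conjCLE ((∂_{v} f : Test) x)
  have hf : DifferentiableAt ℝ f x := f.contDiff.differentiable (by simp) x
  have hc : DifferentiableAt ℝ (conj f) x := (conj f).contDiff.differentiable (by simp) x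
  rw [lineDeriv_apply, lineDeriv_apply, hf.lineDeriv_eq_fderiv, hc.lineDeriv_eq_fderiv]
  change fderiv ℝ (Complex.conjCLE ∘ f) x v = _
  rw [ContinuousLinearEquiv.comp_fderiv]
  rfl

theorem kleinGordon_translate (m : ℝ) (a : Spacetime) (f : Test) :
    kleinGordon m (translate a f) = translate a (kleinGordon m f) := by
  simp only [kleinGordon, lineDeriv_translate]
  rfl

theorem kleinGordon_conj (m : ℝ) (f : Test) :
    kleinGordon m (conj f) = conj (kleinGordon m f) := by
  simp only [kleinGordon, lineDeriv_conj]
  simp only [conj, map_add, map_sub, map_smul]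

/-! ### The algebra of local fields -/

/-- The relations of the Klein-Gordon field: linearity in the test function, the field equation
`φ((□ + m²) f) = 0`, and the canonical commutation relations `[φ(f), φ(g)] = i E(f, g) 1`. -/
inductive FieldRel (m : ℝ) : FreeAlgebra ℂ Test → FreeAlgebra ℂ Test → Prop
  | add (f g : Test) : FieldRel m (FreeAlgebra.ι ℂ (f + g)) (FreeAlgebra.ι ℂ f + FreeAlgebra.ι ℂ g)
  | smul (c : ℂ) (f : Test) : FieldRel m (FreeAlgebra.ι ℂ (c • f)) (c • FreeAlgebra.ι ℂ f)
  | field_eq (f : Test) : FieldRel m (FreeAlgebra.ι ℂ (kleinGordon m f)) 0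
  | ccr (f g : Test) :
      FieldRel m (FreeAlgebra.ι ℂ f * FreeAlgebra.ι ℂ g - FreeAlgebra.ι ℂ g * FreeAlgebra.ι ℂ f)
        (algebraMap ℂ _ (Complex.I * causalPropagator m f g))

/-- The unital algebra of local fields on Minkowski spacetime, generated by the fields `φ(f)`
subject to the relations `FieldRel`. It is a `*`-algebra by the `StarRing` instance below. -/
abbrev FieldAlgebra (m : ℝ) : Type := RingQuot (FieldRel m)

/-- The smeared field `φ(f)`. -/
def field (m : ℝ) (f : Test) : FieldAlgebra m :=
  RingQuot.mkAlgHom ℂ (FieldRel m) (FreeAlgebra.ι ℂ f)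

theorem field_add (m : ℝ) (f g : Test) : field m (f + g) = field m f + field m g := by
  simpa [field] using RingQuot.mkAlgHom_rel ℂ (FieldRel.add (m := m) f g)

theorem field_smul (m : ℝ) (c : ℂ) (f : Test) : field m (c • f) = c • field m f := by
  simpa [field] using RingQuot.mkAlgHom_rel ℂ (FieldRel.smul (m := m) c f)

theorem field_kleinGordon (m : ℝ) (f : Test) : field m (kleinGordon m f) = 0 := by
  simpa [field] using RingQuot.mkAlgHom_rel ℂ (FieldRel.field_eq (m := m) f)

theorem field_ccr (m : ℝ) (f g : Test) :
    field m f * field m g - field m g * field m f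
      = algebraMap ℂ (FieldAlgebra m) (Complex.I * causalPropagator m f g) := by
  have h := RingQuot.mkAlgHom_rel ℂ (FieldRel.ccr (m := m) f g)
  rwa [map_sub, map_mul, map_mul, AlgHom.commutes] at h

/-- The universal property: a map of test functions into an algebra that satisfies the relations
extends to the algebra of local fields. -/
def liftField {m : ℝ} {B : Type*} [Ring B] [Algebra ℂ B] (Φ : Test → B)
    (h_add : ∀ f g, Φ (f + g) = Φ f + Φ g) (h_smul : ∀ (c : ℂ) f, Φ (c • f) = c • Φ f)
    (h_eq : ∀ f, Φ (kleinGordon m f) = 0)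
    (h_ccr : ∀ f g, Φ f * Φ g - Φ g * Φ f
      = algebraMap ℂ B (Complex.I * causalPropagator m f g)) :
    FieldAlgebra m →ₐ[ℂ] B :=
  RingQuot.liftAlgHom ℂ ⟨FreeAlgebra.lift ℂ Φ, by
    intro x y hxy
    cases hxy with
    | add f g => simpa using h_add f g
    | smul c f => simpa using h_smul c f
    | field_eq f => simpa using h_eq f
    | ccr f g =>
      rw [map_sub, map_mul, map_mul, AlgHom.commutes, FreeAlgebra.lift_ι_apply,
        FreeAlgebra.lift_ι_apply]
      exact h_ccr f g⟩

theorem liftField_field {m : ℝ} {B : Type*} [Ring B] [Algebra ℂ B] (Φ : Test → B)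
    (h_add h_smul h_eq h_ccr) (f : Test) :
    liftField (m := m) Φ h_add h_smul h_eq h_ccr (field m f) = Φ f := by
  unfold liftField field
  rw [RingQuot.liftAlgHom_mkAlgHom_apply, FreeAlgebra.lift_ι_apply]

/-- The algebra of local fields is generated by the fields. -/
theorem field_induction {m : ℝ} {P : FieldAlgebra m → Prop}
    (h_scalar : ∀ c : ℂ, P (algebraMap ℂ _ c)) (h_field : ∀ f, P (field m f))
    (h_mul : ∀ a b, P a → P b → P (a * b)) (h_add : ∀ a b, P a → P b → P (a + b))
    (a : FieldAlgebra m) : P a := by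
  obtain ⟨x, rfl⟩ := RingQuot.mkAlgHom_surjective ℂ (FieldRel m) a
  induction x with
  | grade0 c => simpa only [AlgHom.commutes] using h_scalar c
  | grade1 f => exact h_field f
  | mul a b ha hb => simpa only [map_mul] using h_mul _ _ ha hb
  | add a b ha hb => simpa only [map_add] using h_add _ _ ha hb

/-- The opposite algebra with complex conjugated scalars. -/
def ConjOp (A : Type*) : Type _ := Aᵐᵒᵖ

instance (A : Type*) [Ring A] : Ring (ConjOp A) := inferInstanceAs (Ring Aᵐᵒᵖ)

instance (A : Type*) [Ring A] [Algebra ℂ A] : Algebra ℂ (ConjOp A) :=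
  RingHom.toAlgebra' ((algebraMap ℂ Aᵐᵒᵖ).comp (starRingEnd ℂ)) fun c x =>
    Algebra.commutes (A := Aᵐᵒᵖ) (starRingEnd ℂ c) x

/-- The involution as a homomorphism into the conjugate opposite algebra, determined by
`φ(f)^* = φ(f̄)`. -/
def starHom (m : ℝ) : FieldAlgebra m →ₐ[ℂ] ConjOp (FieldAlgebra m) :=
  liftField (fun f => (MulOpposite.op (field m (conj f)) : (FieldAlgebra m)ᵐᵒᵖ))
    (fun f g => by
      have h : conj (f + g) = conj f + conj g := map_add _ f g
      rw [h, field_add]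
      rfl)
    (fun c f => by
      have h : conj (c • f) = (starRingEnd ℂ c) • conj f := by
        ext x
        exact map_mul (starRingEnd ℂ) c (f x)
      rw [h, field_smul]
      exact (Algebra.smul_def (A := (FieldAlgebra m)ᵐᵒᵖ) (starRingEnd ℂ c) _).trans
        (Algebra.smul_def (A := ConjOp (FieldAlgebra m)) c _).symm)
    (fun f => by
      rw [← kleinGordon_conj, field_kleinGordon]
      rfl)
    (fun f g => by
      have h := congrArg MulOpposite.op (field_ccr m (conj g) (conj f))
      rw [MulOpposite.op_sub, MulOpposite.op_mul, MulOpposite.op_mul] at h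
      have h2 := congrArg MulOpposite.op (field_ccr m (conj f) (conj g))
      rw [MulOpposite.op_sub, MulOpposite.op_mul, MulOpposite.op_mul] at h2
      have h3 : Complex.I * causalPropagator m (conj f) (conj g)
          = - (starRingEnd ℂ) (Complex.I * causalPropagator m f g) := by
        rw [causalPropagator_conj, map_mul, Complex.conj_I]
        ring
      rw [h3, map_neg, MulOpposite.op_neg] at h2
      refine (neg_inj.mp ((neg_sub _ _).trans h2)))

/-- The conjugate linear involution of the algebra of local fields. -/
def fieldStar (m : ℝ) (a : FieldAlgebra m) : FieldAlgebra m :=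
  MulOpposite.unop (starHom m a : (FieldAlgebra m)ᵐᵒᵖ)

theorem fieldStar_field (m : ℝ) (f : Test) : fieldStar m (field m f) = field m (conj f) :=
  congrArg MulOpposite.unop (liftField_field (B := ConjOp (FieldAlgebra m)) _ _ _ _ _ f)

theorem fieldStar_algebraMap (m : ℝ) (c : ℂ) :
    fieldStar m (algebraMap ℂ (FieldAlgebra m) c)
      = algebraMap ℂ (FieldAlgebra m) (starRingEnd ℂ c) :=
  congrArg MulOpposite.unop ((starHom m).commutes c)

theorem fieldStar_mul (m : ℝ) (a b : FieldAlgebra m) :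
    fieldStar m (a * b) = fieldStar m b * fieldStar m a :=
  congrArg MulOpposite.unop (map_mul (starHom m) a b)

theorem fieldStar_add (m : ℝ) (a b : FieldAlgebra m) :
    fieldStar m (a + b) = fieldStar m a + fieldStar m b :=
  congrArg MulOpposite.unop (map_add (starHom m) a b)

/-- The `*`-algebra structure with `φ(f)^* = φ(f̄)`. -/
instance (m : ℝ) : StarRing (FieldAlgebra m) where
  star := fieldStar m
  star_involutive a := by
    induction a using field_induction with
    | h_scalar c => rw [fieldStar_algebraMap, fieldStar_algebraMap, Complex.conj_conj]
    | h_field f =>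
      rw [fieldStar_field, fieldStar_field]
      congr 1
      ext x
      exact Complex.conj_conj _
    | h_mul a b ha hb => rw [fieldStar_mul, fieldStar_mul, ha, hb]
    | h_add a b ha hb => rw [fieldStar_add, fieldStar_add, ha, hb]
  star_mul := fieldStar_mul m
  star_add := fieldStar_add m

instance (m : ℝ) : StarModule ℂ (FieldAlgebra m) where
  star_smul c a := by
    rw [Algebra.smul_def, star_mul, Algebra.smul_def]
    change _ * fieldStar m (algebraMap ℂ _ c) = _
    rw [fieldStar_algebraMap]
    exact (Algebra.commutes (starRingEnd ℂ c) (star a)).symm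

/-- The space-time translation `τ_{(1,a)}`, the endomorphism of the algebra of local fields with
`τ_{(1,a)} φ(f) = φ(f(· - a))`. -/
def translation (m : ℝ) (a : Spacetime) : FieldAlgebra m →ₐ[ℂ] FieldAlgebra m :=
  liftField (fun f => field m (translate a f))
    (fun f g => field_add m (translate a f) (translate a g))
    (fun c f => field_smul m c (translate a f))
    (fun f => by rw [← kleinGordon_translate, field_kleinGordon])
    (fun f g => by rw [field_ccr, causalPropagator_translate])

theorem translation_field (m : ℝ) (a : Spacetime) (f : Test) :
    translation m a (field m f) = field m (translate a f) :=
  liftField_field _ _ _ _ _ f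

/-! ### States -/

/-- `T` is the `n`-point distribution of the functional `ω`:
`T(f₁ ⊗ ⋯ ⊗ fₙ) = ω(φ(f₁) ⋯ φ(fₙ))`. -/
def IsNPointDistribution {m : ℝ} (ω : FieldAlgebra m →ₗ[ℂ] ℂ) (n : ℕ)
    (T : 𝓓((⊤ : Opens (Fin n → Spacetime)), ℂ) →L[ℂ] ℂ) : Prop :=
  ∀ f : Fin n → Test, T (tensor f) = ω (List.ofFn fun i => field m (f i)).prod

/-- A state: a normalized positive linear functional whose `n`-point functions are
distributions. -/
structure IsState {m : ℝ} (ω : FieldAlgebra m →ₗ[ℂ] ℂ) : Prop where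
  map_one : ω 1 = 1
  nonneg : ∀ A, 0 ≤ ω (star A * A)
  distribution : ∀ n, ∃ T, IsNPointDistribution ω n T

/-- The KMS condition at inverse temperature `β` with respect to the time evolution
`α_t = τ_{(1,te)}` in the time direction `e`. -/
def IsKMS {m : ℝ} (ω : FieldAlgebra m →ₗ[ℂ] ℂ) (β : ℝ) (e : Spacetime) : Prop :=
  ∀ A B : FieldAlgebra m, ∃ F : ℂ → ℂ,
    DifferentiableOn ℂ F {z | 0 < z.im ∧ z.im < β} ∧
    ContinuousOn F {z | 0 ≤ z.im ∧ z.im ≤ β} ∧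
    (∀ t : ℝ, F t = ω (A * translation m (t • e) B)) ∧
    (∀ t : ℝ, F (t + β * Complex.I) = ω (translation m (t • e) B * A))

/-- Invariance of a functional under all space-time translations. -/
def IsTranslationInvariant {m : ℝ} (ω : FieldAlgebra m →ₗ[ℂ] ℂ) : Prop :=
  ∀ (a : Spacetime) (A : FieldAlgebra m), ω (translation m a A) = ω A

/-! ### The relative-variable two-point function -/

/-- A sequence of mollifiers: nonnegative test functions of integral one whose supports shrink
to the origin. -/
def IsDeltaSequence {V : Type*} [NormedAddCommGroup V] [NormedSpace ℝ V] [MeasureSpace V]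
    (χ : ℕ → 𝓓((⊤ : Opens V), ℂ)) : Prop :=
  (∀ n x, 0 ≤ χ n x) ∧ (∀ n, ∫ x, χ n x = 1) ∧
    ∀ r > 0, ∀ᶠ n in atTop, tsupport (χ n) ⊆ Metric.ball 0 r

/-- `u = κ^* T` in the sense of distributions, for a map `κ` from spacetime and a distribution `T`
on `V`: the pullbacks along `κ` of the smooth regularizations `T * χₙ`, where
`(T * χₙ)(x) = T(y ↦ χₙ(x - y))`, converge to `u`, for every sequence of mollifiers `χₙ`. -/
def IsPullback {V : Type*} [NormedAddCommGroup V] [NormedSpace ℝ V] [MeasureSpace V]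
    (κ : Spacetime → V) (T : 𝓓((⊤ : Opens V), ℂ) →L[ℂ] ℂ) (u : 𝓢'(Spacetime, ℂ)) : Prop :=
  ∀ χ : ℕ → 𝓓((⊤ : Opens V), ℂ), IsDeltaSequence χ →
    ∀ h : 𝓢(Spacetime, ℂ), HasCompactSupport h →
      Tendsto (fun n => ∫ z, T (reflect (κ z) (χ n)) * h z) atTop (𝓝 (u h))

/-- The map `κ_q : z ↦ (q - z/2, q + z/2)`. -/
def relativePoints (q z : Spacetime) : Fin 2 → Spacetime :=
  ![q - (1 / 2 : ℝ) • z, q + (1 / 2 : ℝ) • z]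

/-- `w` is the relative-variable two-point function of `ω` at `q`, the pullback `κ_q^* ω₂` of the
two-point distribution `ω₂`, formally `w(z) = ω(φ(q - z/2) φ(q + z/2))`. -/
def IsRelativeTwoPoint {m : ℝ} (ω : FieldAlgebra m →ₗ[ℂ] ℂ) (q : Spacetime)
    (w : 𝓢'(Spacetime, ℂ)) : Prop :=
  ∃ T : 𝓓((⊤ : Opens (Fin 2 → Spacetime)), ℂ) →L[ℂ] ℂ,
    IsNPointDistribution ω 2 T ∧ IsPullback (relativePoints q) T w

/-- The reflection `h⁻(z) = h(-z)` of a Schwartz function. -/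
def reflectSchwartz (h : 𝓢(Spacetime, ℂ)) : 𝓢(Spacetime, ℂ) :=
  SchwartzMap.compCLMOfContinuousLinearEquiv ℂ (ContinuousLinearEquiv.neg ℝ) h

/-! ### The flat tube -/

/-- The complex point `z + iσe`. -/
def tubePoint (e : Spacetime) (z : Spacetime) (σ : ℝ) : ComplexSpacetime :=
  WithLp.toLp 2 fun μ => (z μ : ℂ) + (σ * e μ : ℝ) * Complex.I

/-- The flat tube `{z + iσe | z ∈ ℝ⁴, 0 < σ < β}`. -/
def flatTube (β : ℝ) (e : Spacetime) : Set ComplexSpacetime :=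
  {ζ | ∃ z σ, 0 < σ ∧ σ < β ∧ ζ = tubePoint e z σ}

end KleinGordon

end

open KleinGordon

/-! Everything is read off from one positive measure `μ` on momentum space. In the GNS space of `ω`
the field vectors `u f` satisfy `⟪u f, u g⟫ = ω(φ(f)* φ(g))`. Translation invariance makes `a ↦ ⟪u
f, u (translate a f)⟫` positive definite, hence the characteristic function of a finite measure.
These measures fit together to a tempered `μ` with `ω(φ(f)* φ(g)) = ∫ conj(ft f) ft g dμ`
(`exists_twoPoint_measure`). Pairings `⟨p,x⟩` are Euclidean: `p` is a covector, and `⟨p,e⟩` is its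
energy in the direction `e`. The distribution is `w(h) = ∫ ft h dμ` and the function is `F(ζ) = ∫
exp(i p·ζ) dμ(p)`.

Two properties of `μ` carry the theorem. The field equation puts `μ` on the mass shell
(`ae_minkowski_eq`), where the energy controls all momenta: `‖p‖ ≤ 4 e₀ |⟨p,e⟩|`. The KMS condition
gives detailed balance, `exp(-β⟨p,e⟩) dμ(p) = dμ(-p)` (`withDensity_exp_eq_map_neg`). The KMS
functions come without growth bounds in the strip. Positivity replaces such bounds: by a Landau-type
argument, a positive measure whose characteristic function continues to the closed strip has
exponential moments up to order `β` (`integrable_exp_of_strip`).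

At height `σ` the integrand of `F` has modulus `exp(-σ⟨p,e⟩)`, whatever `z` is. For `0 < σ < β` this
decays relative to `μ` at positive energy and, by detailed balance, relative to the reflected
measure at negative energy; on the mass shell this is decay in `‖p‖`. Hence `F` is analytic in all
four variables and bounded over compact sets of heights. Both boundary values follow by dominated
convergence with the majorant `1 + exp(-β⟨p,e⟩)`; at `σ = β` detailed balance turns the weight into
the reflection `p ↦ -p`. -/

noncomputable section

namespace KleinGordon

open scoped FourierTransform

/-! ### Bochner's theorem for continuous positive definite functions -/

section Bochner

variable {V : Type*} [NormedAddCommGroup V] [InnerProductSpace ℝ V] [FiniteDimensional ℝ V]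
  [MeasurableSpace V] [BorelSpace V]
  {H : Type*} [NormedAddCommGroup H] [InnerProductSpace ℂ H] [CompleteSpace H]

theorem inner_integral_smul_integral_smul {g h : V → ℂ} {u v : V → H}
    (hg : Integrable fun b => g b • u b) (hh : Integrable fun a => h a • v a) :
    inner ℂ (∫ b, g b • u b) (∫ a, h a • v a)
      = ∫ b, ∫ a, starRingEnd ℂ (g b) * h a * inner ℂ (u b) (v a) := by
  rw [← inner_conj_symm, ← integral_inner hg, ← integral_conj]
  refine integral_congr_ae (Eventually.of_forall fun b => ?_)
  simp only
  rw [inner_conj_symm, ← integral_inner hh]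
  refine integral_congr_ae (Eventually.of_forall fun a => ?_)
  simp only [inner_smul_left, inner_smul_right]
  ring

/-- Fatou's lemma, in the form that turns bounds on approximating integrals into integrability of
the limit. -/
theorem integrable_of_tendsto_of_integral_le {α : Type*} [MeasurableSpace α] {μ : Measure α}
    {G : ℕ → α → ℝ} {f : α → ℝ} {C : ℝ} (hG : ∀ n, Integrable (G n) μ) (hG0 : ∀ n x, 0 ≤ G n x)
    (hlim : ∀ x, Tendsto (fun n => G n x) atTop (𝓝 (f x)))
    (hC : ∀ᶠ n in atTop, ∫ x, G n x ∂μ ≤ C) : Integrable f μ := by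
  have hf0 : ∀ x, 0 ≤ f x := fun x => ge_of_tendsto' (hlim x) fun n => hG0 n x
  refine ⟨aestronglyMeasurable_of_tendsto_ae _ (fun n => (hG n).1)
    (Eventually.of_forall hlim), ?_⟩
  have h1 : ∫⁻ x, ‖f x‖ₑ ∂μ ≤ liminf (fun n => ∫⁻ x, ‖G n x‖ₑ ∂μ) atTop := by
    have := lintegral_liminf_le' (μ := μ) (u := atTop)
      (fun n => (hG n).1.aemeasurable.enorm)
    refine le_trans (le_of_eq (lintegral_congr fun x => ?_)) this
    exact (hlim x).enorm.liminf_eq.symm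
  have h2 : liminf (fun n => ∫⁻ x, ‖G n x‖ₑ ∂μ) atTop ≤ ENNReal.ofReal C := by
    refine liminf_le_of_frequently_le' (Eventually.frequently ?_)
    filter_upwards [hC] with n hn
    rw [← ofReal_integral_norm_eq_lintegral_enorm (hG n)]
    refine ENNReal.ofReal_le_ofReal (le_trans (le_of_eq ?_) hn)
    exact integral_congr_ae (Eventually.of_forall fun x => Real.norm_of_nonneg (hG0 n x))
  exact (h1.trans h2).trans_lt ENNReal.ofReal_lt_top

/-- The Gaussian means `∫ exp(-‖w‖²/c) g(w) dw` tend to `f 0` as `c → ∞`. Since `g ≥ 0` they are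
positive and eventually bounded, and Fatou's lemma applies. This is what permits Fourier inversion
in Bochner's theorem. -/
theorem integrable_fourier_of_nonneg {f : V → ℂ} (hf : Integrable f) (hf0 : ContinuousAt f 0)
    {g : V → ℝ} (hg : ∀ q, 0 ≤ g q) (hfg : ∀ q, 𝓕 f q = g q) : Integrable g := by
  have hcont : Continuous g := by
    have : Continuous (𝓕 f) :=
      VectorFourier.fourierIntegral_continuous Real.continuous_fourierChar continuous_inner hf
    have h2 : g = fun q => (𝓕 f q).re := by ext q; simp [hfg]
    rw [h2]; exact Complex.continuous_re.comp this
  have B : Tendsto (fun c : ℝ => ∫ w : V, Complex.exp (- (c : ℂ)⁻¹ * ‖w‖ ^ 2) * 𝓕 f w) atTop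
      (𝓝 (f 0)) := by
    refine (Real.tendsto_integral_gaussian_smul' hf hf0).congr' ?_
    filter_upwards [Ioi_mem_atTop 0] with c (hc : 0 < c)
    have J : Integrable (fun w : V => Complex.exp (- (c : ℂ)⁻¹ * ‖w‖ ^ 2)) := by
      simpa using GaussianFourier.integrable_cexp_neg_mul_sq_norm_add (V := V)
        (b := (c : ℂ)⁻¹) (by simpa using hc) 0 0
    have := VectorFourier.integral_fourierIntegral_smul_eq_flip (L := innerₗ V)
      Real.continuous_fourierChar continuous_inner J hf
    have h2 := fun w => fourier_gaussian_innerProductSpace (V := V) (b := (c : ℂ)⁻¹)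
      (by simpa using hc) w
    simp only [smul_eq_mul] at this ⊢
    refine Eq.trans ?_ (this.trans ?_)
    · refine integral_congr_ae (Eventually.of_forall fun w => ?_)
      have h3 := h2 w
      change _ = (𝓕 (fun w : V => Complex.exp (- (c : ℂ)⁻¹ * ‖w‖ ^ 2)) w) * f w
      simp only [h3]
      congr 2
      · simp
      · rw [zero_sub, norm_neg, div_inv_eq_mul]; ring_nf
    · refine integral_congr_ae (Eventually.of_forall fun w => ?_)
      simp only [flip_innerₗ]
      rfl
  have hbdd : ∀ q, ‖g q‖ ≤ ∫ v, ‖f v‖ := fun q => by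
    have := VectorFourier.norm_fourierIntegral_le_integral_norm Real.fourierChar volume
      (innerₗ V) f q
    have h2 : ‖g q‖ = ‖𝓕 f q‖ := by rw [hfg, Complex.norm_real]
    rw [h2]; exact this
  have hJ : ∀ c : ℝ, 0 < c → Integrable (fun w : V => Real.exp (- c⁻¹ * ‖w‖ ^ 2)) := by
    intro c hc
    have J : Integrable (fun w : V => Complex.exp (- (c : ℂ)⁻¹ * ‖w‖ ^ 2)) := by
      simpa using GaussianFourier.integrable_cexp_neg_mul_sq_norm_add (V := V)
        (b := (c : ℂ)⁻¹) (by simpa using hc) 0 0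
    refine J.re.congr (Eventually.of_forall fun w => ?_)
    simp only [← Complex.ofReal_inv, ← Complex.ofReal_neg, ← Complex.ofReal_pow,
      ← Complex.ofReal_mul, ← Complex.ofReal_exp]
    rfl
  have B' := ((Complex.continuous_re.tendsto _).comp B).comp
    ((tendsto_natCast_atTop_atTop (R := ℝ)).comp (tendsto_add_atTop_nat 1))
  refine integrable_of_tendsto_of_integral_le (C := (f 0).re + 1)
    (G := fun n w => Real.exp (- ((n + 1 : ℕ) : ℝ)⁻¹ * ‖w‖ ^ 2) * g w) ?_ ?_ ?_ ?_
  · intro n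
    exact (hJ _ (by positivity)).mul_bdd (c := ∫ v, ‖f v‖) hcont.aestronglyMeasurable
      (Eventually.of_forall hbdd)
  · intro n w
    exact mul_nonneg (Real.exp_pos _).le (hg w)
  · intro w
    have h0 : Tendsto (fun n : ℕ => ((n + 1 : ℕ) : ℝ)⁻¹) atTop (𝓝 0) :=
      (tendsto_inv_atTop_zero.comp (tendsto_natCast_atTop_atTop (R := ℝ))).comp
        (tendsto_add_atTop_nat 1)
    have : Tendsto (fun n : ℕ => Real.exp (- ((n + 1 : ℕ) : ℝ)⁻¹ * ‖w‖ ^ 2) * g w) atTop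
        (𝓝 (Real.exp (-0 * ‖w‖ ^ 2) * g w)) :=
      ((Real.continuous_exp.tendsto _).comp (h0.neg.mul_const _)).mul_const _
    simpa using this
  · filter_upwards [B'.eventually (gt_mem_nhds (lt_add_one (f 0).re))] with n hn
    refine le_of_eq_of_le ?_ hn.le
    simp only [Function.comp_apply]
    rw [← Complex.ofReal_re (∫ _, _), ← integral_complex_ofReal]
    congr 1
    refine integral_congr_ae (Eventually.of_forall fun w => ?_)
    simp [hfg]

theorem norm_eq_norm_zero_of_inner_sub {V : Type*} [AddGroup V]
    {H : Type*} [NormedAddCommGroup H] [InnerProductSpace ℂ H] {v : V → H} {Φ : V → ℂ}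
    (hΦ : ∀ a b, inner ℂ (v b) (v a) = Φ (a - b)) (a : V) : ‖v a‖ = ‖v 0‖ := by
  have h1 := hΦ a a
  have h2 := hΦ 0 0
  rw [sub_self] at h1 h2
  rw [← h2, inner_self_eq_norm_sq_to_K, inner_self_eq_norm_sq_to_K] at h1
  have : ‖v a‖ ^ 2 = ‖v 0‖ ^ 2 := by exact_mod_cast h1
  exact (sq_eq_sq₀ (norm_nonneg _) (norm_nonneg _)).1 this

/-- Up to a positive constant this Fourier transform is the squared norm of the vector `∫ g(b) v(b)
db`, for a Gaussian times a character `g`. -/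
theorem fourier_gaussian_mul_nonneg {v : V → H} (hv : Continuous v) {Φ : V → ℂ}
    (hΦ : ∀ a b, inner ℂ (v b) (v a) = Φ (a - b)) {ε : ℝ} (hε : 0 < ε) (q : V) :
    ∃ r : ℝ, 0 ≤ r ∧ 𝓕 (fun a => Complex.exp (-ε * ‖a‖ ^ 2) * Φ a) q = r := by
  have hbd := norm_eq_norm_zero_of_inner_sub hΦ
  have hΦc : Continuous Φ := by
    have : Φ = fun a => inner ℂ (v 0) (v a) := by ext a; simp [hΦ]
    rw [this]; fun_prop
  have hΦb : ∀ a, ‖Φ a‖ ≤ ‖v 0‖ ^ 2 := fun a => by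
    have h := norm_inner_le_norm (𝕜 := ℂ) (v 0) (v a)
    rwa [hΦ, hbd a, sub_zero, ← sq] at h
  have gint : ∀ {b : ℝ}, 0 < b → Integrable fun a : V => Complex.exp (-b * ‖a‖ ^ 2) := by
    intro b hb
    simpa using GaussianFourier.integrable_cexp_neg_mul_sq_norm_add (V := V)
        (b := (b : ℂ)) (by simpa using hb) 0 0
  set ch : V → ℂ := fun a => Complex.exp (((-2 * Real.pi * inner ℝ a q : ℝ) : ℂ) * Complex.I)
  have hch : ∀ a, ‖ch a‖ = 1 := fun a => Complex.norm_exp_ofReal_mul_I _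
  have hchc : Continuous ch := by fun_prop
  -- The width `2ε` is chosen because `2ε(‖b‖² + ‖s + b‖²) = 4ε‖b + s/2‖² + ε‖s‖²`: integrating over
  -- `b` leaves the constant `c` and the wanted factor `exp(-ε‖s‖²)`.
  set g : V → ℂ := fun a => Complex.exp (-(2 * ε : ℝ) * ‖a‖ ^ 2) * ch a with hg
  have hgc : Continuous g := by fun_prop
  have hgi : Integrable g :=
    (gint (by positivity)).mul_bdd (c := 1) hchc.aestronglyMeasurable
      (Eventually.of_forall fun a => (hch a).le)
  have hgv : Integrable fun a => g a • v a :=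
    hgi.smul_bdd ‖v 0‖ hv.aestronglyMeasurable
      (Eventually.of_forall fun a => (hbd a).le)
  set c : ℝ := ∫ b : V, Real.exp (-(4 * ε) * ‖b‖ ^ 2) with hc
  have hc' : (∫ b : V, Complex.exp (-(4 * ε : ℝ) * ‖b‖ ^ 2)) = c := by
    rw [hc, ← integral_complex_ofReal]
    push_cast
    rfl
  have hcpos : 0 < c := by
    rw [hc, GaussianFourier.integral_rexp_neg_mul_sq_norm (by positivity)]
    positivity
  have key : inner ℂ (∫ b, g b • v b) (∫ a, g a • v a)
      = c * 𝓕 (fun a => Complex.exp (-ε * ‖a‖ ^ 2) * Φ a) q := by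
    rw [inner_integral_smul_integral_smul hgv hgv]
    have h1 : ∀ b, ∫ a, starRingEnd ℂ (g b) * g a * inner ℂ (v b) (v a)
        = ∫ s, starRingEnd ℂ (g b) * g (s + b) * Φ s := fun b => by
      rw [← integral_add_right_eq_self _ b]
      simp [hΦ]
    simp only [h1]
    have h2 : Integrable (fun x : V × V => starRingEnd ℂ (g x.1) * g (x.2 + x.1) * Φ x.2)
        (volume.prod volume) := by
      have hi : Integrable (fun x : V × V => starRingEnd ℂ (g x.1) * g (x.2 + x.1))
          (volume.prod volume) := by
        have h3 : Integrable (fun x : V × V => starRingEnd ℂ (g x.1) * g x.2)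
            (volume.prod volume) :=
          Integrable.mul_prod
            ((Complex.conjCLE : ℂ →L[ℝ] ℂ).integrable_comp hgi) hgi
        have h4 := (measurePreserving_prod_add (volume : Measure V) (volume : Measure V))
        have h5 := h4.integrable_comp_of_integrable h3
        refine h5.congr (Eventually.of_forall fun x => ?_)
        simp [add_comm]
      refine hi.mul_bdd (c := ‖v 0‖ ^ 2) (hΦc.comp continuous_snd).aestronglyMeasurable
        (Eventually.of_forall fun x => hΦb _)
    rw [integral_integral_swap h2, Real.fourier_eq', ← integral_const_mul]
    refine integral_congr_ae (Eventually.of_forall fun s => ?_)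
    simp only [smul_eq_mul]
    rw [integral_mul_const]
    have h6 : ∀ b, starRingEnd ℂ (g b) * g (s + b) = Complex.exp (-(4 * ε : ℝ) * ‖b + (1/2 : ℝ) • s‖ ^ 2)
        * (Complex.exp (-ε * ‖s‖ ^ 2) * ch s) := by
      intro b
      have e1 : ‖b + (1/2 : ℝ) • s‖ ^ 2 = ‖b‖ ^ 2 + inner ℝ b s + ‖s‖ ^ 2 / 4 := by
        rw [norm_add_sq_real, inner_smul_right, norm_smul, mul_pow]
        norm_num; ring
      have e2 : ‖s + b‖ ^ 2 = ‖s‖ ^ 2 + 2 * inner ℝ b s + ‖b‖ ^ 2 := by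
        rw [norm_add_sq_real, real_inner_comm]
      simp only [hg, ch, ← Complex.exp_conj, ← Complex.exp_add, ← Complex.ofReal_pow, e1, e2,
        inner_add_left]
      congr 1
      simp only [map_add, map_neg, map_mul, Complex.conj_ofReal, Complex.conj_I]
      push_cast
      ring
    simp only [h6]
    rw [integral_mul_const, integral_add_right_eq_self
      (fun b : V => Complex.exp (-(4 * ε : ℝ) * ‖b‖ ^ 2)), hc']
    simp only [ch]
    ring
  refine ⟨c⁻¹ * ‖∫ b, g b • v b‖ ^ 2, by positivity, ?_⟩
  rw [inner_self_eq_norm_sq_to_K] at key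
  push_cast
  rw [eq_inv_mul_iff_mul_eq₀ (by exact_mod_cast hcpos.ne'), ← key]
  rfl

/-- `Φ` times a Gaussian has a nonnegative integrable Fourier transform, so after normalization it
is the characteristic function of a probability measure. As the Gaussian widens, these measures are
tight because their characteristic functions converge to a continuous limit. By Prokhorov they have
a cluster point. -/
theorem exists_measure_charFun_eq {v : V → H} (hv : Continuous v) {Φ : V → ℂ}
    (hΦ : ∀ a b, inner ℂ (v b) (v a) = Φ (a - b)) :
    ∃ ν : Measure V, IsFiniteMeasure ν ∧ ∀ a, charFun ν a = Φ a := by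
  have hΦc : Continuous Φ := by
    have : Φ = fun a => inner ℂ (v 0) (v a) := by ext a; simp [hΦ]
    rw [this]; fun_prop
  have hΦ0 : Φ 0 = (‖v 0‖ ^ 2 : ℝ) := by
    have h := hΦ 0 0
    rw [sub_self, inner_self_eq_norm_sq_to_K] at h
    rw [← h]; push_cast; rfl
  have hbd := norm_eq_norm_zero_of_inner_sub hΦ
  have hΦb : ∀ a, ‖Φ a‖ ≤ ‖v 0‖ ^ 2 := fun a => by
    have h := norm_inner_le_norm (𝕜 := ℂ) (v 0) (v a)
    rwa [hΦ, hbd a, sub_zero, ← sq] at h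
  rcases (norm_nonneg (v 0)).eq_or_lt with h0 | h0
  · refine ⟨0, inferInstance, fun a => ?_⟩
    have := hΦb a
    rw [← h0] at this
    simpa [eq_comm] using this
  set c : ℝ := ‖v 0‖ ^ 2 with hc
  have hcpos : 0 < c := by positivity
  have main : ∀ n : ℕ, ∃ μ : ProbabilityMeasure V, ∀ a,
      charFun (μ : Measure V) a = Complex.exp (-(((n + 1 : ℕ) : ℝ)⁻¹ : ℝ) * ‖a‖ ^ 2) * Φ a / c := by
    intro n
    set ε : ℝ := ((n + 1 : ℕ) : ℝ)⁻¹ with hε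
    have hεpos : 0 < ε := by positivity
    choose g hg0 hg using fourier_gaussian_mul_nonneg hv hΦ hεpos
    set f : V → ℂ := fun a => Complex.exp (-ε * ‖a‖ ^ 2) * Φ a with hf
    have hfc : Continuous f := by fun_prop
    have hfi : Integrable f := by
      have J : Integrable fun a : V => Complex.exp (-ε * ‖a‖ ^ 2) := by
        simpa using GaussianFourier.integrable_cexp_neg_mul_sq_norm_add (V := V)
          (b := (ε : ℂ)) (by simpa using hεpos) 0 0
      exact J.mul_bdd (c := c) hΦc.aestronglyMeasurable (Eventually.of_forall hΦb)
    have hgi : Integrable g := integrable_fourier_of_nonneg hfi hfc.continuousAt hg0 hg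
    have hinv : 𝓕⁻ (fun q => (g q : ℂ)) = f := by
      have h1 : 𝓕 f = fun q => (g q : ℂ) := funext hg
      rw [← h1]
      exact hfc.fourierInv_fourier_eq hfi (h1 ▸ hgi.ofReal)
    -- The dilation by `2π` converts the kernel `exp(2πi⟨q,a⟩)` of Fourier inversion into the kernel
    -- `exp(i⟨q,a⟩)` of `charFun`; dividing by `c = Φ 0` gives total mass one.
    set μ : Measure V := ((volume : Measure V).withDensity
      fun q => ENNReal.ofReal (g q / c)).map ((2 * Real.pi) • ·) with hμ
    have hchar : ∀ a, charFun μ a = f a / c := by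
      intro a
      have hd : ∀ q, 0 ≤ g q / c := fun q => div_nonneg (hg0 q) hcpos.le
      rw [hμ, charFun_map_smul, charFun_apply,
        integral_withDensity_eq_integral_toReal_smul₀
          ((hgi.1.aemeasurable.div_const c).ennreal_ofReal)
          (Eventually.of_forall fun _ => ENNReal.ofReal_lt_top), ← hinv, Real.fourierInv_eq',
        ← integral_div]
      refine integral_congr_ae (Eventually.of_forall fun q => ?_)
      simp only [ENNReal.toReal_ofReal (hd q), inner_smul_right, Complex.real_smul, smul_eq_mul]
      push_cast
      ring
    have : IsFiniteMeasure (volume.withDensity fun q : V => ENNReal.ofReal (g q / c)) :=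
      isFiniteMeasure_withDensity_ofReal (hgi.div_const c).2
    have hfin : IsFiniteMeasure μ := by rw [hμ]; infer_instance
    have hprob : IsProbabilityMeasure μ := by
      refine ⟨?_⟩
      have h1 := hchar 0
      rw [charFun_zero] at h1
      have h2 : μ.real Set.univ = 1 := by
        have : f 0 / c = (1 : ℝ) := by
          simp only [hf, hΦ0]
          simp [hcpos.ne']
        rw [this] at h1
        exact_mod_cast h1
      rw [← ENNReal.ofReal_toReal (measure_ne_top μ Set.univ)]
      rw [Measure.real] at h2
      rw [h2, ENNReal.ofReal_one]
    exact ⟨⟨μ, hprob⟩, hchar⟩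
  choose μ hμ using main
  have hlim : ∀ a, Tendsto (fun n => charFun (μ n : Measure V) a) atTop (𝓝 (Φ a / c)) := by
    intro a
    have h0 : Tendsto (fun n : ℕ => ((n + 1 : ℕ) : ℝ)⁻¹) atTop (𝓝 0) :=
      (tendsto_inv_atTop_zero.comp (tendsto_natCast_atTop_atTop (R := ℝ))).comp
        (tendsto_add_atTop_nat 1)
    have h1 : Continuous fun ε : ℝ => Complex.exp (-(ε : ℂ) * ‖a‖ ^ 2) * Φ a / c := by fun_prop
    have h2 := (h1.tendsto 0).comp h0
    simp only [Complex.ofReal_zero, neg_zero, zero_mul, Complex.exp_zero, one_mul] at h2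
    refine h2.congr fun n => (hμ n a).symm
  have htight : IsTightMeasureSet (Set.range fun n => (μ n : Measure V)) :=
    isTightMeasureSet_of_tendsto_charFun (hΦc.div_const _).continuousAt hlim
  have hcomp : IsCompact (closure (Set.range μ)) := by
    refine isCompact_closure_of_isTightMeasureSet ?_
    convert! htight using 1
    ext ν
    simp
  -- A nonprincipal ultrafilter replaces the extraction of a convergent subsequence.
  obtain ⟨ν, -, hν⟩ := hcomp.ultrafilter_le_nhds ((hyperfilter ℕ).map μ)
    (le_trans (by simp) (monotone_principal subset_closure))
  have hν' : Tendsto μ (hyperfilter ℕ) (𝓝 ν) := hν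
  refine ⟨c.toNNReal • (ν : Measure V), inferInstance, fun a => ?_⟩
  have h1 : Tendsto (fun n => charFun (μ n : Measure V) a) (hyperfilter ℕ)
      (𝓝 (charFun (ν : Measure V) a)) := by
    rw [ProbabilityMeasure.tendsto_iff_forall_integral_rclike_tendsto ℂ] at hν'
    simp_rw [charFun_eq_integral_innerProbChar]
    exact hν' (BoundedContinuousFunction.innerProbChar a)
  have h2 := tendsto_nhds_unique h1 ((hlim a).mono_left Nat.hyperfilter_le_atTop)
  have h3 : charFun (c.toNNReal • (ν : Measure V)) a = c * charFun (ν : Measure V) a := by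
    rw [charFun_apply, charFun_apply, integral_smul_nnreal_measure, NNReal.smul_def,
      Real.coe_toNNReal _ hcpos.le, Complex.real_smul]
  rw [h3, h2, mul_div_cancel₀ _ (by exact_mod_cast hcpos.ne')]

/-- Smearing an orbit with spectral measure `ν` by `g` multiplies the spectral measure by `|ĝ|²`. -/
theorem inner_integral_orbit {v : V → H} (hv : Continuous v) {ν : Measure V} [IsFiniteMeasure ν]
    (hΦ : ∀ a b, inner ℂ (v b) (v a) = charFun ν (a - b)) {g : V → ℂ} (hg : Integrable g) (a : V) :
    inner ℂ (∫ b, g b • v b) (∫ b, g b • v (b + a))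
      = ∫ p, Complex.exp (inner ℝ p a * Complex.I)
          * ‖∫ x, g x * Complex.exp (inner ℝ p x * Complex.I)‖ ^ 2 ∂ν := by
  have hbd := norm_eq_norm_zero_of_inner_sub hΦ
  have hgv : ∀ a, Integrable fun b => g b • v (b + a) := fun a =>
    hg.smul_bdd ‖v 0‖ (hv.comp (continuous_add_const a)).aestronglyMeasurable
      (Eventually.of_forall fun b => (hbd _).le)
  have hexp : ∀ (p x : V), ‖Complex.exp (inner ℝ p x * Complex.I)‖ = 1 := fun p x =>
    Complex.norm_exp_ofReal_mul_I _
  rw [inner_integral_smul_integral_smul (by simpa using hgv 0) (hgv a)]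
  simp only [hΦ, charFun_apply]
  have i1 : Integrable (fun x : V × V => starRingEnd ℂ (g x.1) * g x.2)
      (volume.prod volume) :=
    Integrable.mul_prod ((Complex.conjCLE : ℂ →L[ℝ] ℂ).integrable_comp hg) hg
  have i2 : Integrable (fun x : (V × V) × V => starRingEnd ℂ (g x.1.1) * g x.1.2
      * Complex.exp (inner ℝ x.2 (x.1.2 + a - x.1.1) * Complex.I))
      ((volume.prod volume).prod ν) := by
    refine (i1.comp_fst ν).mul_bdd (c := 1)
      (Continuous.aestronglyMeasurable (by fun_prop)) (Eventually.of_forall fun x => ?_)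
    exact (hexp _ _).le
  have i3 : Integrable (fun x : V × V => ∫ p, starRingEnd ℂ (g x.1) * g x.2
      * Complex.exp (inner ℝ p (x.2 + a - x.1) * Complex.I) ∂ν) (volume.prod volume) :=
    i2.integral_prod_left
  calc _ = ∫ b, ∫ x, ∫ p, starRingEnd ℂ (g b) * g x
        * Complex.exp (inner ℝ p (x + a - b) * Complex.I) ∂ν := by
        simp only [integral_const_mul]
    _ = ∫ x : V × V, ∫ p, starRingEnd ℂ (g x.1) * g x.2
        * Complex.exp (inner ℝ p (x.2 + a - x.1) * Complex.I) ∂ν ∂(volume.prod volume) :=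
        (integral_prod _ i3).symm
    _ = ∫ p, ∫ x : V × V, starRingEnd ℂ (g x.1) * g x.2
        * Complex.exp (inner ℝ p (x.2 + a - x.1) * Complex.I) ∂(volume.prod volume) ∂ν :=
        integral_integral_swap i2
    _ = _ := by
        refine integral_congr_ae (Eventually.of_forall fun p => ?_)
        simp only
        rw [← Complex.conj_mul', ← integral_conj, ← integral_prod_mul, ← integral_const_mul]
        refine integral_congr_ae (Eventually.of_forall fun x => ?_)
        simp only [map_mul, ← Complex.exp_conj, Complex.conj_ofReal, Complex.conj_I,
          inner_sub_right, inner_add_right]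
        have : Complex.exp (((inner ℝ p x.2 + inner ℝ p a - inner ℝ p x.1 : ℝ) : ℂ) * Complex.I)
          = Complex.exp (inner ℝ p a * Complex.I) * (Complex.exp (inner ℝ p x.1 * -Complex.I)
            * Complex.exp (inner ℝ p x.2 * Complex.I)) := by
          rw [← Complex.exp_add, ← Complex.exp_add]
          congr 1
          push_cast
          ring
        rw [this]
        ring

end Bochner

/-! ### Continuation to a strip forces exponential moments -/

section Strip

open ProbabilityTheory

/-- A continuous function that is holomorphic off the real axis is holomorphic. -/
theorem differentiableOn_of_differentiableAt_off_real {G : ℂ → ℂ} {U : Set ℂ} (hU : IsOpen U)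
    (hc : ContinuousOn G U) (hd : ∀ z ∈ U, z.im ≠ 0 → DifferentiableAt ℂ G z) :
    DifferentiableOn ℂ G U := by
  refine (Complex.isConservativeOn_and_continuousOn_iff_isDifferentiableOn hU).1 ⟨?_, hc⟩
  intro z w hzw
  rw [← add_eq_zero_iff_eq_neg, Complex.wedgeIntegral_add_wedgeIntegral_eq]
  -- By Morera it suffices to integrate over rectangles. Cauchy's theorem needs only continuity on
  -- the boundary, so a rectangle that touches the real axis at most along an edge is covered. Any
  -- other is cut along the axis, and the two integrals along the cut cancel.
  have aux : ∀ z w : ℂ, Complex.Rectangle z w ⊆ U → (0 : ℝ) ∉ Set.Ioo (min z.im w.im) (max z.im w.im) →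
      (∫ x : ℝ in z.re..w.re, G (x + z.im * Complex.I)) -
      (∫ x : ℝ in z.re..w.re, G (x + w.im * Complex.I)) +
      Complex.I • (∫ y : ℝ in z.im..w.im, G (w.re + y * Complex.I)) -
      Complex.I • (∫ y : ℝ in z.im..w.im, G (z.re + y * Complex.I)) = 0 := by
    intro z w h h0
    refine Complex.integral_boundary_rect_eq_zero_of_continuousOn_of_differentiableOn G z w
      (hc.mono h) fun s hs => ?_
    refine (hd s (h ?_) fun him => h0 ?_).differentiableWithinAt
    · exact ⟨Set.Ioo_subset_Icc_self hs.1, Set.Ioo_subset_Icc_self hs.2⟩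
    · rw [← him]; exact hs.2
  by_cases h0 : (0 : ℝ) ∉ Set.Ioo (min z.im w.im) (max z.im w.im)
  · exact aux z w hzw h0
  rw [not_not] at h0
  have h0' : (0 : ℝ) ∈ Set.uIcc z.im w.im := Set.Ioo_subset_Icc_self h0
  have s1 : Set.uIcc z.im 0 ⊆ Set.uIcc z.im w.im := Set.uIcc_subset_uIcc_left h0'
  have s2 : Set.uIcc 0 w.im ⊆ Set.uIcc z.im w.im := Set.uIcc_subset_uIcc_right h0'
  have e1 := aux z ⟨w.re, 0⟩ (fun s hs => hzw ⟨hs.1, s1 hs.2⟩) (by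
    rintro ⟨a, b⟩; rcases le_total z.im 0 with h | h <;> simp_all)
  have e2 := aux ⟨z.re, 0⟩ w (fun s hs => hzw ⟨hs.1, s2 hs.2⟩) (by
    rintro ⟨a, b⟩; rcases le_total w.im 0 with h | h <;> simp_all)
  have hi : ∀ r ∈ Set.uIcc z.re w.re, ∀ a b : ℝ, Set.uIcc a b ⊆ Set.uIcc z.im w.im →
      IntervalIntegrable (fun y : ℝ => G (r + y * Complex.I)) volume a b := by
    intro r hr a b hab
    refine ContinuousOn.intervalIntegrable (hc.comp (by fun_prop) fun y hy => hzw ?_)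
    refine ⟨?_, ?_⟩
    · simpa using hr
    · simpa using hab hy
  have a1 := intervalIntegral.integral_add_adjacent_intervals
    (hi w.re Set.right_mem_uIcc _ _ s1) (hi w.re Set.right_mem_uIcc _ _ s2)
  have a2 := intervalIntegral.integral_add_adjacent_intervals
    (hi z.re Set.left_mem_uIcc _ _ s1) (hi z.re Set.left_mem_uIcc _ _ s2)
  rw [← a1, ← a2]
  simp only [smul_eq_mul] at e1 e2 ⊢
  linear_combination e1 + e2

theorem continuousOn_integral_exp_mul {ν : Measure ℝ} [IsFiniteMeasure ν] {S : Set ℂ}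
    (hS : ∀ s ∈ S, ∀ᵐ x ∂ν, s.re * x ≤ 0) : ContinuousOn (complexMGF id ν) S := by
  refine continuousOn_of_dominated (bound := fun _ => 1) (fun s _ => ?_) (fun s hs => ?_)
    (integrable_const _) (Eventually.of_forall fun x => ?_)
  · exact Continuous.aestronglyMeasurable (by fun_prop)
  · filter_upwards [hS s hs] with x hx
    rw [Complex.norm_exp]
    simpa using hx
  · exact Continuous.continuousOn (by fun_prop)

theorem integrable_exp_mul_of_ae_nonpos {ν : Measure ℝ} [IsFiniteMeasure ν] {t : ℝ}
    (h : ∀ᵐ x ∂ν, t * x ≤ 0) : Integrable (fun x => Real.exp (t * x)) ν := by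
  refine Integrable.mono' (integrable_const 1) (Continuous.aestronglyMeasurable (by fun_prop)) ?_
  filter_upwards [h] with x hx
  rw [Real.norm_of_nonneg (Real.exp_pos _).le]
  exact Real.exp_le_one_iff.2 hx

/-- A one-sided analogue of Landau's lemma: if the Laplace transform of a measure on the negative
half-line continues holomorphically to `-β < Re s`, it converges there. -/
theorem integrable_exp_of_differentiableOn {ν : Measure ℝ} [IsFiniteMeasure ν]
    (hν : ∀ᵐ x ∂ν, x ≤ 0) {β : ℝ} {f : ℂ → ℂ} (hf : DifferentiableOn ℂ f {s | -β < s.re})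
    (heq : ∀ s : ℂ, 0 < s.re → f s = complexMGF id ν s) {σ : ℝ} (hσ0 : 0 < σ) (hσ : σ < β) :
    Integrable (fun x => Real.exp (-σ * x)) ν ∧ f (-σ) = ∫ x, Real.exp (-σ * x) ∂ν := by
  have hint : (1 : ℂ).re ∈ interior (integrableExpSet id ν) := by
    refine mem_interior.2 ⟨Set.Ioi 0, fun t (ht : 0 < t) => ?_, isOpen_Ioi, by simp⟩
    refine integrable_exp_mul_of_ae_nonpos ?_
    filter_upwards [hν] with x hx using mul_nonpos_of_nonneg_of_nonpos ht.le hx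
  have hder : ∀ n, iteratedDeriv n f 1 = ∫ x, (x : ℂ) ^ n * Complex.exp (1 * x) ∂ν := by
    intro n
    have : f =ᶠ[𝓝 1] complexMGF id ν := by
      have : {s : ℂ | 0 < s.re} ∈ 𝓝 (1 : ℂ) :=
        (isOpen_lt continuous_const Complex.continuous_re).mem_nhds (by simp)
      filter_upwards [this] with s hs using heq s hs
    rw [this.iteratedDeriv_eq, iteratedDeriv_complexMGF hint]
    rfl
  -- The Taylor series of `f` at `1` converges in the whole disc that fits into the half-plane, and
  -- this disc contains `-σ`.
  have hball : DifferentiableOn ℂ f (Metric.ball 1 (1 + β)) := by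
    refine hf.mono fun s hs => ?_
    rw [Metric.mem_ball, dist_eq_norm] at hs
    have := (abs_le.1 (Complex.abs_re_le_norm (s - 1))).1
    simp only [Complex.sub_re, Complex.one_re] at this
    change -β < s.re
    linarith
  have hz : (-σ : ℂ) ∈ Metric.ball (1 : ℂ) (1 + β) := by
    rw [Metric.mem_ball, dist_eq_norm]
    have : (-σ - 1 : ℂ) = ((-(1 + σ) : ℝ) : ℂ) := by push_cast; ring
    rw [this, Complex.norm_real, norm_neg, Real.norm_of_nonneg (by positivity)]
    linarith
  have hsum := Complex.hasSum_taylorSeries_on_ball hball hz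
  -- The point is the sign: for `x ≤ 0` the term `(-σ - 1)ⁿ xⁿ` is nonnegative. The Taylor series at
  -- `-σ` is therefore a convergent series of integrals of nonnegative functions, and summing under
  -- the integral yields `exp(-σ x)`.
  set F : ℕ → ℝ → ℝ := fun n x => ((1 + σ) * |x|) ^ n / n.factorial * Real.exp x with hF
  have hF0 : ∀ n x, 0 ≤ F n x := fun n x => by positivity
  have hFint : ∀ n, Integrable (F n) ν := by
    intro n
    have := (integrable_pow_abs_mul_exp_of_mem_interior_integrableExpSet (X := id) (μ := ν)
      (v := 1) (by simpa using hint) n).const_mul ((1 + σ) ^ n / n.factorial)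
    refine this.congr (Eventually.of_forall fun x => ?_)
    simp only [hF, id, one_mul, mul_pow]
    ring
  have hterm : ∀ n, ((n.factorial : ℂ))⁻¹ • (-σ - 1 : ℂ) ^ n • iteratedDeriv n f 1
      = ((∫ x, F n x ∂ν : ℝ) : ℂ) := by
    intro n
    rw [hder, smul_smul, smul_eq_mul, ← integral_const_mul, ← integral_complex_ofReal]
    refine integral_congr_ae ?_
    filter_upwards [hν] with x hx
    simp only [hF, abs_of_nonpos hx]
    push_cast
    rw [one_mul, mul_pow, neg_pow (x : ℂ), show (-σ - 1 : ℂ) = -(1 + σ) by ring,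
      neg_pow (1 + σ : ℂ)]
    ring
  simp only [hterm] at hsum
  have hreal : HasSum (fun n => ∫ x, F n x ∂ν) (f (-σ)).re := by
    have := Complex.hasSum_re hsum
    simpa using this
  have hFsum : ∀ x, HasSum (fun n => F n x) (Real.exp ((1 + σ) * |x|) * Real.exp x) := by
    intro x
    have := (NormedSpace.expSeries_div_hasSum_exp ((1 + σ) * |x|)).mul_right (Real.exp x)
    rwa [← Real.exp_eq_exp_ℝ] at this
  have hI : Integrable (fun x => Real.exp ((1 + σ) * |x|) * Real.exp x) ν := by
    refine integrable_of_tendsto_of_integral_le (C := (f (-σ)).re)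
      (G := fun n x => ∑ k ∈ Finset.range n, F k x)
      (fun n => integrable_finsetSum _ fun k _ => hFint k)
      (fun n x => Finset.sum_nonneg fun k _ => hF0 k x)
      (fun x => (hFsum x).tendsto_sum_nat) (Eventually.of_forall fun n => ?_)
    rw [integral_finsetSum _ fun k _ => hFint k]
    exact sum_le_hasSum _ (fun k _ => integral_nonneg (hF0 k)) hreal
  have hae : ∀ᵐ x ∂ν, Real.exp ((1 + σ) * |x|) * Real.exp x = Real.exp (-σ * x) := by
    filter_upwards [hν] with x hx
    rw [← Real.exp_add, abs_of_nonpos hx]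
    ring_nf
  refine ⟨hI.congr hae, ?_⟩
  have h1 : HasSum (fun n => ∫ x, F n x ∂ν) (∫ x, ∑' n, F n x ∂ν) := by
    refine hasSum_integral_of_summable_integral_norm hFint ?_
    refine hreal.summable.congr fun n => ?_
    exact integral_congr_ae (Eventually.of_forall fun x => (Real.norm_of_nonneg (hF0 n x)).symm)
  have h2 : ∫ x, ∑' n, F n x ∂ν = ∫ x, Real.exp (-σ * x) ∂ν := by
    refine integral_congr_ae ?_
    filter_upwards [hae] with x hx
    rw [(hFsum x).tsum_eq, hx]
  rw [h2] at h1
  exact hsum.unique (Complex.hasSum_ofReal.2 h1) |>.symm ▸ rfl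

/-- If the characteristic function of a finite measure on `ℝ` continues to the strip
`0 < Im z < β`, continuously up to the boundary, then the measure has exponential moments up to
order `β`; no bound on the continuation is assumed. -/
theorem integrable_exp_of_strip {ν : Measure ℝ} [IsFiniteMeasure ν] {β : ℝ} (hβ : 0 < β)
    {F : ℂ → ℂ} (hd : DifferentiableOn ℂ F {z | 0 < z.im ∧ z.im < β})
    (hc : ContinuousOn F {z | 0 ≤ z.im ∧ z.im ≤ β}) (hF : ∀ t : ℝ, F t = charFun ν t) :
    Integrable (fun x => Real.exp (-β * x)) ν ∧
      F (β * Complex.I) = ∫ x, Real.exp (-β * x) ∂ν := by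
  set νp := ν.restrict (Set.Ici 0) with hνp
  set νm := ν.restrict (Set.Ici 0)ᶜ with hνm
  have hadd : ν = νp + νm := (Measure.restrict_add_restrict_compl measurableSet_Ici).symm
  have hp : ∀ᵐ x ∂νp, 0 ≤ x := ae_restrict_mem measurableSet_Ici
  have hm : ∀ᵐ x ∂νm, x ≤ 0 := by
    filter_upwards [ae_restrict_mem (μ := ν) (measurableSet_Ici (a := (0 : ℝ))).compl] with x hx
    exact (not_le.1 (show ¬ 0 ≤ x from hx)).le
  have cp : ContinuousOn (complexMGF id νp) {s | s.re ≤ 0} :=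
    continuousOn_integral_exp_mul fun s (hs : s.re ≤ 0) => by
      filter_upwards [hp] with x hx using mul_nonpos_of_nonpos_of_nonneg hs hx
  have cm : ContinuousOn (complexMGF id νm) {s | 0 ≤ s.re} :=
    continuousOn_integral_exp_mul fun s (hs : 0 ≤ s.re) => by
      filter_upwards [hm] with x hx using mul_nonpos_of_nonneg_of_nonpos hs hx
  have dp : DifferentiableOn ℂ (complexMGF id νp) {s | s.re < 0} := by
    refine differentiableOn_complexMGF.mono fun s (hs : s.re < 0) => ?_
    refine mem_interior.2 ⟨Set.Iio 0, fun t (ht : t < 0) => ?_, isOpen_Iio, hs⟩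
    refine integrable_exp_mul_of_ae_nonpos ?_
    filter_upwards [hp] with x hx using mul_nonpos_of_nonpos_of_nonneg ht.le hx
  have dm : DifferentiableOn ℂ (complexMGF id νm) {s | 0 < s.re} := by
    refine differentiableOn_complexMGF.mono fun s (hs : 0 < s.re) => ?_
    refine mem_interior.2 ⟨Set.Ioi 0, fun t (ht : 0 < t) => ?_, isOpen_Ioi, hs⟩
    refine integrable_exp_mul_of_ae_nonpos ?_
    filter_upwards [hm] with x hx using mul_nonpos_of_nonneg_of_nonpos ht.le hx
  have hre : ∀ z : ℂ, (Complex.I * z).re = -z.im := fun z => by simp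
  -- The part of `ν` on `x ≥ 0` has its transform in the upper half-plane, the part on `x < 0` in
  -- the lower one. On the real axis `F` is the sum of both, so `F` minus the first continues the
  -- second; gluing gives a function `G` holomorphic on all of `Im z < β`.
  set gp : ℂ → ℂ := fun z => F z - complexMGF id νp (Complex.I * z) with hgp
  set gm : ℂ → ℂ := fun z => complexMGF id νm (Complex.I * z) with hgm
  have hreal : ∀ z : ℂ, z.im = 0 → gp z = gm z := by
    intro z hz
    have hz' : z = (z.re : ℂ) := Complex.ext rfl (by simpa using hz)
    simp only [hgp, hgm]
    rw [sub_eq_iff_eq_add, hz', hF, mul_comm, complexMGF_id_mul_I, complexMGF_id_mul_I,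
      charFun_apply, charFun_apply, charFun_apply, add_comm, ← integral_add_measure, ← hadd]
    · refine Integrable.of_bound (C := 1) (Continuous.aestronglyMeasurable (by fun_prop))
        (Eventually.of_forall fun x => ?_)
      rw [Complex.norm_exp_ofReal_mul_I]
    · refine Integrable.of_bound (C := 1) (Continuous.aestronglyMeasurable (by fun_prop))
        (Eventually.of_forall fun x => ?_)
      rw [Complex.norm_exp_ofReal_mul_I]
  set U : Set ℂ := {z | z.im < β} with hUdef
  have hU : IsOpen U := isOpen_lt Complex.continuous_im continuous_const
  set G : ℂ → ℂ := fun z => if 0 ≤ z.im then gp z else gm z with hG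
  have hGc : ContinuousOn G U := by
    refine ContinuousOn.if (fun z hz => ?_) ?_ ?_
    · have := hz.2
      rw [Complex.frontier_setOfPred_le_im] at this
      exact hreal z this
    · have hcl : closure {z : ℂ | 0 ≤ z.im} = {z | 0 ≤ z.im} :=
        (isClosed_le continuous_const Complex.continuous_im).closure_eq
      rw [hcl]
      refine ContinuousOn.sub (hc.mono fun z hz => ⟨hz.2, hz.1.le⟩) ?_
      refine cp.comp (by fun_prop) fun z hz => ?_
      change (Complex.I * z).re ≤ 0
      rw [hre]
      linarith [show (0 : ℝ) ≤ z.im from hz.2]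
    · have hcl : closure {z : ℂ | ¬ 0 ≤ z.im} = {z | z.im ≤ 0} := by
        simp only [not_le]
        exact Complex.closure_setOfPred_im_lt 0
      rw [hcl]
      refine cm.comp (by fun_prop) fun z hz => ?_
      change 0 ≤ (Complex.I * z).re
      rw [hre]
      linarith [show z.im ≤ 0 from hz.2]
  have hGd : DifferentiableOn ℂ G U := by
    refine differentiableOn_of_differentiableAt_off_real hU hGc fun z hz hz0 => ?_
    rcases lt_or_gt_of_ne hz0 with h | h
    · have hev : G =ᶠ[𝓝 z] gm := by
        filter_upwards [(isOpen_lt Complex.continuous_im continuous_const).mem_nhds h] with y hy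
        exact if_neg (not_le.2 hy)
      refine DifferentiableAt.congr_of_eventuallyEq ?_ hev
      refine DifferentiableAt.comp (g := complexMGF id νm) z ?_
        (differentiableAt_id.const_mul Complex.I)
      refine dm.differentiableAt ((isOpen_lt continuous_const Complex.continuous_re).mem_nhds ?_)
      change 0 < (Complex.I * z).re
      rw [hre]
      linarith
    · have hev : G =ᶠ[𝓝 z] gp := by
        filter_upwards [(isOpen_lt continuous_const Complex.continuous_im).mem_nhds h] with y hy
        exact if_pos (le_of_lt hy)
      refine DifferentiableAt.congr_of_eventuallyEq ?_ hev
      refine DifferentiableAt.sub (hd.differentiableAt ?_)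
        (DifferentiableAt.comp (g := complexMGF id νp) z ?_
          (differentiableAt_id.const_mul Complex.I))
      · exact ((isOpen_lt continuous_const Complex.continuous_im).inter hU).mem_nhds ⟨h, hz⟩
      · refine dp.differentiableAt ((isOpen_lt Complex.continuous_re continuous_const).mem_nhds ?_)
        change (Complex.I * z).re < 0
        rw [hre]
        linarith
  have him : ∀ s : ℂ, (-Complex.I * s).im = -s.re := fun s => by simp
  have hσ : ∀ σ : ℝ, 0 < σ → σ < β → Integrable (fun x => Real.exp (-σ * x)) ν ∧
      F (σ * Complex.I) = ∫ x, Real.exp (-σ * x) ∂ν := by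
    intro σ h0 h1
    -- The rotation `z = -i s` carries `Im z < β` to `-β < Re s`. Only the negative half of `ν`
    -- needs the argument: on the other half `exp(-σ x) ≤ 1`.
    obtain ⟨im, em⟩ := integrable_exp_of_differentiableOn hm (β := β)
      (f := fun s => G (-Complex.I * s))
      (hGd.comp (by fun_prop) fun s hs => by
        change (-Complex.I * s).im < β
        rw [him]; linarith [show -β < s.re from hs])
      (fun s hs => by
        have : ¬ 0 ≤ (-Complex.I * s).im := by rw [him]; linarith
        simp only [hG, if_neg this, hgm]
        congr 1
        rw [← mul_assoc, mul_neg, Complex.I_mul_I]; simp) h0 h1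
    have ip : Integrable (fun x => Real.exp (-σ * x)) νp := by
      refine integrable_exp_mul_of_ae_nonpos ?_
      filter_upwards [hp] with x hx
      exact mul_nonpos_of_nonpos_of_nonneg (by linarith) hx
    refine ⟨hadd ▸ ip.add_measure im, ?_⟩
    have e1 : (-Complex.I * (-σ : ℂ)) = σ * Complex.I := by ring
    have e2 : (0 : ℝ) ≤ ((σ : ℂ) * Complex.I).im := by simpa using h0.le
    have e3 : Complex.I * (σ * Complex.I) = ((-σ : ℝ) : ℂ) := by
      rw [mul_comm, mul_assoc, Complex.I_mul_I]; simp
    simp only [e1, hG, if_pos e2, hgp, e3, complexMGF_ofReal] at em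
    rw [sub_eq_iff_eq_add] at em
    rw [em, hadd, integral_add_measure ip im, add_comm]
    push_cast
    rfl
  -- The moment of order `β` itself is reached from inside: continuity of `F` at `iβ` bounds the
  -- moments of order `u n`, and Fatou's lemma passes to the limit. The shift by `2` keeps `u n`
  -- strictly between `0` and `β`.
  set u : ℕ → ℝ := fun n => β * (1 - ((n + 2 : ℕ) : ℝ)⁻¹) with hu
  have hinv : ∀ n : ℕ, ((n + 2 : ℕ) : ℝ)⁻¹ < 1 := fun n =>
    inv_lt_one_of_one_lt₀ (by push_cast; linarith [(Nat.cast_nonneg n : (0 : ℝ) ≤ n)])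
  have hu0 : ∀ n, 0 < u n := fun n => mul_pos hβ (by linarith [hinv n])
  have hu1 : ∀ n, u n < β := fun n => by
    have : (0 : ℝ) < ((n + 2 : ℕ) : ℝ)⁻¹ := by positivity
    simp only [hu]
    nlinarith
  have hulim : Tendsto u atTop (𝓝 β) := by
    have h0 : Tendsto (fun n : ℕ => ((n + 2 : ℕ) : ℝ)⁻¹) atTop (𝓝 0) :=
      (tendsto_inv_atTop_zero.comp (tendsto_natCast_atTop_atTop (R := ℝ))).comp
        (tendsto_add_atTop_nat 2)
    have h1 := (h0.const_sub 1).const_mul β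
    rwa [sub_zero, mul_one] at h1
  have hFlim : Tendsto (fun n => F (u n * Complex.I)) atTop (𝓝 (F (β * Complex.I))) := by
    refine (hc (β * Complex.I) ⟨by simpa using hβ.le, by simp⟩).tendsto.comp
      (tendsto_nhdsWithin_iff.2 ⟨?_, Eventually.of_forall fun n => ?_⟩)
    · exact ((Complex.continuous_ofReal.tendsto _).comp hulim).mul_const _
    · exact ⟨by simpa using (hu0 n).le, by simpa using (hu1 n).le⟩
  have hexplim : ∀ x : ℝ, Tendsto (fun n => Real.exp (-u n * x)) atTop (𝓝 (Real.exp (-β * x))) :=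
    fun x => (Real.continuous_exp.tendsto _).comp (hulim.neg.mul_const x)
  have hint : Integrable (fun x => Real.exp (-β * x)) ν := by
    refine integrable_of_tendsto_of_integral_le (C := (F (β * Complex.I)).re + 1)
      (fun n => (hσ (u n) (hu0 n) (hu1 n)).1) (fun n x => (Real.exp_pos _).le) hexplim ?_
    have h1 := (Complex.continuous_re.tendsto _).comp hFlim
    filter_upwards [h1.eventually (gt_mem_nhds (lt_add_one _))] with n hn
    simp only [Function.comp_apply, (hσ (u n) (hu0 n) (hu1 n)).2, Complex.ofReal_re] at hn
    exact hn.le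
  refine ⟨hint, tendsto_nhds_unique hFlim ?_⟩
  have h2 : Tendsto (fun n => ∫ x, Real.exp (-u n * x) ∂ν) atTop
      (𝓝 (∫ x, Real.exp (-β * x) ∂ν)) := by
    refine tendsto_integral_of_dominated_convergence (fun x => 1 + Real.exp (-β * x))
      (fun n => Continuous.aestronglyMeasurable (by fun_prop)) ((integrable_const 1).add hint)
      (fun n => Eventually.of_forall fun x => ?_) (Eventually.of_forall hexplim)
    rw [Real.norm_of_nonneg (Real.exp_pos _).le]
    rcases le_total 0 x with hx | hx
    · have : Real.exp (-u n * x) ≤ 1 :=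
        Real.exp_le_one_iff.2 (mul_nonpos_of_nonpos_of_nonneg (by linarith [hu0 n]) hx)
      linarith [Real.exp_pos (-β * x)]
    · have : Real.exp (-u n * x) ≤ Real.exp (-β * x) :=
        Real.exp_le_exp.2 (mul_le_mul_of_nonpos_right (by linarith [hu1 n]) hx)
      linarith
  refine ((Complex.continuous_ofReal.tendsto _).comp h2).congr fun n => ?_
  exact (hσ (u n) (hu0 n) (hu1 n)).2.symm

end Strip

/-! ### The GNS construction -/

section GNS

universe u

variable {A : Type u} [Ring A] [StarRing A] [Algebra ℂ A] [StarModule ℂ A]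

/-- Polarization: the values of the form at `a + b` and `a + i b` are real, which gives the two real
components of the identity. -/
theorem conj_apply_star_mul (ω : A →ₗ[ℂ] ℂ) (hω : ∀ a, 0 ≤ ω (star a * a)) (a b : A) :
    starRingEnd ℂ (ω (star b * a)) = ω (star a * b) := by
  have him : ∀ a, (ω (star a * a)).im = 0 := fun a => (Complex.nonneg_iff.1 (hω a)).2.symm
  have h1 := him (a + b)
  have h2 := him (a + Complex.I • b)
  have ha := him a
  have hb := him b
  simp only [star_add, star_smul, add_mul, mul_add, smul_mul_assoc, mul_smul_comm, map_add,
    map_smul, smul_eq_mul, Complex.add_im, Complex.star_def, Complex.conj_I, Complex.mul_im,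
    Complex.mul_re, Complex.neg_re, Complex.neg_im, Complex.I_re, Complex.I_im] at h1 h2
  refine Complex.ext ?_ ?_
  · rw [Complex.conj_re]; linarith
  · rw [Complex.conj_im]; linarith

/-- The Gelfand-Naimark-Segal construction, as a map into a Hilbert space. -/
theorem exists_gns (ω : A →ₗ[ℂ] ℂ) (hω : ∀ a, 0 ≤ ω (star a * a)) :
    ∃ (H : Type u) (_ : NormedAddCommGroup H) (_ : InnerProductSpace ℂ H) (_ : CompleteSpace H)
      (η : A →ₗ[ℂ] H), ∀ a b, inner ℂ (η a) (η b) = ω (star a * b) := by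
  let core : PreInnerProductSpace.Core ℂ A :=
    { inner := fun a b => ω (star a * b)
      conj_inner_symm := fun a b => conj_apply_star_mul ω hω a b
      re_inner_nonneg := fun a => (Complex.nonneg_iff.1 (hω a)).1
      add_left := fun a b c => by simp [add_mul]
      smul_left := fun a b c => by simp }
  let : SeminormedAddCommGroup A := InnerProductSpace.Core.toSeminormedAddCommGroup (c := core)
  let : InnerProductSpace ℂ A := InnerProductSpace.ofCore core
  -- The completion is separated, so it also divides out the null vectors of the form.
  exact ⟨UniformSpace.Completion A, inferInstance, inferInstance, inferInstance,
    (UniformSpace.Completion.toComplₗᵢ (𝕜 := ℂ) (E := A)).toLinearMap,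
    fun a b => UniformSpace.Completion.inner_coe (𝕜 := ℂ) a b⟩

end GNS

/-! ### Jets of test functions in Banach spaces, and convolution -/

section Jets

open scoped BoundedContinuousFunction Pointwise

variable {V : Type} [NormedAddCommGroup V] [NormedSpace ℝ V]

/-- The `i`-th derivative of a test function, as a bounded continuous function. -/
def derivBCF (i : ℕ) : 𝓓((⊤ : Opens V), ℂ) →ₗ[ℂ] (V →ᵇ (V [×i]→L[ℝ] ℂ)) where
  toFun f := BoundedContinuousFunction.ofNormedAddCommGroup (iteratedFDeriv ℝ i f)
    (f.contDiff.continuous_iteratedFDeriv (by exact_mod_cast le_top))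
    ((f.contDiff.continuous_iteratedFDeriv (m := i) (by exact_mod_cast le_top)).bounded_above_of_compact_support
      (f.hasCompactSupport.iteratedFDeriv i)).choose
    ((f.contDiff.continuous_iteratedFDeriv (m := i) (by exact_mod_cast le_top)).bounded_above_of_compact_support
      (f.hasCompactSupport.iteratedFDeriv i)).choose_spec
  map_add' f g := by
    ext1 x
    exact iteratedFDeriv_add_apply (f.contDiff.of_le (by exact_mod_cast le_top)).contDiffAt
      (g.contDiff.of_le (by exact_mod_cast le_top)).contDiffAt
  map_smul' c f := by
    ext1 x
    exact iteratedFDeriv_const_smul_apply (f.contDiff.of_le (by exact_mod_cast le_top)).contDiffAt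

theorem derivBCF_apply (i : ℕ) (f : 𝓓((⊤ : Opens V), ℂ)) (x : V) :
    derivBCF i f x = iteratedFDeriv ℝ i f x := rfl

variable (V) in
/-- Bounded continuous functions with values in the symmetric tensors up to order `N`. -/
def JetSpace (N : ℕ) : Type := ∀ i : Fin (N + 1), V →ᵇ (V [×(i : ℕ)]→L[ℝ] ℂ)

instance (N : ℕ) : NormedAddCommGroup (JetSpace V N) :=
  Pi.normedAddCommGroup (G := fun i : Fin (N + 1) => V →ᵇ (V [×(i : ℕ)]→L[ℝ] ℂ))

instance (N : ℕ) : NormedSpace ℂ (JetSpace V N) :=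
  Pi.normedSpace (E := fun i : Fin (N + 1) => V →ᵇ (V [×(i : ℕ)]→L[ℝ] ℂ))

instance (N : ℕ) : CompleteSpace (JetSpace V N) :=
  Pi.complete (fun i : Fin (N + 1) => V →ᵇ (V [×(i : ℕ)]→L[ℝ] ℂ))

/-- The derivatives of a test function up to order `N`. -/
def jet (N : ℕ) : 𝓓((⊤ : Opens V), ℂ) →ₗ[ℂ] JetSpace V N where
  toFun f i := derivBCF (i : ℕ) f
  map_add' f g := funext fun i => map_add (derivBCF (i : ℕ)) f g
  map_smul' c f := funext fun i => map_smul (derivBCF (i : ℕ)) c f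

/-- The value at `x` of the component of order `i` of a jet. -/
def evalJet {N : ℕ} (i : Fin (N + 1)) (x : V) : JetSpace V N →L[ℂ] (V [×(i : ℕ)]→L[ℝ] ℂ) :=
  (BoundedContinuousFunction.evalCLM ℂ x).comp
    (ContinuousLinearMap.proj (R := ℂ) (φ := fun i : Fin (N + 1) => V →ᵇ (V [×(i : ℕ)]→L[ℝ] ℂ)) i)

theorem evalJet_jet {N : ℕ} (i : Fin (N + 1)) (x : V) (f : 𝓓((⊤ : Opens V), ℂ)) :
    evalJet i x (jet N f) = iteratedFDeriv ℝ i f x := rfl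

theorem jetSpace_ext {N : ℕ} {j k : JetSpace V N} (h : ∀ i x, evalJet i x j = evalJet i x k) :
    j = k :=
  funext fun i => BoundedContinuousFunction.ext fun x => h i x

theorem norm_iteratedFDeriv_le_norm_jet {N i : ℕ} (hi : i ≤ N) (f : 𝓓((⊤ : Opens V), ℂ)) (x : V) :
    ‖iteratedFDeriv ℝ i f x‖ ≤ ‖jet N f‖ :=
  ((derivBCF i f).norm_coe_le_norm x).trans
    (norm_le_pi_norm (G := fun i : Fin (N + 1) => V →ᵇ (V [×(i : ℕ)]→L[ℝ] ℂ)) (jet N f) (⟨i, Nat.lt_succ_of_le hi⟩ : Fin (N + 1)))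

theorem norm_jet_le {N : ℕ} {f : 𝓓((⊤ : Opens V), ℂ)} {M : ℝ} (hM : 0 ≤ M)
    (h : ∀ i ≤ N, ∀ x, ‖iteratedFDeriv ℝ i f x‖ ≤ M) : ‖jet N f‖ ≤ M :=
  (pi_norm_le_iff_of_nonneg hM).2 fun i =>
    (BoundedContinuousFunction.norm_le hM).2 fun x => h i (Nat.le_of_lt_succ i.2) x

theorem jet_injective (N : ℕ) : Function.Injective (jet (V := V) N) := by
  refine (injective_iff_map_eq_zero _).2 fun f hf => ?_
  ext x
  have h := norm_iteratedFDeriv_le_norm_jet (Nat.zero_le N) f x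
  rw [hf, norm_zero, norm_iteratedFDeriv_zero] at h
  simpa using h

theorem iteratedFDeriv_translate (a : V) (f : 𝓓((⊤ : Opens V), ℂ)) (i : ℕ) (x : V) :
    iteratedFDeriv ℝ i (translate a f) x = iteratedFDeriv ℝ i f (x - a) :=
  iteratedFDeriv_comp_sub i a x

theorem continuous_jet_translate (N : ℕ) (f : 𝓓((⊤ : Opens V), ℂ)) :
    Continuous fun a => jet N (translate a f) := by
  refine continuous_pi fun i => ?_
  change Continuous fun a => derivBCF i (translate a f)
  have hu : UniformContinuous (iteratedFDeriv ℝ (i : ℕ) f) :=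
    (f.hasCompactSupport.iteratedFDeriv i).uniformContinuous_of_continuous
      (f.contDiff.continuous_iteratedFDeriv (by exact_mod_cast le_top))
  rw [Metric.continuous_iff]
  intro a ε hε
  obtain ⟨δ, hδ, h⟩ := Metric.uniformContinuous_iff.1 hu (ε / 2) (half_pos hε)
  refine ⟨δ, hδ, fun b hb => lt_of_le_of_lt ?_ (half_lt_self hε)⟩
  rw [BoundedContinuousFunction.dist_le (half_pos hε).le]
  intro x
  rw [derivBCF_apply, derivBCF_apply, iteratedFDeriv_translate, iteratedFDeriv_translate]
  refine (h ?_).le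
  rwa [dist_sub_left]

/-- A linear map on test functions that is bounded by finitely many derivatives on test functions
supported in a given compact set. -/
def IsLocallyBounded {H : Type*} [NormedAddCommGroup H] [Module ℂ H]
    (u : 𝓓((⊤ : Opens V), ℂ) →ₗ[ℂ] H) : Prop :=
  ∀ K : Set V, IsCompact K → ∃ (N : ℕ) (C : ℝ), 0 ≤ C ∧
    ∀ f : 𝓓((⊤ : Opens V), ℂ), tsupport f ⊆ K → ‖u f‖ ≤ C * ‖jet N f‖

/-- On functions supported in a fixed compact set the topology is given by the derivative seminorms,
so a continuous functional is bounded by finitely many of them. -/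
theorem isLocallyBounded_of_continuous (T : 𝓓((⊤ : Opens V), ℂ) →L[ℂ] ℂ) :
    IsLocallyBounded (T : 𝓓((⊤ : Opens V), ℂ) →ₗ[ℂ] ℂ) := by
  intro K hK
  let K' : Compacts V := ⟨K, hK⟩
  have hsub : (K' : Set V) ⊆ (⊤ : Opens V) := fun _ _ => trivial
  let S : 𝓓_{K'}(V, ℂ) →L[ℂ] ℂ := T.comp (TestFunction.ofSupportedInCLM ℂ hsub)
  let q : Seminorm ℂ 𝓓_{K'}(V, ℂ) := (normSeminorm ℂ ℂ).comp (S : 𝓓_{K'}(V, ℂ) →ₗ[ℂ] ℂ)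
  have hq : Continuous q := continuous_norm.comp S.continuous
  obtain ⟨s, C, -, hC⟩ := Seminorm.bound_of_continuous
    (ContDiffMapSupportedIn.withSeminorms ℂ V ℂ ⊤ K') q hq
  refine ⟨s.sup id, C, C.2, fun f hf => ?_⟩
  let f' : 𝓓_{K'}(V, ℂ) := .of_support_subset f.contDiff (subset_closure.trans hf)
  refine (hC f').trans ?_
  change C * (s.sup (ContDiffMapSupportedIn.seminorm ℂ V ℂ ⊤ K')) f' ≤ _
  refine mul_le_mul_of_nonneg_left ?_ C.2
  refine Seminorm.finset_sup_apply_le (norm_nonneg _) fun i hi => ?_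
  rw [ContDiffMapSupportedIn.seminorm_top_le_iff ℂ (norm_nonneg _)]
  intro x _
  exact norm_iteratedFDeriv_le_norm_jet (Finset.le_sup (f := id) hi) f x

theorem tsupport_translate_subset {f : 𝓓((⊤ : Opens V), ℂ)} {K : Set V} {a : V} (ha : a ∈ K) :
    tsupport (translate a f) ⊆ K + tsupport f := by
  intro x hx
  refine ⟨a, ha, x - a, ?_, by simp⟩
  have : tsupport (translate a f) = (Homeomorph.subRight a) ⁻¹' tsupport f :=
    tsupport_comp_eq_preimage f (Homeomorph.subRight a)
  rw [this] at hx
  exact hx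

theorem IsLocallyBounded.continuous_translate [ProperSpace V] {H : Type*} [NormedAddCommGroup H] [Module ℂ H]
    {u : 𝓓((⊤ : Opens V), ℂ) →ₗ[ℂ] H} (hu : IsLocallyBounded u) (f : 𝓓((⊤ : Opens V), ℂ)) :
    Continuous fun a => u (translate a f) := by
  refine continuous_iff_continuousAt.2 fun a => ?_
  have hK : IsCompact (Metric.closedBall a 1 + tsupport f) :=
    (isCompact_closedBall a 1).add f.hasCompactSupport.isCompact
  obtain ⟨N, C, hC, h⟩ := hu _ hK
  have h1 : Tendsto (fun b => C * ‖jet N (translate b f) - jet N (translate a f)‖) (𝓝 a) (𝓝 0) := by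
    have := ((continuous_jet_translate N f).tendsto a).sub_const (jet N (translate a f))
    simpa using this.norm.const_mul C
  rw [ContinuousAt, tendsto_iff_norm_sub_tendsto_zero]
  refine squeeze_zero' (Eventually.of_forall fun _ => norm_nonneg _) ?_ h1
  filter_upwards [Metric.closedBall_mem_nhds a one_pos] with b hb
  rw [← map_sub, ← map_sub]
  refine h _ ((tsupport_sub _ _).trans (Set.union_subset ?_ ?_))
  · exact tsupport_translate_subset hb
  · exact tsupport_translate_subset (Metric.mem_closedBall_self zero_le_one)

/-- Jets determine the function, so `u` factors through a subspace of `JetSpace V N` on which it is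
bounded; Hahn-Banach extends it. A functional on a Banach space can be exchanged with Bochner
integrals, which is the use made of it. -/
theorem IsLocallyBounded.exists_extension {u : 𝓓((⊤ : Opens V), ℂ) →ₗ[ℂ] ℂ}
    (hu : IsLocallyBounded u) {K : Set V} (hK : IsCompact K) :
    ∃ (N : ℕ) (L : JetSpace V N →L[ℂ] ℂ),
      ∀ f : 𝓓((⊤ : Opens V), ℂ), tsupport f ⊆ K → u f = L (jet N f) := by
  obtain ⟨N, C, hC, h⟩ := hu K hK
  let S : Submodule ℂ 𝓓((⊤ : Opens V), ℂ) :=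
    { carrier := {f | tsupport f ⊆ K}
      add_mem' := fun {f g} hf hg => (tsupport_add f g).trans (Set.union_subset hf hg)
      zero_mem' := by
        change tsupport (0 : V → ℂ) ⊆ K
        simp
      smul_mem' := fun c f hf => (tsupport_smul_subset_right (fun _ => c) f).trans hf }
  let J : S →ₗ[ℂ] JetSpace V N := (jet N).comp S.subtype
  have hJ : Function.Injective J := (jet_injective N).comp Subtype.val_injective
  let E := LinearEquiv.ofInjective J hJ
  let φ : LinearMap.range J →ₗ[ℂ] ℂ := (u.comp S.subtype).comp E.symm.toLinearMap
  have hE : ∀ x, jet N (E.symm x : S).1 = x := fun x =>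
    congrArg Subtype.val (E.apply_symm_apply x)
  let φ' : StrongDual ℂ (LinearMap.range J) := φ.mkContinuous C fun x => by
    have := h (E.symm x : S).1 (E.symm x : S).2
    rw [hE] at this
    exact this
  obtain ⟨L, hL, -⟩ := exists_extension_norm_eq (LinearMap.range J) φ'
  refine ⟨N, L, fun f hf => ?_⟩
  have h1 := hL ⟨J ⟨f, hf⟩, LinearMap.mem_range_self J _⟩
  have h2 : E.symm ⟨J ⟨f, hf⟩, LinearMap.mem_range_self J _⟩ = ⟨f, hf⟩ :=
    E.symm_apply_apply ⟨f, hf⟩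
  refine Eq.trans ?_ h1.symm
  change _ = u (E.symm ⟨J ⟨f, hf⟩, LinearMap.mem_range_self J _⟩ : S).1
  rw [h2]

variable [ProperSpace V] [MeasurableSpace V] [BorelSpace V] {μ : Measure V} [μ.IsAddHaarMeasure]

theorem fderiv_integral_smul {W : Type} [NormedAddCommGroup W] [NormedSpace ℝ W] [NormedSpace ℂ W]
    [IsScalarTower ℝ ℂ W] {g : V → ℂ} (hg : Continuous g) {F : V → W}
    (hF : ContDiff ℝ 1 F) (hFc : HasCompactSupport F) :
    fderiv ℝ (fun x => ∫ b, g b • F (x - b) ∂μ)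
      = fun x => ∫ b, g b • fderiv ℝ F (x - b) ∂μ := by
  ext1 x
  exact (hFc.hasFDerivAt_convolution_right (μ := μ)
    (ContinuousLinearMap.lsmul ℝ ℂ : ℂ →L[ℝ] W →L[ℝ] W) hg.locallyIntegrable hF x).fderiv

/-- The induction step of `iteratedFDeriv_integral_smul`, where `e` is the currying that makes a
derivative of an `n`-th derivative into an `(n + 1)`-st one. -/
theorem map_fderiv_integral_smul {W W' : Type} [NormedAddCommGroup W] [NormedSpace ℝ W]
    [NormedSpace ℂ W] [IsScalarTower ℝ ℂ W] [NormedAddCommGroup W'] [NormedSpace ℝ W']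
    [NormedSpace ℂ W'] [CompleteSpace W] [CompleteSpace W'] {g : V → ℂ} (hg : Continuous g)
    {F : V → W} (hF : ContDiff ℝ 1 F) (hFc : HasCompactSupport F)
    (e : (V →L[ℝ] W) →L[ℝ] W') (he : ∀ (c : ℂ) T, e (c • T) = c • e T) (x : V) :
    e (fderiv ℝ (fun x => ∫ b, g b • F (x - b) ∂μ) x) = ∫ b, g b • e (fderiv ℝ F (x - b)) ∂μ := by
  have hi : Integrable (fun b => g b • fderiv ℝ F (x - b)) μ :=
    (hFc.fderiv ℝ).convolutionExists_right
      (ContinuousLinearMap.lsmul ℝ ℂ : ℂ →L[ℝ] (V →L[ℝ] W) →L[ℝ] (V →L[ℝ] W))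
      hg.locallyIntegrable (hF.continuous_fderiv one_ne_zero) x
  rw [fderiv_integral_smul hg hF hFc, ← e.integral_comp_comm hi]
  simp only [he]

theorem iteratedFDeriv_integral_smul {g : V → ℂ} (hg : Continuous g) {F : V → ℂ}
    (hF : ContDiff ℝ (⊤ : ℕ∞) F) (hFc : HasCompactSupport F) (n : ℕ) :
    iteratedFDeriv ℝ n (fun x => ∫ b, g b • F (x - b) ∂μ)
      = fun x => ∫ b, g b • iteratedFDeriv ℝ n F (x - b) ∂μ := by
  induction n with
  | zero =>
    ext1 x
    simp only [iteratedFDeriv_zero_eq_comp, Function.comp_apply]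
    refine ((continuousMultilinearCurryFin0 ℝ V ℂ).symm.toContinuousLinearEquiv.integral_comp_comm
      _).symm.trans ?_
    rfl
  | succ n ih =>
    rw [iteratedFDeriv_succ_eq_comp_left, ih, iteratedFDeriv_succ_eq_comp_left]
    ext1 x
    exact map_fderiv_integral_smul hg
      (hF.iteratedFDeriv_right (i := n) (m := 1) (by exact_mod_cast le_top)) (hFc.iteratedFDeriv n)
      (continuousMultilinearCurryLeftEquiv ℝ (fun _ : Fin (n + 1) => V)
        ℂ).symm.toContinuousLinearEquiv.toContinuousLinearMap (fun c T => rfl) x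

/-- The convolution of two test functions. -/
def convTest (g f : Test) : Test where
  toFun := fun x => ∫ b, g b * f (x - b)
  contDiff' := by
    have h := f.hasCompactSupport.contDiff_convolution_right (μ := volume)
      (ContinuousLinearMap.lsmul ℝ ℂ : ℂ →L[ℝ] ℂ →L[ℝ] ℂ) g.continuous.locallyIntegrable f.contDiff
    exact h
  hasCompactSupport' := by
    have h := HasCompactSupport.convolution (μ := volume)
      (ContinuousLinearMap.lsmul ℝ ℂ : ℂ →L[ℝ] ℂ →L[ℝ] ℂ) g.hasCompactSupport f.hasCompactSupport
    exact h
  tsupport_subset' := fun _ _ => trivial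

theorem convTest_apply (g f : Test) (x : Spacetime) :
    convTest g f x = ∫ b, g b * f (x - b) := rfl

theorem convTest_comm (g f : Test) : convTest g f = convTest f g := by
  ext x
  rw [convTest_apply, convTest_apply, ← integral_sub_left_eq_self _ volume x]
  refine integral_congr_ae (Eventually.of_forall fun b => ?_)
  simp only [sub_sub_cancel]
  ring

theorem tsupport_convTest_subset (g f : Test) :
    tsupport (convTest g f) ⊆ tsupport g + tsupport f := by
  refine closure_minimal ?_
    (g.hasCompactSupport.isCompact.add f.hasCompactSupport.isCompact).isClosed
  exact (support_convolution_subset (ContinuousLinearMap.lsmul ℝ ℂ) (μ := volume)).trans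
    ((Set.add_subset_add subset_closure subset_closure))

/-- A convolution is a superposition of translates as a Bochner integral in the space of jets; point
evaluations separate jets and reduce this to differentiation under the integral. -/
theorem integral_smul_jet_translate (N : ℕ) (g f : Test) :
    ∫ b, g b • jet N (translate b f) = jet N (convTest g f) := by
  have hc : Continuous fun b => g b • jet N (translate b f) :=
    g.continuous.smul (continuous_jet_translate N f)
  have hi : Integrable fun b => g b • jet N (translate b f) :=
    hc.integrable_of_hasCompactSupport g.hasCompactSupport.smul_right
  refine jetSpace_ext fun i x => ?_
  rw [← ContinuousLinearMap.integral_comp_comm _ hi, evalJet_jet]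
  refine Eq.trans ?_ (congrFun (iteratedFDeriv_integral_smul (μ := volume) g.continuous
    f.contDiff f.hasCompactSupport i) x).symm
  refine integral_congr_ae (Eventually.of_forall fun b => ?_)
  simp only [map_smul, evalJet_jet, iteratedFDeriv_translate]

theorem IsLocallyBounded.apply_convTest_complex {u : Test →ₗ[ℂ] ℂ} (hu : IsLocallyBounded u)
    (g f : Test) : u (convTest g f) = ∫ b, g b • u (translate b f) := by
  obtain ⟨N, L, hL⟩ := hu.exists_extension
    (g.hasCompactSupport.isCompact.add f.hasCompactSupport.isCompact)
  have hi : Integrable fun b => g b • jet N (translate b f) :=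
    (g.continuous.smul (continuous_jet_translate N f)).integrable_of_hasCompactSupport
      g.hasCompactSupport.smul_right
  rw [hL _ (tsupport_convTest_subset g f), ← integral_smul_jet_translate,
    ← L.integral_comp_comm hi]
  refine integral_congr_ae (Eventually.of_forall fun b => ?_)
  simp only [map_smul]
  -- The extension `L` agrees with `u` only on supports in the chosen compact set; where the
  -- translate might leave it, `g b` vanishes.
  by_cases hb : g b = 0
  · simp [hb]
  · rw [hL _ (tsupport_translate_subset (subset_tsupport g hb))]

/-- A locally bounded linear map commutes with the integral that defines a convolution. -/
theorem IsLocallyBounded.apply_convTest {H : Type*} [NormedAddCommGroup H] [InnerProductSpace ℂ H]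
    [CompleteSpace H] {u : Test →ₗ[ℂ] H} (hu : IsLocallyBounded u) (g f : Test) :
    u (convTest g f) = ∫ b, g b • u (translate b f) := by
  have hi : Integrable fun b => g b • u (translate b f) :=
    (g.continuous.smul (hu.continuous_translate f)).integrable_of_hasCompactSupport
      g.hasCompactSupport.smul_right
  refine ext_inner_left ℂ fun y => ?_
  -- Testing against a vector `y` reduces the Hilbert-space-valued case to scalar functionals.
  have hy : IsLocallyBounded ((innerSL ℂ y : H →ₗ[ℂ] ℂ).comp u) := by
    intro K hK
    obtain ⟨N, C, hC, h⟩ := hu K hK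
    refine ⟨N, ‖y‖ * C, by positivity, fun f hf => ?_⟩
    refine (norm_inner_le_norm y (u f)).trans ?_
    rw [mul_assoc]
    exact mul_le_mul_of_nonneg_left (h f hf) (norm_nonneg y)
  have h1 := hy.apply_convTest_complex g f
  refine h1.trans ?_
  rw [← integral_inner hi]
  refine integral_congr_ae (Eventually.of_forall fun b => ?_)
  simp [inner_smul_right]

end Jets

/-! ### The Fourier transform normalized like a characteristic function -/

section FourierTransform

open scoped FourierTransform

theorem norm_exp_inner_mul_I {V : Type*} [NormedAddCommGroup V] [InnerProductSpace ℝ V] (p x : V) :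
    ‖Complex.exp (inner ℝ p x * Complex.I)‖ = 1 :=
  Complex.norm_exp_ofReal_mul_I _

variable {V : Type*} [NormedAddCommGroup V] [InnerProductSpace ℝ V] [FiniteDimensional ℝ V]
  [MeasurableSpace V] [BorelSpace V]

/-- The Fourier transform in the normalization `p ↦ ∫ f(x) exp(i⟨p,x⟩) dx`. -/
def ft (f : V → ℂ) (p : V) : ℂ := ∫ x, f x * Complex.exp (inner ℝ p x * Complex.I)

theorem ft_eq_fourier (f : V → ℂ) (p : V) : ft f p = 𝓕 f (-(2 * Real.pi)⁻¹ • p) := by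
  rw [Real.fourier_eq', ft]
  refine integral_congr_ae (Eventually.of_forall fun x => ?_)
  simp only [smul_eq_mul, inner_smul_right]
  rw [mul_comm, real_inner_comm]
  congr 3
  have := Real.pi_ne_zero
  push_cast
  field_simp

theorem continuous_ft {f : V → ℂ} (hf : Integrable f) : Continuous (ft f) := by
  rw [funext (ft_eq_fourier f)]
  exact (VectorFourier.fourierIntegral_continuous Real.continuous_fourierChar
    (by simp only [innerₗ_apply_apply]; fun_prop) hf).comp (by fun_prop)

theorem norm_ft_le (f : V → ℂ) (p : V) : ‖ft f p‖ ≤ ∫ x, ‖f x‖ := by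
  refine (norm_integral_le_integral_norm _).trans_eq ?_
  simp

theorem ft_zero (f : V → ℂ) : ft f 0 = ∫ x, f x := by simp [ft]

/-- The Fourier transform on Schwartz space. -/
def ftCLM : 𝓢(V, ℂ) →L[ℂ] 𝓢(V, ℂ) :=
  (SchwartzMap.compCLMOfContinuousLinearEquiv ℂ
    (ContinuousLinearEquiv.smulLeft (Units.mk0 (-(2 * Real.pi)⁻¹) (by simp [Real.pi_ne_zero])))).comp
    (FourierTransform.fourierCLM ℂ 𝓢(V, ℂ))

theorem ftCLM_apply (h : 𝓢(V, ℂ)) (p : V) : ftCLM h p = ft h p := by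
  rw [ft_eq_fourier]
  rfl

end FourierTransform

/-! ### Fourier transforms of test functions -/

section TestFT

/-- A test function as a Schwartz function. -/
def toSchwartz (f : Test) : 𝓢(Spacetime, ℂ) := f.hasCompactSupport.toSchwartzMap f.contDiff

theorem integrable_test (f : Test) : Integrable f :=
  f.continuous.integrable_of_hasCompactSupport f.hasCompactSupport

theorem integrable_test_mul_exp (f : Test) (p : Spacetime) :
    Integrable fun x => f x * Complex.exp (inner ℝ p x * Complex.I) :=
  (integrable_test f).mul_bdd (c := 1) (by fun_prop)
    (Eventually.of_forall fun x => (norm_exp_inner_mul_I p x).le)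

theorem ft_add (f g : Test) (p : Spacetime) : ft (f + g : Test) p = ft f p + ft g p := by
  rw [ft, ft, ft, ← integral_add (integrable_test_mul_exp f p) (integrable_test_mul_exp g p)]
  refine integral_congr_ae (Eventually.of_forall fun x => ?_)
  exact add_mul _ _ _

theorem ft_smul (c : ℂ) (f : Test) (p : Spacetime) : ft (c • f : Test) p = c * ft f p := by
  rw [ft, ft, ← integral_const_mul]
  refine integral_congr_ae (Eventually.of_forall fun x => ?_)
  exact mul_assoc _ _ _

theorem ft_translate (a : Spacetime) (f : Test) (p : Spacetime) :
    ft (translate a f) p = Complex.exp (inner ℝ p a * Complex.I) * ft f p := by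
  rw [ft, ft, ← integral_const_mul, ← integral_add_right_eq_self _ a]
  refine integral_congr_ae (Eventually.of_forall fun x => ?_)
  change f (x + a - a) * _ = _
  simp only [add_sub_cancel_right, inner_add_right, Complex.ofReal_add, add_mul, Complex.exp_add]
  ring

theorem ft_conj (f : Test) (p : Spacetime) :
    ft (conj f) p = starRingEnd ℂ (ft f (-p)) := by
  rw [ft, ft, ← integral_conj]
  refine integral_congr_ae (Eventually.of_forall fun x => ?_)
  change starRingEnd ℂ (f x) * _ = _
  simp only [map_mul, ← Complex.exp_conj, Complex.conj_I, inner_neg_left,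
    Complex.ofReal_neg, map_neg, Complex.conj_ofReal, neg_mul_neg]

theorem ft_neg_of_even {f : Test} (hf : ∀ x, f (-x) = f x) (p : Spacetime) :
    ft f (-p) = ft f p := by
  rw [ft, ft, ← integral_neg_eq_self]
  simp only [hf, inner_neg_neg]

theorem ft_convTest (g f : Test) (p : Spacetime) : ft (convTest g f) p = ft g p * ft f p := by
  rw [ft_eq_fourier, ft_eq_fourier g, ft_eq_fourier f]
  exact Real.fourier_mul_convolution_eq (integrable_test g) (integrable_test f) _

theorem exists_bump : ∃ χ : Test, (∀ x, 0 ≤ χ x) ∧ (∀ x, χ (-x) = χ x) ∧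
    tsupport χ ⊆ Metric.closedBall 0 1 ∧ ft χ 0 ≠ 0 := by
  let b : ContDiffBump (0 : Spacetime) := ⟨1 / 2, 1, by norm_num, by norm_num⟩
  refine ⟨⟨fun x => (b x : ℂ), Complex.ofRealCLM.contDiff.comp b.contDiff,
    b.hasCompactSupport.comp_left Complex.ofReal_zero, fun _ _ => trivial⟩, ?_, ?_, ?_, ?_⟩
  · intro x
    exact Complex.zero_le_real.2 b.nonneg
  · intro x
    exact congrArg Complex.ofReal (b.neg x)
  · refine (closure_mono ?_).trans b.tsupport_eq.subset
    intro x hx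
    exact fun h => hx (congrArg Complex.ofReal h)
  · rw [ft_zero]
    change ∫ x, (b x : ℂ) ≠ 0
    rw [integral_complex_ofReal]
    exact_mod_cast b.integral_pos.ne'

/-- The product of a test function and a smooth function. -/
def mulTest (G : Spacetime → ℂ) (hG : ContDiff ℝ (⊤ : ℕ∞) G) (f : Test) : Test where
  toFun := fun x => f x * G x
  contDiff' := f.contDiff.mul hG
  hasCompactSupport' := f.hasCompactSupport.mul_right
  tsupport_subset' := fun _ _ => trivial

open scoped FourierTransform in
/-- The Fourier transform of a test function times a Gaussian. -/
theorem ft_mul_gaussian (k : Test) {f : Test}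
    (hf : ∀ x, f x = k x * Complex.exp (-Real.pi * ‖x‖ ^ 2)) (p : Spacetime) :
    ft f p = ∫ q : Spacetime, ft k (p - (2 * Real.pi) • q) * Complex.exp (-Real.pi * ‖q‖ ^ 2) := by
  have hb : (0 : ℝ) < (Real.pi : ℂ).re := by simpa using Real.pi_pos
  have hG : ∀ w : Spacetime, 𝓕 (fun v : Spacetime => Complex.exp (-(Real.pi : ℂ) * ‖v‖ ^ 2)) w
      = Complex.exp (-Real.pi * ‖w‖ ^ 2) := fun w => by
    have hpi : (Real.pi : ℂ) ≠ 0 := by exact_mod_cast Real.pi_ne_zero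
    rw [fourier_gaussian_innerProductSpace hb, div_self hpi, Complex.one_cpow, one_mul]
    congr 1
    field_simp
  have hGi : Integrable (fun v : Spacetime => Complex.exp (-(Real.pi : ℂ) * ‖v‖ ^ 2)) := by
    simpa using GaussianFourier.integrable_cexp_neg_mul_sq_norm_add hb 0 (0 : Spacetime)
  have h := VectorFourier.integral_fourierIntegral_smul_eq_flip (L := innerₗ Spacetime)
    Real.continuous_fourierChar (by simp only [innerₗ_apply_apply]; fun_prop)
    (integrable_test_mul_exp k p) hGi
  have h1 : ∀ q : Spacetime, VectorFourier.fourierIntegral 𝐞 volume (innerₗ Spacetime)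
      (fun x => k x * Complex.exp (inner ℝ p x * Complex.I)) q = ft k (p - (2 * Real.pi) • q) := by
    intro q
    refine (Real.fourier_eq' _ q).trans (integral_congr_ae (Eventually.of_forall fun x => ?_))
    simp only [smul_eq_mul]
    rw [mul_left_comm, ← Complex.exp_add, inner_sub_left, inner_smul_left, real_inner_comm q x]
    congr 2
    simp
    ring
  have h2 : ∀ x : Spacetime, VectorFourier.fourierIntegral 𝐞 volume (innerₗ Spacetime).flip
      (fun v : Spacetime => Complex.exp (-(Real.pi : ℂ) * ‖v‖ ^ 2)) x
        = Complex.exp (-Real.pi * ‖x‖ ^ 2) := by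
    intro x
    rw [flip_innerₗ]
    exact hG x
  simp only [h1, h2, smul_eq_mul] at h
  rw [h, ft]
  refine integral_congr_ae (Eventually.of_forall fun x => ?_)
  simp only [hf]
  ring

/-- There is a test function whose Fourier transform has no zeros. -/
theorem exists_ft_ne_zero : ∃ f : Test, ∀ p, ft f p ≠ 0 := by
  obtain ⟨χ, h0, heven, -, hne⟩ := exists_bump
  have hGs : ContDiff ℝ (⊤ : ℕ∞) fun x : Spacetime => Complex.exp (-Real.pi * ‖x‖ ^ 2) := by
    have : ContDiff ℝ (⊤ : ℕ∞) fun x : Spacetime => ((‖x‖ ^ 2 : ℝ) : ℂ) :=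
      Complex.ofRealCLM.contDiff.comp (contDiff_norm_sq ℝ)
    push_cast at this
    exact (contDiff_const.mul this).cexp
  -- `χ` is real and even, so `ft χ` is real and `χ * χ` has transform `‖ft χ‖²`. Multiplying by a
  -- Gaussian convolves this with a Gaussian: the integrand is nonnegative, and it is positive at `q
  -- = p/(2π)` because `ft χ 0 ≠ 0`.
  refine ⟨mulTest _ hGs (convTest χ χ), fun p => ?_⟩
  rw [ft_mul_gaussian (convTest χ χ) (fun x => rfl)]
  have hreal : ∀ q, ft (convTest χ χ) q = ((‖ft χ q‖ ^ 2 : ℝ) : ℂ) := fun q => by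
    have hc : conj χ = χ := by
      ext x
      change starRingEnd ℂ (χ x) = χ x
      exact Complex.conj_eq_iff_im.2 (Complex.nonneg_iff.1 (h0 x)).2.symm
    have := ft_conj χ q
    rw [hc, ft_neg_of_even heven] at this
    rw [ft_convTest]
    push_cast
    rw [← Complex.conj_mul', ← this]
  have hint : ∀ q : Spacetime, ft (convTest χ χ) (p - (2 * Real.pi) • q)
      * Complex.exp (-Real.pi * ‖q‖ ^ 2)
      = ((‖ft χ (p - (2 * Real.pi) • q)‖ ^ 2 * Real.exp (-Real.pi * ‖q‖ ^ 2) : ℝ) : ℂ) := fun q => by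
    rw [hreal]
    push_cast
    rfl
  simp only [hint]
  rw [integral_complex_ofReal, Complex.ofReal_ne_zero]
  have hcont : Continuous fun q : Spacetime =>
      ‖ft χ (p - (2 * Real.pi) • q)‖ ^ 2 * Real.exp (-Real.pi * ‖q‖ ^ 2) := by
    have := continuous_ft (integrable_test χ)
    fun_prop
  have hnn : ∀ q : Spacetime, 0 ≤ ‖ft χ (p - (2 * Real.pi) • q)‖ ^ 2 * Real.exp (-Real.pi * ‖q‖ ^ 2) :=
    fun q => by positivity
  have hGi : Integrable (fun v : Spacetime => Real.exp (-Real.pi * ‖v‖ ^ 2)) := by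
    have hb : (0 : ℝ) < (Real.pi : ℂ).re := by simpa using Real.pi_pos
    have := (GaussianFourier.integrable_cexp_neg_mul_sq_norm_add hb 0 (0 : Spacetime)).norm
    simpa [Complex.norm_exp, ← Complex.ofReal_pow] using this
  refine ((integral_pos_iff_support_of_nonneg hnn ?_).2 ?_).ne'
  · refine hGi.bdd_mul (c := (∫ x, ‖χ x‖) ^ 2) ?_ (Eventually.of_forall fun q => ?_)
    · have := continuous_ft (integrable_test χ)
      exact Continuous.aestronglyMeasurable (by fun_prop)
    · rw [norm_pow, norm_norm]
      exact pow_le_pow_left₀ (norm_nonneg _) (norm_ft_le _ _) 2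
  · refine hcont.isOpen_support.measure_pos _ ⟨(2 * Real.pi)⁻¹ • p, ?_⟩
    have hpi := Real.pi_ne_zero
    rw [Function.mem_support, smul_inv_smul₀ (by positivity), sub_self]
    positivity

/-- The dilation `x ↦ f (r x)` of a test function. -/
def dilate (r : ℝ) (hr : 0 < r) (f : Test) : Test where
  toFun := fun x => f (r • x)
  contDiff' := f.contDiff.comp (contDiff_const_smul r)
  hasCompactSupport' := f.hasCompactSupport.comp_homeomorph (Homeomorph.smulOfNeZero r hr.ne')
  tsupport_subset' := fun _ _ => trivial

theorem ft_dilate (r : ℝ) (hr : 0 < r) (f : Test) (p : Spacetime) :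
    ft (dilate r hr f) p = ((r ^ 4)⁻¹ : ℝ) * ft f (r⁻¹ • p) := by
  have h := Measure.integral_comp_smul (volume : Measure Spacetime)
    (fun x => f x * Complex.exp (inner ℝ (r⁻¹ • p) x * Complex.I)) r
  rw [ft, ft]
  rw [finrank_euclideanSpace_fin, abs_of_pos (by positivity)] at h
  rw [← Complex.real_smul, ← h]
  refine integral_congr_ae (Eventually.of_forall fun x => ?_)
  change f (r • x) * _ = _
  simp only [inner_smul_left, inner_smul_right, RCLike.conj_to_real]
  rw [mul_inv_cancel_left₀ hr.ne']

theorem norm_jet_dilate_le (N : ℕ) {r : ℝ} (hr : 1 ≤ r) (f : Test) :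
    ‖jet N (dilate r (zero_lt_one.trans_le hr) f)‖ ≤ r ^ N * ‖jet N f‖ := by
  have hr0 : 0 < r := zero_lt_one.trans_le hr
  refine norm_jet_le (by positivity) fun i hi x => ?_
  have h := congrFun (iteratedFDeriv_comp_const_smul (i := i) r
    (f.contDiff.of_le (by exact_mod_cast le_top))) x
  change ‖iteratedFDeriv ℝ i (fun z => f (r • z)) x‖ ≤ _
  rw [h, norm_smul, norm_pow, Real.norm_of_nonneg hr0.le]
  exact mul_le_mul (pow_le_pow_right₀ hr hi) (norm_iteratedFDeriv_le_norm_jet hi f _)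
    (norm_nonneg _) (by positivity)

theorem tsupport_dilate_subset {r : ℝ} (hr : 1 ≤ r) {f : Test}
    (hf : tsupport f ⊆ Metric.closedBall 0 1) :
    tsupport (dilate r (zero_lt_one.trans_le hr) f) ⊆ Metric.closedBall 0 1 := by
  refine closure_minimal (fun x hx => ?_) Metric.isClosed_closedBall
  have h := hf (subset_tsupport f (show f (r • x) ≠ 0 from hx))
  rw [mem_closedBall_zero_iff, norm_smul, Real.norm_of_nonneg (by linarith)] at h
  rw [mem_closedBall_zero_iff]
  nlinarith [norm_nonneg x]

end TestFT

/-! ### The spectral measure and its temperedness -/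

section SpectralMeasure

/-- The measure with density `‖ft f‖²` with respect to `μ`. -/
def ftDensity (μ : Measure Spacetime) (f : Test) : Measure Spacetime :=
  μ.withDensity fun p => ‖ft f p‖ₑ ^ 2

theorem measurable_ft_enorm_sq (f : Test) : Measurable fun p => ‖ft f p‖ₑ ^ 2 :=
  (continuous_ft (integrable_test f)).enorm.measurable.pow_const 2

theorem isFiniteMeasure_ftDensity (ν : Measure Spacetime) [IsFiniteMeasure ν] (f : Test) :
    IsFiniteMeasure (ftDensity ν f) := by
  refine isFiniteMeasure_withDensity (lt_of_le_of_lt (lintegral_mono (g := fun _ =>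
    ENNReal.ofReal (∫ x, ‖f x‖) ^ 2) fun p => ?_) ?_).ne
  · refine pow_le_pow_left₀ zero_le ?_ 2
    rw [← ofReal_norm]
    exact ENNReal.ofReal_le_ofReal (norm_ft_le f p)
  · rw [lintegral_const]
    exact ENNReal.mul_lt_top (by simp) (measure_lt_top _ _)

theorem charFun_ftDensity (ν : Measure Spacetime) (f : Test) (a : Spacetime) :
    charFun (ftDensity ν f) a
      = ∫ p, Complex.exp (inner ℝ p a * Complex.I) * ‖ft f p‖ ^ 2 ∂ν := by
  rw [charFun_apply, ftDensity, integral_withDensity_eq_integral_toReal_smul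
    (measurable_ft_enorm_sq f) (Eventually.of_forall fun p => by simp)]
  refine integral_congr_ae (Eventually.of_forall fun p => ?_)
  simp [mul_comm]

variable {H : Type*} [NormedAddCommGroup H] [InnerProductSpace ℂ H]
  {u : Test →ₗ[ℂ] H}

theorem translate_translate (a b : Spacetime) (f : Test) :
    translate a (translate b f) = translate (a + b) f := by
  ext x
  change f (x - a - b) = f (x - (a + b))
  rw [sub_sub]

theorem translate_convTest (a : Spacetime) (g f : Test) :
    translate a (convTest g f) = convTest g (translate a f) := by
  ext x
  change ∫ b, g b * f (x - a - b) = ∫ b, g b * f (x - b - a)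
  simp only [sub_right_comm]

/-- The spectral measure of a translation covariant vector valued distribution. -/
theorem exists_spectral_measure [CompleteSpace H] (hu : IsLocallyBounded u)
    (hinv : ∀ a f g, inner ℂ (u (translate a f)) (u (translate a g)) = inner ℂ (u f) (u g)) :
    ∃ μ : Measure Spacetime, ∀ f, IsFiniteMeasure (ftDensity μ f) ∧
      ∀ a, charFun (ftDensity μ f) a = inner ℂ (u f) (u (translate a f)) := by
  have hΦ : ∀ f a b, inner ℂ (u (translate b f)) (u (translate a f))
      = inner ℂ (u f) (u (translate (a - b) f)) := fun f a b => by
    rw [← hinv b f, translate_translate, add_sub_cancel]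
  have hex : ∀ f : Test, ∃ ν : Measure Spacetime, IsFiniteMeasure ν ∧
      ∀ a, charFun ν a = inner ℂ (u f) (u (translate a f)) := fun f =>
    exists_measure_charFun_eq (hu.continuous_translate f)
      (Φ := fun a => inner ℂ (u f) (u (translate a f))) (hΦ f)
  choose ν hfin hν using hex
  have hconv : ∀ f g a, charFun (ftDensity (ν f) g) a
      = inner ℂ (u (convTest g f)) (u (translate a (convTest g f))) := fun f g a => by
    have h := inner_integral_orbit (hu.continuous_translate f) (ν := ν f)
      (fun a b => by rw [hΦ, hν]) (integrable_test g) a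
    rw [charFun_ftDensity, translate_convTest, hu.apply_convTest, hu.apply_convTest]
    simp only [translate_translate]
    exact h.symm
  -- Both sides are the spectral measure of the vector `u (g * f)`, and convolution is commutative.
  -- This is the compatibility that lets all `ν f` be `‖ft f‖² μ` for a single `μ`.
  have hswap : ∀ f g, ftDensity (ν f) g = ftDensity (ν g) f := fun f g => by
    have := isFiniteMeasure_ftDensity (ν f) g
    have := isFiniteMeasure_ftDensity (ν g) f
    refine Measure.ext_of_charFun (funext fun a => ?_)
    rw [hconv, hconv, convTest_comm]
  obtain ⟨f₀, hf₀⟩ := exists_ft_ne_zero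
  -- Dividing by `‖ft f₀‖²` is possible everywhere because `ft f₀` has no zeros.
  refine ⟨(ν f₀).withDensity fun p => (‖ft f₀ p‖ₑ ^ 2)⁻¹, fun f => ?_⟩
  have key : ftDensity ((ν f₀).withDensity fun p => (‖ft f₀ p‖ₑ ^ 2)⁻¹) f = ν f := by
    have hm : Measurable fun p => (‖ft f₀ p‖ₑ ^ 2)⁻¹ := (measurable_ft_enorm_sq f₀).inv
    rw [ftDensity, ← withDensity_mul _ hm (measurable_ft_enorm_sq f), mul_comm,
      withDensity_mul _ (measurable_ft_enorm_sq f) hm]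
    change (ftDensity (ν f₀) f).withDensity _ = _
    rw [hswap]
    refine withDensity_inv_same (measurable_ft_enorm_sq f₀)
      (Eventually.of_forall fun p => ?_) (Eventually.of_forall fun p => ?_)
    · simpa using hf₀ p
    · simp
  rw [key]
  exact ⟨hfin f, hν f⟩

/-- With `n = ⌊‖x‖/δ⌋` the weight of exponent `M + 2` at `x` is at most `(δ(n+1))^-(M+2)`, which
uses `δ ≤ 1`. Against balls of mass `O((n+1)^M)` this leaves the summable `(n+1)⁻²`. -/
theorem hasTemperateGrowth_of_measure_ball_le {V : Type*} [NormedAddCommGroup V]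
    [MeasurableSpace V] [BorelSpace V] {μ : Measure V} {δ C : ℝ} (hδ : 0 < δ) (hδ1 : δ ≤ 1)
    {M : ℕ}
    (h : ∀ n : ℕ, μ (Metric.ball 0 (δ * (n + 1))) ≤ ENNReal.ofReal (C * (n + 1) ^ M)) :
    μ.HasTemperateGrowth := by
  refine ⟨M + 2, (Continuous.aestronglyMeasurable ?_), ?_⟩
  · exact Continuous.rpow_const (by fun_prop) fun x => Or.inl (by positivity)
  have hle : ∀ x : V, ‖(1 + ‖x‖) ^ (-((M + 2 : ℕ) : ℝ))‖ₑ ≤ ∑' n : ℕ, (Metric.ball 0 (δ * (n + 1))).indicator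
      (fun _ => ENNReal.ofReal ((δ * (n + 1)) ^ (M + 2))⁻¹) x := by
    intro x
    set n := ⌊‖x‖ / δ⌋₊
    refine le_trans ?_ (ENNReal.le_tsum n)
    have h1 : ‖x‖ < δ * (n + 1) := by
      have := Nat.lt_floor_add_one (‖x‖ / δ)
      rwa [div_lt_iff₀' hδ] at this
    have h2 : δ * n ≤ ‖x‖ := by
      have := Nat.floor_le (show 0 ≤ ‖x‖ / δ by positivity)
      rwa [le_div_iff₀' hδ] at this
    rw [Set.indicator_of_mem (by simpa using h1), ← ofReal_norm,
      Real.norm_of_nonneg (by positivity)]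
    refine ENNReal.ofReal_le_ofReal ?_
    rw [Real.rpow_neg (by positivity), Real.rpow_natCast]
    refine inv_anti₀ (by positivity) (pow_le_pow_left₀ (by positivity) ?_ _)
    linarith
  rw [hasFiniteIntegral_iff_enorm]
  refine (lintegral_mono hle).trans_lt ?_
  rw [lintegral_tsum fun n => (measurable_const.indicator measurableSet_ball).aemeasurable]
  have hs : Summable fun n : ℕ => C * (δ ^ (M + 2))⁻¹ * (((n + 1 : ℕ) : ℝ) ^ 2)⁻¹ :=
    ((summable_nat_add_iff 1).2 (Real.summable_nat_pow_inv.2 one_lt_two)).mul_left _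
  refine lt_of_le_of_lt (ENNReal.tsum_le_tsum fun n => ?_) hs.tsum_ofReal_lt_top
  rw [lintegral_indicator_const measurableSet_ball]
  refine (mul_le_mul_right (h n) _).trans ?_
  rw [← ENNReal.ofReal_mul (by positivity)]
  refine ENNReal.ofReal_le_ofReal (le_of_eq ?_)
  push_cast
  rw [mul_pow]
  field_simp
  ring

/-- The spectral measure of a locally bounded vector valued distribution is tempered. -/
theorem hasTemperateGrowth_spectral (hu : IsLocallyBounded u) {μ : Measure Spacetime}
    (hμ : ∀ f : Test, ∫⁻ p, ‖ft f p‖ₑ ^ 2 ∂μ = ENNReal.ofReal (‖u f‖ ^ 2)) : μ.HasTemperateGrowth := by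
  obtain ⟨χ, -, -, hsupp, hne⟩ := exists_bump
  obtain ⟨N, C, hC, hb⟩ := hu _ (isCompact_closedBall 0 1)
  set c := ‖ft χ 0‖ / 2 with hc
  have hc0 : 0 < c := half_pos (norm_pos_iff.2 hne)
  obtain ⟨δ, hδ, hball⟩ : ∃ δ > 0, ∀ p ∈ Metric.ball (0 : Spacetime) δ, c < ‖ft χ p‖ := by
    have hcont := (continuous_ft (integrable_test χ)).norm
    exact Metric.eventually_nhds_iff_ball.1 (hcont.tendsto 0 |>.eventually_const_lt
      (by rw [hc]; exact half_lt_self (norm_pos_iff.2 hne)))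
  -- Dilating the bump by `r ≥ 1` spreads its transform over a ball of radius `δ r` at height at
  -- least `c r⁻⁴`, while its `C^N` norm grows by at most `r^N` and its support stays in the unit
  -- ball. Squaring gives mass `O(r^(2N+8))` for that ball.
  refine hasTemperateGrowth_of_measure_ball_le (δ := min δ 1) (C := (C * ‖jet N χ‖ / c) ^ 2)
    (M := 2 * N + 8) (by positivity) (min_le_right _ _) fun n => ?_
  set r : ℝ := n + 1 with hr
  have hr1 : 1 ≤ r := by simp [hr]
  have hr0 : 0 < r := zero_lt_one.trans_le hr1
  set f := dilate r hr0 χ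
  have hf1 : ‖u f‖ ≤ C * (r ^ N * ‖jet N χ‖) :=
    (hb f (tsupport_dilate_subset hr1 hsupp)).trans
      (mul_le_mul_of_nonneg_left (norm_jet_dilate_le N hr1 χ) hC)
  have hf2 : ∀ p ∈ Metric.ball (0 : Spacetime) (min δ 1 * r), (r ^ 4)⁻¹ * c ≤ ‖ft f p‖ := by
    intro p hp
    rw [ft_dilate, norm_mul, Complex.norm_real, Real.norm_of_nonneg (by positivity)]
    refine mul_le_mul_of_nonneg_left (hball _ ?_).le (by positivity)
    rw [mem_ball_zero_iff] at hp ⊢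
    rw [norm_smul, norm_inv, Real.norm_of_nonneg hr0.le, inv_mul_lt_iff₀ hr0, mul_comm]
    exact hp.trans_le (mul_le_mul_of_nonneg_right (min_le_left _ _) hr0.le)
  have hk : ENNReal.ofReal (((r ^ 4)⁻¹ * c) ^ 2) * μ (Metric.ball 0 (min δ 1 * r))
      ≤ ENNReal.ofReal (‖u f‖ ^ 2) := by
    rw [← hμ f, ← setLIntegral_const]
    refine (setLIntegral_mono (measurable_ft_enorm_sq f) fun p hp => ?_).trans
      (setLIntegral_le_lintegral _ _)
    rw [← ofReal_norm, ← ENNReal.ofReal_pow (norm_nonneg _)]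
    exact ENNReal.ofReal_le_ofReal (pow_le_pow_left₀ (by positivity) (hf2 p hp) 2)
  have hpos : 0 < ((r ^ 4)⁻¹ * c) ^ 2 := by positivity
  have h1 : μ (Metric.ball 0 (min δ 1 * r))
      ≤ ENNReal.ofReal (‖u f‖ ^ 2) / ENNReal.ofReal (((r ^ 4)⁻¹ * c) ^ 2) := by
    rw [ENNReal.le_div_iff_mul_le (by simp only [ne_eq, ENNReal.ofReal_eq_zero, not_le]; exact Or.inl hpos) (by simp), mul_comm]
    exact hk
  refine h1.trans ?_
  rw [← ENNReal.ofReal_div_of_pos hpos]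
  refine ENNReal.ofReal_le_ofReal ?_
  rw [div_le_iff₀ hpos]
  calc ‖u f‖ ^ 2 ≤ (C * (r ^ N * ‖jet N χ‖)) ^ 2 := pow_le_pow_left₀ (norm_nonneg _) hf1 2
    _ = _ := by
      field_simp
      ring

end SpectralMeasure

/-! ### Spectral representation of the two-point function -/

section TwoPoint

theorem tensor_apply_two (f g : Test) (x : Fin 2 → Spacetime) :
    tensor ![f, g] x = f (x 0) * g (x 1) := by
  change ∏ i, (![f, g] i) (x i) = _
  rw [Fin.prod_univ_two]
  rfl

theorem norm_iteratedFDeriv_comp_proj_le {N i : ℕ} (hi : i ≤ N) (f : Test) (k : Fin 2)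
    (x : Fin 2 → Spacetime) :
    ‖iteratedFDeriv ℝ i (fun y : Fin 2 → Spacetime => f (y k)) x‖ ≤ ‖jet N f‖ := by
  let L : (Fin 2 → Spacetime) →L[ℝ] Spacetime := ContinuousLinearMap.proj k
  have hL : ‖L‖ ≤ 1 := L.opNorm_le_bound zero_le_one fun y => by
    rw [one_mul]
    exact norm_le_pi_norm y k
  have h := L.iteratedFDeriv_comp_right f.contDiff x (i := i) (by exact_mod_cast le_top)
  change ‖iteratedFDeriv ℝ i (f ∘ L) x‖ ≤ _
  rw [h]
  refine (ContinuousMultilinearMap.norm_compContinuousLinearMap_le _ _).trans ?_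
  refine (mul_le_of_le_one_right (norm_nonneg _) ?_).trans
    (norm_iteratedFDeriv_le_norm_jet hi f (L x))
  exact Finset.prod_le_one (fun _ _ => norm_nonneg _) fun _ _ => hL

theorem norm_jet_tensor_le (N : ℕ) (f g : Test) :
    ‖jet N (tensor ![f, g])‖ ≤ 2 ^ N * (‖jet N f‖ * ‖jet N g‖) := by
  refine norm_jet_le (by positivity) fun i hi x => ?_
  have hfun : (tensor ![f, g] : (Fin 2 → Spacetime) → ℂ) = fun y => f (y 0) * g (y 1) :=
    funext (tensor_apply_two f g)
  rw [hfun]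
  refine (norm_iteratedFDeriv_mul_le (N := ((⊤ : ℕ∞) : WithTop ℕ∞))
    (f.contDiff.comp (contDiff_apply ℝ Spacetime (0 : Fin 2)))
    (g.contDiff.comp (contDiff_apply ℝ Spacetime (1 : Fin 2))) x (n := i)
    (by exact_mod_cast le_top)).trans ?_
  calc _ ≤ ∑ k ∈ Finset.range (i + 1), (i.choose k : ℝ) * (‖jet N f‖ * ‖jet N g‖) := by
        refine Finset.sum_le_sum fun k hk => ?_
        rw [mul_assoc]
        have hk' := Finset.mem_range.1 hk
        gcongr
        · exact norm_iteratedFDeriv_comp_proj_le (by omega) f 0 x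
        · exact norm_iteratedFDeriv_comp_proj_le (by omega) g 1 x
    _ = 2 ^ i * (‖jet N f‖ * ‖jet N g‖) := by
        rw [← Finset.sum_mul]
        congr 1
        exact_mod_cast Nat.sum_range_choose i
    _ ≤ _ := by
        gcongr
        norm_num

theorem norm_jet_conj_le (N : ℕ) (f : Test) : ‖jet N (conj f)‖ ≤ ‖jet N f‖ := by
  refine norm_jet_le (norm_nonneg _) fun i hi x => ?_
  have h := Complex.conjLIE.norm_iteratedFDeriv_comp_left (𝕜 := ℝ) f x i
  exact h.trans_le (norm_iteratedFDeriv_le_norm_jet hi f x)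

theorem tsupport_conj_subset (f : Test) : tsupport (conj f) ⊆ tsupport f := by
  refine closure_mono fun x hx hfx => hx ?_
  change starRingEnd ℂ (f x) = 0
  rw [hfx, map_zero]

theorem conj_conj (f : Test) : conj (conj f) = f := by
  ext x
  exact Complex.conj_conj _

variable {m : ℝ} {ω : FieldAlgebra m →ₗ[ℂ] ℂ}

/-- The smeared field as a linear map. -/
def fieldLinear (m : ℝ) : Test →ₗ[ℂ] FieldAlgebra m where
  toFun := field m
  map_add' := field_add m
  map_smul' := field_smul m

theorem star_field (f : Test) : star (field m f) = field m (conj f) := fieldStar_field m f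

/-- Local boundedness of the two-point distribution on `K × K`, with the Leibniz factor `2^N`
absorbed. The bound is a square because the left side is `‖u f‖²`, so that `u` itself is locally
bounded. -/
theorem exists_twoPoint_bound (hω : IsState ω) {K : Set Spacetime} (hK : IsCompact K) :
    ∃ (N : ℕ) (C : ℝ), 0 ≤ C ∧ ∀ f : Test, tsupport f ⊆ K →
      ‖ω (field m (conj f) * field m f)‖ ≤ (C * ‖jet N f‖) ^ 2 := by
  obtain ⟨T, hT⟩ := hω.distribution 2
  obtain ⟨N, C, hC, h⟩ := isLocallyBounded_of_continuous T _
    (isCompact_univ_pi fun _ : Fin 2 => hK)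
  refine ⟨N, Real.sqrt (C * 2 ^ N), Real.sqrt_nonneg _, fun f hf => ?_⟩
  have h1 : ω (field m (conj f) * field m f) = T (tensor ![conj f, f]) := by
    rw [hT]
    simp [List.ofFn_succ]
  have hsupp : tsupport (tensor ![conj f, f]) ⊆ Set.univ.pi fun _ : Fin 2 => K := by
    refine closure_minimal (fun x hx => ?_) (isCompact_univ_pi fun _ : Fin 2 => hK).isClosed
    rw [Function.mem_support, tensor_apply_two] at hx
    intro i _
    fin_cases i
    · exact hf (tsupport_conj_subset f (subset_tsupport _ (left_ne_zero_of_mul hx)))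
    · exact hf (subset_tsupport _ (right_ne_zero_of_mul hx))
  rw [h1, mul_pow, Real.sq_sqrt (by positivity)]
  refine (h _ hsupp).trans ?_
  rw [mul_assoc, sq]
  refine mul_le_mul_of_nonneg_left ((norm_jet_tensor_le N _ _).trans ?_) hC
  gcongr
  exact norm_jet_conj_le N f

theorem integrable_ft_mul {μ : Measure Spacetime} [μ.HasTemperateGrowth] (f : Test)
    {g : Spacetime → ℂ} {C : ℝ} (hg : Continuous g) (hC : ∀ p, ‖g p‖ ≤ C) :
    Integrable (fun p => ft f p * g p) μ := by
  have h := (ftCLM (toSchwartz f)).integrable (μ := μ)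
  have h2 : ∀ p, ftCLM (toSchwartz f) p = ft f p := fun p => ftCLM_apply _ p
  rw [show (ftCLM (toSchwartz f) : Spacetime → ℂ) = ft f from funext h2] at h
  exact h.mul_bdd (c := C) hg.aestronglyMeasurable (Eventually.of_forall hC)

theorem complex_polarization (a b : ℂ) :
    starRingEnd ℂ a * b = ((‖a + b‖ ^ 2 : ℝ) - (‖a - b‖ ^ 2 : ℝ)
      + ((‖a - Complex.I * b‖ ^ 2 : ℝ) - (‖a + Complex.I * b‖ ^ 2 : ℝ)) * Complex.I) / 4 := by
  have h := inner_eq_sum_norm_sq_div_four (𝕜 := ℂ) a b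
  simp only [RCLike.inner_apply, smul_eq_mul, RCLike.I_to_complex] at h
  rw [mul_comm, h]
  push_cast
  rfl

theorem ft_sub (f g : Test) (p : Spacetime) : ft (f - g : Test) p = ft f p - ft g p := by
  have h : f - g = f + (-1 : ℂ) • g := by module
  rw [h, ft_add, ft_smul]
  ring

/-- Polarization: the sesquilinear form of a measure is determined by its diagonal. It serves both
to pass from `f = g` to general pairs and to compare two measures. -/
theorem integral_conj_ft_mul_ft {μ : Measure Spacetime}
    (hi : ∀ f : Test, Integrable (fun p => ‖ft f p‖ ^ 2) μ) (f g : Test) :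
    ∫ p, starRingEnd ℂ (ft f p) * ft g p ∂μ
      = ((∫ p, ‖ft (f + g : Test) p‖ ^ 2 ∂μ : ℝ) - (∫ p, ‖ft (f - g : Test) p‖ ^ 2 ∂μ : ℝ)
        + ((∫ p, ‖ft (f - Complex.I • g : Test) p‖ ^ 2 ∂μ : ℝ)
          - (∫ p, ‖ft (f + Complex.I • g : Test) p‖ ^ 2 ∂μ : ℝ)) * Complex.I) / 4 := by
  have hp : ∀ p, starRingEnd ℂ (ft f p) * ft g p
      = ((‖ft (f + g : Test) p‖ ^ 2 : ℝ) - (‖ft (f - g : Test) p‖ ^ 2 : ℝ)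
        + ((‖ft (f - Complex.I • g : Test) p‖ ^ 2 : ℝ)
          - (‖ft (f + Complex.I • g : Test) p‖ ^ 2 : ℝ)) * Complex.I) / 4 := fun p => by
    rw [complex_polarization, ft_add, ft_add, ft_sub, ft_sub, ft_smul]
  have hi' : ∀ f : Test, Integrable (fun p => ((‖ft f p‖ ^ 2 : ℝ) : ℂ)) μ := fun f => (hi f).ofReal
  have hd : ∀ f g : Test, Integrable (fun p => ((‖ft f p‖ ^ 2 : ℝ) : ℂ)
      - ((‖ft g p‖ ^ 2 : ℝ) : ℂ)) μ := fun f g => (hi' f).sub (hi' g)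
  simp only [hp]
  rw [integral_div, integral_add (hd _ _) ((hd _ _).mul_const _),
    integral_mul_const, integral_sub (hi' _) (hi' _), integral_sub (hi' _) (hi' _)]
  simp only [integral_complex_ofReal]

theorem integrable_norm_ft_sq {μ : Measure Spacetime} [μ.HasTemperateGrowth] (f : Test) :
    Integrable (fun p => ‖ft f p‖ ^ 2) μ := by
  have := (integrable_ft_mul (μ := μ) f (g := fun p => starRingEnd ℂ (ft f p))
    (Complex.continuous_conj.comp (continuous_ft (integrable_test f)))
    (fun p => by rw [RCLike.norm_conj]; exact norm_ft_le f p)).norm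
  refine this.congr (Eventually.of_forall fun p => ?_)
  simp [sq]

/-- The spectral representation of the two-point function. -/
theorem exists_twoPoint_measure (hω : IsState ω) (hinv : IsTranslationInvariant ω) :
    ∃ μ : Measure Spacetime, μ.HasTemperateGrowth ∧ ∀ f g : Test,
      ω (field m (conj f) * field m g) = ∫ p, starRingEnd ℂ (ft f p) * ft g p ∂μ := by
  obtain ⟨H, _, _, _, η, hη⟩ := exists_gns ω hω.nonneg
  -- The vector `φ(f)Ω` of the GNS representation.
  let u : Test →ₗ[ℂ] H := η.comp (fieldLinear m)
  have hu : ∀ f g, inner ℂ (u f) (u g) = ω (field m (conj f) * field m g) := fun f g => by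
    rw [← star_field]
    exact hη _ _
  have hsq : ∀ f, ((‖u f‖ ^ 2 : ℝ) : ℂ) = ω (field m (conj f) * field m f) := fun f => by
    rw [← hu, inner_self_eq_norm_sq_to_K]
    push_cast
    rfl
  have hb : IsLocallyBounded u := by
    intro K hK
    obtain ⟨N, C, hC, h⟩ := exists_twoPoint_bound hω hK
    refine ⟨N, C, hC, fun f hf => ?_⟩
    have h1 := h f hf
    rw [← hsq, Complex.norm_real, Real.norm_of_nonneg (by positivity)] at h1
    exact (pow_le_pow_iff_left₀ (norm_nonneg _) (by positivity) two_ne_zero).1 h1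
  have htr : ∀ a f g, inner ℂ (u (translate a f)) (u (translate a g)) = inner ℂ (u f) (u g) := by
    intro a f g
    have h : translation m a (field m (conj f) * field m g)
        = field m (conj (translate a f)) * field m (translate a g) := by
      rw [map_mul, translation_field, translation_field]
      rfl
    rw [hu, hu, ← hinv a (field m (conj f) * field m g), h]
  obtain ⟨μ, hμ⟩ := exists_spectral_measure hb htr
  have ht0 : ∀ f : Test, translate 0 f = f := fun f => by
    ext x
    exact congrArg f (sub_zero x)
  have hlint : ∀ f : Test, ∫⁻ p, ‖ft f p‖ₑ ^ 2 ∂μ = ENNReal.ofReal (‖u f‖ ^ 2) := by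
    intro f
    have := (hμ f).1
    have h0 := (hμ f).2 0
    rw [charFun_zero, ht0, inner_self_eq_norm_sq_to_K] at h0
    have h1 : (ftDensity μ f).real Set.univ = ‖u f‖ ^ 2 :=
      Complex.ofReal_injective (h0.trans (by push_cast; rfl))
    rw [← h1, ofReal_measureReal, ftDensity, withDensity_apply _ MeasurableSet.univ,
      setLIntegral_univ]
  have hmt : μ.HasTemperateGrowth := hasTemperateGrowth_spectral hb hlint
  refine ⟨μ, hmt, fun f g => ?_⟩
  have hint : ∀ f : Test, ∫ p, ‖ft f p‖ ^ 2 ∂μ = ‖u f‖ ^ 2 := by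
    intro f
    have hc : Continuous fun p => ‖ft f p‖ ^ 2 := (continuous_ft (integrable_test f)).norm.pow 2
    rw [integral_eq_lintegral_of_nonneg_ae
      (Eventually.of_forall fun p => sq_nonneg _) hc.aestronglyMeasurable]
    simp only [ENNReal.ofReal_pow (norm_nonneg _), ofReal_norm]
    rw [hlint, ENNReal.toReal_ofReal (by positivity)]
  rw [← hu, inner_eq_sum_norm_sq_div_four (𝕜 := ℂ),
    integral_conj_ft_mul_ft integrable_norm_ft_sq]
  simp only [hint]
  rw [map_add, map_sub, map_sub, map_add, map_smul]
  push_cast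
  rfl

end TwoPoint

/-! ### The mass shell -/

section MassShell

theorem ft_lineDeriv (v : Spacetime) (f : Test) (p : Spacetime) :
    ft (∂_{v} f : Test) p = -(inner ℝ p v * Complex.I) * ft f p := by
  have hf : ∀ x, DifferentiableAt ℝ f x := fun x => f.contDiff.differentiable (by simp) x
  have hd : ∀ x, (∂_{v} f : Test) x = fderiv ℝ f x v := fun x => by
    rw [lineDeriv_apply, (hf x).lineDeriv_eq_fderiv]
  have hg : ∀ x, HasFDerivAt (fun x : Spacetime => Complex.exp (inner ℝ p x * Complex.I))
      (Complex.exp (inner ℝ p x * Complex.I) •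
        (Complex.ofRealCLM.comp (innerSL ℝ p)).smulRight Complex.I) x := fun x => by
    have h1 : HasFDerivAt (fun x : Spacetime => ((inner ℝ p x : ℝ) : ℂ))
        (Complex.ofRealCLM.comp (innerSL ℝ p)) x :=
      (Complex.ofRealCLM.comp (innerSL ℝ p)).hasFDerivAt
    exact (h1.mul_const' Complex.I).cexp
  have hgv : ∀ x, fderiv ℝ (fun x : Spacetime => Complex.exp (inner ℝ p x * Complex.I)) x v
      = (inner ℝ p v * Complex.I) * Complex.exp (inner ℝ p x * Complex.I) := fun x => by
    rw [(hg x).fderiv]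
    simp [mul_comm]
  have h := integral_mul_fderiv_eq_neg_fderiv_mul_of_integrable (μ := (volume : Measure Spacetime))
    (f := f) (g := fun x : Spacetime => Complex.exp (inner ℝ p x * Complex.I)) (v := v)
    (by simpa only [hd] using integrable_test_mul_exp (∂_{v} f) p)
    (by
      simp only [hgv]
      refine ((integrable_test_mul_exp f p).const_mul (inner ℝ p v * Complex.I)).congr
        (Eventually.of_forall fun x => ?_)
      simp only
      ring)
    (integrable_test_mul_exp f p) (fun x _ => hf x) (fun x _ => (hg x).differentiableAt)
  simp only [hgv, ← hd] at h
  rw [ft, ← neg_eq_iff_eq_neg.2 h, ft, neg_mul, ← integral_const_mul]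
  congr 1
  refine integral_congr_ae (Eventually.of_forall fun x => ?_)
  simp only
  ring

theorem ft_kleinGordon (m : ℝ) (f : Test) (p : Spacetime) :
    ft (kleinGordon m f : Test) p = ((m ^ 2 - minkowski p p : ℝ) : ℂ) * ft f p := by
  have hs : ∀ g : Test, ((m ^ 2 : ℝ) • g : Test) = ((m ^ 2 : ℝ) : ℂ) • g := fun g => by
    ext x
    exact Complex.real_smul
  have hI := Complex.I_sq
  rw [kleinGordon, hs, ft_add, ft_sub, ft_sub, ft_sub, ft_smul]
  simp only [ft_lineDeriv, EuclideanSpace.inner_single_right, minkowski]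
  simp
  linear_combination (p 0 ^ 2 - p 1 ^ 2 - p 2 ^ 2 - p 3 ^ 2) * ft f p * hI

variable {m : ℝ} {ω : FieldAlgebra m →ₗ[ℂ] ℂ}

/-- The spectral measure is concentrated on the mass shell. -/
theorem ae_minkowski_eq {μ : Measure Spacetime} [μ.HasTemperateGrowth]
    (hμ : ∀ f g : Test,
      ω (field m (conj f) * field m g) = ∫ p, starRingEnd ℂ (ft f p) * ft g p ∂μ) :
    ∀ᵐ p ∂μ, minkowski p p = m ^ 2 := by
  obtain ⟨f₀, hf₀⟩ := exists_ft_ne_zero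
  -- The field equation makes `∫ (m² - p²)² ‖ft f₀‖² dμ` vanish, and `ft f₀` has no zeros.
  have h := hμ (kleinGordon m f₀) (kleinGordon m f₀)
  rw [field_kleinGordon, mul_zero, map_zero] at h
  simp only [Complex.conj_mul'] at h
  have h2 : ∫ p, ‖ft (kleinGordon m f₀ : Test) p‖ ^ 2 ∂μ = 0 := by
    have : ((∫ p, ‖ft (kleinGordon m f₀ : Test) p‖ ^ 2 ∂μ : ℝ) : ℂ) = 0 := by
      rw [← integral_complex_ofReal, h]
      push_cast
      rfl
    exact_mod_cast this
  rw [integral_eq_zero_iff_of_nonneg (fun p => by positivity) (integrable_norm_ft_sq _)] at h2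
  filter_upwards [h2] with p hp
  have h3 : ft (kleinGordon m f₀ : Test) p = 0 := by simpa using hp
  rw [ft_kleinGordon] at h3
  have h4 := (mul_eq_zero.1 h3).resolve_right (hf₀ p)
  have h5 : m ^ 2 - minkowski p p = 0 := by exact_mod_cast h4
  linarith

/-- On causal covectors the energy in a time direction controls the norm. -/
theorem norm_le_mul_abs_inner {e p : Spacetime} (he : e ∈ timeDirections)
    (hp : 0 ≤ minkowski p p) : ‖p‖ ≤ 4 * e 0 * |inner ℝ p e| := by
  obtain ⟨⟨he0, -⟩, he1⟩ := he
  have hin : inner ℝ p e = p 0 * e 0 + (p 1 * e 1 + p 2 * e 2 + p 3 * e 3) := by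
    rw [PiLp.inner_apply, Fin.sum_univ_four]
    simp
    ring
  have hn : ‖p‖ ^ 2 = p 0 ^ 2 + (p 1 ^ 2 + p 2 ^ 2 + p 3 ^ 2) := by
    rw [EuclideanSpace.norm_sq_eq, Fin.sum_univ_four]
    simp only [Real.norm_eq_abs, sq_abs]
    ring
  simp only [minkowski] at hp he1
  set s := p 1 * e 1 + p 2 * e 2 + p 3 * e 3 with hs
  set P := p 1 ^ 2 + p 2 ^ 2 + p 3 ^ 2 with hP
  set Q := e 1 ^ 2 + e 2 ^ 2 + e 3 ^ 2 with hQ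
  have hcs : s ^ 2 ≤ P * Q := by
    rw [hs, hP, hQ]
    nlinarith [sq_nonneg (p 1 * e 2 - p 2 * e 1), sq_nonneg (p 1 * e 3 - p 3 * e 1),
      sq_nonneg (p 2 * e 3 - p 3 * e 2)]
  have hQ1 : Q = e 0 ^ 2 - 1 := by rw [hQ]; linarith
  have hP1 : P ≤ p 0 ^ 2 := by rw [hP]; linarith
  have hsle : s ^ 2 ≤ p 0 ^ 2 * (e 0 ^ 2 - 1) := by
    refine hcs.trans ?_
    rw [hQ1]
    exact mul_le_mul_of_nonneg_right hP1 (by rw [← hQ1, hQ]; positivity)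
  have he1' : 1 ≤ e 0 := by nlinarith [show 0 ≤ Q by rw [hQ]; positivity]
  have habs : |p 0| ≤ 2 * e 0 * |inner ℝ p e| := by
    -- Cauchy-Schwarz gives `|s| ≤ |p₀| √(e₀² - 1)`, and the root is at most `e₀ - 1/(2e₀)`. The gap
    -- `|p₀|/(2e₀)` bounds the energy from below; with `‖p‖ ≤ 2|p₀|` this yields the factor `4 e₀`.
    have h1 : |s| ≤ |p 0| * (e 0 - 1 / (2 * e 0)) := by
      refine abs_le_of_sq_le_sq ?_ (mul_nonneg (abs_nonneg _) ?_)
      · rw [mul_pow, sq_abs]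
        refine hsle.trans (mul_le_mul_of_nonneg_left ?_ (sq_nonneg _))
        have : (e 0 - 1 / (2 * e 0)) ^ 2 = e 0 ^ 2 - 1 + (1 / (2 * e 0)) ^ 2 := by
          field_simp
          ring
        rw [this]
        linarith [sq_nonneg (1 / (2 * e 0))]
      · have : 1 / (2 * e 0) ≤ 1 := by
          rw [div_le_one (by positivity)]
          linarith
        linarith
    have h2 : |p 0| * e 0 ≤ |inner ℝ p e| + |s| := by
      have h : p 0 * e 0 = inner ℝ p e - s := by rw [hin]; ring
      calc |p 0| * e 0 = |p 0 * e 0| := by rw [abs_mul, abs_of_pos he0]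
        _ = |inner ℝ p e - s| := by rw [h]
        _ ≤ _ := abs_sub _ _
    have h3 : |p 0| * (1 / (2 * e 0)) ≤ |inner ℝ p e| := by linarith
    rw [mul_one_div, div_le_iff₀ (by positivity)] at h3
    linarith
  have h4 : ‖p‖ ≤ 2 * |p 0| := by
    refine (sq_le_sq₀ (norm_nonneg _) (by positivity)).1 ?_
    rw [hn, mul_pow, sq_abs]
    nlinarith [sq_nonneg (p 0)]
  linarith

end MassShell

/-! ### From the KMS condition to detailed balance -/

section KMS

theorem withDensity_ftDensity (ρ : Measure Spacetime) {f : Test} (hf : ∀ p, ft f p ≠ 0) :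
    (ftDensity ρ f).withDensity (fun p => (‖ft f p‖ₑ ^ 2)⁻¹) = ρ :=
  withDensity_inv_same (measurable_ft_enorm_sq f)
    (Eventually.of_forall fun p => by simpa using hf p) (Eventually.of_forall fun p => by simp)

theorem isFiniteMeasure_ftDensity_of_integrable {ρ : Measure Spacetime} {f : Test}
    (hf : Integrable (fun p => ‖ft f p‖ ^ 2) ρ) : IsFiniteMeasure (ftDensity ρ f) := by
  refine isFiniteMeasure_withDensity (ne_of_lt ?_)
  have := hf.2
  simpa [hasFiniteIntegral_iff_enorm, enorm_pow] using this

/-- A measure is determined by the integrals of the functions `‖ft f‖²`. -/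
theorem measure_ext_of_integral_norm_ft_sq {ρ₁ ρ₂ : Measure Spacetime}
    (h₁ : ∀ f : Test, Integrable (fun p => ‖ft f p‖ ^ 2) ρ₁)
    (h₂ : ∀ f : Test, Integrable (fun p => ‖ft f p‖ ^ 2) ρ₂)
    (h : ∀ f : Test, ∫ p, ‖ft f p‖ ^ 2 ∂ρ₁ = ∫ p, ‖ft f p‖ ^ 2 ∂ρ₂) : ρ₁ = ρ₂ := by
  obtain ⟨f₀, hf₀⟩ := exists_ft_ne_zero
  rw [← withDensity_ftDensity ρ₁ hf₀, ← withDensity_ftDensity ρ₂ hf₀]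
  congr 1
  have := isFiniteMeasure_ftDensity_of_integrable (h₁ f₀)
  have := isFiniteMeasure_ftDensity_of_integrable (h₂ f₀)
  refine Measure.ext_of_charFun (funext fun a => ?_)
  -- Translating one argument produces the character, so the characteristic function of `‖ft f₀‖² ρ`
  -- is itself a value of the sesquilinear form.
  have hc : ∀ p, Complex.exp (inner ℝ p a * Complex.I) * ‖ft f₀ p‖ ^ 2
      = starRingEnd ℂ (ft f₀ p) * ft (translate a f₀) p := fun p => by
    rw [ft_translate, ← Complex.conj_mul']
    ring
  rw [charFun_ftDensity, charFun_ftDensity]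
  simp only [hc]
  rw [integral_conj_ft_mul_ft h₁, integral_conj_ft_mul_ft h₂]
  simp only [h]

variable {m : ℝ} {ω : FieldAlgebra m →ₗ[ℂ] ℂ}

/-- Passes to the distribution of the energy `⟨p,e⟩` on the real line, where
`integrable_exp_of_strip` applies. -/
theorem map_inner_ftDensity {μ : Measure Spacetime} (f : Test) (e : Spacetime)
    (g : ℝ → ℝ) (hg : Measurable g) :
    (Integrable g ((ftDensity μ f).map fun p => inner ℝ p e) ↔
      Integrable (fun p => ‖ft f p‖ ^ 2 * g (inner ℝ p e)) μ) ∧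
    ∫ x, g x ∂((ftDensity μ f).map fun p => inner ℝ p e)
      = ∫ p, ‖ft f p‖ ^ 2 * g (inner ℝ p e) ∂μ := by
  have hm : Measurable fun p : Spacetime => (inner ℝ p e : ℝ) :=
    (Continuous.inner continuous_id continuous_const).measurable
  constructor
  · rw [integrable_map_measure hg.aestronglyMeasurable hm.aemeasurable, ftDensity,
      integrable_withDensity_iff_integrable_smul' (measurable_ft_enorm_sq f)
        (Eventually.of_forall fun p => by simp)]
    simp
  · rw [integral_map hm.aemeasurable hg.aestronglyMeasurable, ftDensity,
      integral_withDensity_eq_integral_toReal_smul (measurable_ft_enorm_sq f)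
        (Eventually.of_forall fun p => by simp)]
    simp

/-- For `A = φ(f)*` and `B = φ(f)` the KMS function is, on the real axis, the characteristic
function of the energy distribution of `‖ft f‖² μ`. Its value at `iβ` is `ω(φ(f) φ(f)*)`, the same
form evaluated at `conj f`, whose transform is the conjugate of that of `f` at `-p`. -/
theorem integral_exp_norm_ft_sq {β : ℝ} (hβ : 0 < β) {e : Spacetime} (hKMS : IsKMS ω β e)
    {μ : Measure Spacetime} [μ.HasTemperateGrowth]
    (hμ : ∀ f g : Test,
      ω (field m (conj f) * field m g) = ∫ p, starRingEnd ℂ (ft f p) * ft g p ∂μ) (f : Test) :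
    Integrable (fun p => ‖ft f p‖ ^ 2 * Real.exp (-β * inner ℝ p e)) μ ∧
      ∫ p, ‖ft f p‖ ^ 2 * Real.exp (-β * inner ℝ p e) ∂μ = ∫ p, ‖ft f (-p)‖ ^ 2 ∂μ := by
  obtain ⟨F, hd, hc, h0, h1⟩ := hKMS (field m (conj f)) (field m f)
  have hm : Measurable fun p : Spacetime => (inner ℝ p e : ℝ) :=
    (Continuous.inner continuous_id continuous_const).measurable
  have hfin := isFiniteMeasure_ftDensity_of_integrable (integrable_norm_ft_sq (μ := μ) f)
  have hF : ∀ t : ℝ, F t = charFun ((ftDensity μ f).map fun p => inner ℝ p e) t := fun t => by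
    rw [h0, translation_field, hμ, charFun_apply, integral_map hm.aemeasurable
      (by fun_prop)]
    have := charFun_ftDensity μ f (t • e)
    rw [charFun_apply] at this
    simp only [inner_smul_right] at this
    refine Eq.trans ?_ (this.symm.trans ?_)
    · refine integral_congr_ae (Eventually.of_forall fun p => ?_)
      simp only [ft_translate]
      rw [← Complex.conj_mul', inner_smul_right]
      ring
    · refine integral_congr_ae (Eventually.of_forall fun p => ?_)
      simp
  obtain ⟨h2, h3⟩ := integrable_exp_of_strip hβ hd hc hF
  have h4 := map_inner_ftDensity (μ := μ) f e (fun x => Real.exp (-β * x)) (by fun_prop)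
  refine ⟨h4.1.1 h2, ?_⟩
  rw [← h4.2]
  have h5 := h1 0
  have ht0 : translate ((0 : ℝ) • e) f = f := by
    ext x
    change f (x - (0 : ℝ) • e) = f x
    simp
  rw [Complex.ofReal_zero, zero_add, h3, translation_field, ht0] at h5
  have h6 := hμ (conj f) (conj f)
  rw [conj_conj, ← h5] at h6
  simp only [Complex.conj_mul', ft_conj, RCLike.norm_conj] at h6
  apply Complex.ofReal_injective
  rw [h6, ← integral_complex_ofReal]
  push_cast
  rfl

/-- The KMS condition for the spectral measure: detailed balance. -/
theorem withDensity_exp_eq_map_neg {β : ℝ} (hβ : 0 < β) {e : Spacetime} (hKMS : IsKMS ω β e)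
    {μ : Measure Spacetime} [μ.HasTemperateGrowth]
    (hμ : ∀ f g : Test,
      ω (field m (conj f) * field m g) = ∫ p, starRingEnd ℂ (ft f p) * ft g p ∂μ) :
    (μ.withDensity fun p => ENNReal.ofReal (Real.exp (-β * inner ℝ p e))) = μ.map Neg.neg := by
  have hm : Measurable fun p : Spacetime => ENNReal.ofReal (Real.exp (-β * inner ℝ p e)) :=
    (Continuous.measurable (by fun_prop)).ennreal_ofReal
  have hae : ∀ f : Test, AEStronglyMeasurable (fun p => ‖ft f p‖ ^ 2) (μ.map Neg.neg) := fun f =>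
    (show Continuous fun p => ‖ft f p‖ ^ 2 from
      (continuous_ft (integrable_test f)).norm.pow 2).aestronglyMeasurable
  refine measure_ext_of_integral_norm_ft_sq (fun f => ?_) (fun f => ?_) (fun f => ?_)
  · rw [integrable_withDensity_iff_integrable_smul' hm (Eventually.of_forall fun p => by simp)]
    refine (integral_exp_norm_ft_sq hβ hKMS hμ f).1.congr (Eventually.of_forall fun p => ?_)
    simp [ENNReal.toReal_ofReal (Real.exp_nonneg _), mul_comm]
  · rw [integrable_map_measure (hae f) measurable_neg.aemeasurable]
    have := integrable_norm_ft_sq (μ := μ) (conj f)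
    simp only [ft_conj, RCLike.norm_conj] at this
    exact this
  · rw [integral_map measurable_neg.aemeasurable (hae f),
      ← (integral_exp_norm_ft_sq hβ hKMS hμ f).2,
      integral_withDensity_eq_integral_toReal_smul hm (Eventually.of_forall fun p => by simp)]
    refine integral_congr_ae (Eventually.of_forall fun p => ?_)
    simp [ENNReal.toReal_ofReal (Real.exp_nonneg _), mul_comm]

end KMS

/-! ### Analyticity of Laplace transforms in several variables -/

section LaplaceAnalytic

variable {E : Type*} [NormedAddCommGroup E] [NormedSpace ℂ E]

/-- The monomial `(y₁, …, yₙ) ↦ T y₁ ⋯ T yₙ` of a linear functional. -/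
def monomialOf (n : ℕ) (T : E →L[ℂ] ℂ) : ContinuousMultilinearMap ℂ (fun _ : Fin n => E) ℂ :=
  (ContinuousMultilinearMap.mkPiAlgebraFin ℂ n ℂ).compContinuousLinearMap fun _ => T

theorem monomialOf_apply (n : ℕ) (T : E →L[ℂ] ℂ) (y : E) :
    monomialOf n T (fun _ => y) = T y ^ n := by
  simp [monomialOf]

theorem norm_monomialOf_le (n : ℕ) (T : E →L[ℂ] ℂ) : ‖monomialOf n T‖ ≤ ‖T‖ ^ n := by
  refine (ContinuousMultilinearMap.norm_compContinuousLinearMap_le _ _).trans ?_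
  simp

theorem continuous_monomialOf (n : ℕ) : Continuous (monomialOf (E := E) n) := by
  have h : Continuous fun T : E →L[ℂ] ℂ =>
      ContinuousMultilinearMap.compContinuousLinearMapContinuousMultilinear ℂ (fun _ : Fin n => E)
        (fun _ => ℂ) ℂ (fun _ => T) (ContinuousMultilinearMap.mkPiAlgebraFin ℂ n ℂ) :=
    ((ContinuousMultilinearMap.cont _).comp (continuous_pi fun _ => continuous_id)).clm_apply
      continuous_const
  exact h

/-- Laplace transforms are analytic in the interior of their domain of convergence. -/
theorem analyticAt_integral_cexp {α : Type*} [MeasurableSpace α] {μ : Measure α}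
    {L : α → E →L[ℂ] ℂ} (hL : AEStronglyMeasurable L μ) {ζ₀ : E} {r : ℝ} (hr : 0 < r)
    (hint : Integrable (fun p => Real.exp (r * ‖L p‖) * ‖Complex.exp (L p ζ₀)‖) μ) :
    AnalyticAt ℂ (fun ζ => ∫ p, Complex.exp (L p ζ) ∂μ) ζ₀ := by
  lift r to NNReal using hr.le
  have hmeas : ∀ y : E, AEStronglyMeasurable (fun p => L p y) μ := fun y =>
    (ContinuousLinearMap.apply ℂ ℂ y).continuous.comp_aestronglyMeasurable hL
  -- The `n`-th Taylor coefficient of `ζ ↦ exp(L p ζ)` at `ζ₀`. On the ball of radius `r` the whole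
  -- series is dominated by `exp(r‖L p‖) ‖exp(L p ζ₀)‖`, so it may be integrated term by term.
  let Q : ∀ n : ℕ, α → ContinuousMultilinearMap ℂ (fun _ : Fin n => E) ℂ := fun n p =>
    (Complex.exp (L p ζ₀) * (n.factorial : ℂ)⁻¹) • monomialOf n (L p)
  have hQm : ∀ n, AEStronglyMeasurable (Q n) μ := fun n =>
    ((Complex.continuous_exp.comp_aestronglyMeasurable (hmeas ζ₀)).mul_const _).smul
      ((continuous_monomialOf n).comp_aestronglyMeasurable hL)
  have hQn : ∀ n p, ‖Q n p‖ * (r : ℝ) ^ n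
      ≤ (r * ‖L p‖) ^ n / n.factorial * ‖Complex.exp (L p ζ₀)‖ := fun n p => by
    rw [norm_smul, norm_mul, norm_inv, Complex.norm_natCast]
    calc _ ≤ ‖Complex.exp (L p ζ₀)‖ * (n.factorial : ℝ)⁻¹ * ‖L p‖ ^ n * (r : ℝ) ^ n := by
          gcongr
          exact norm_monomialOf_le n (L p)
      _ = _ := by
          rw [mul_pow]
          ring
  have hQe : ∀ n p, ‖Q n p‖ * (r : ℝ) ^ n
      ≤ Real.exp (r * ‖L p‖) * ‖Complex.exp (L p ζ₀)‖ := fun n p =>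
    (hQn n p).trans (mul_le_mul_of_nonneg_right
      (Real.pow_div_factorial_le_exp _ (by positivity) n) (norm_nonneg _))
  have hrn : ∀ n, 0 < (r : ℝ) ^ n := fun n => pow_pos hr n
  have hQi : ∀ n, Integrable (Q n) μ := fun n => by
    refine (hint.mul_const ((r : ℝ) ^ n)⁻¹).mono' (hQm n) (Eventually.of_forall fun p => ?_)
    rw [← div_eq_mul_inv, le_div_iff₀ (hrn n)]
    exact hQe n p
  let P : FormalMultilinearSeries ℂ E ℂ := fun n => ∫ p, Q n p ∂μ
  refine HasFPowerSeriesAt.analyticAt (p := P) ⟨r, ?_, by simpa using hr, ?_⟩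
  · refine P.le_radius_of_bound
      (∫ p, Real.exp (r * ‖L p‖) * ‖Complex.exp (L p ζ₀)‖ ∂μ) fun n => ?_
    refine (mul_le_mul_of_nonneg_right (norm_integral_le_integral_norm _) (hrn n).le).trans ?_
    rw [← integral_mul_const]
    exact integral_mono ((hQi n).norm.mul_const _) hint fun p => hQe n p
  · intro y hy
    have hy' : ‖y‖ ≤ r := by
      have : ‖y‖ < r := by simpa using hy
      exact this.le
    have hPy : ∀ n, P n (fun _ => y) = ∫ p, Q n p (fun _ => y) ∂μ := fun n =>
      (((ContinuousMultilinearMap.apply ℂ (fun _ : Fin n => E) ℂ (fun _ => y))).integral_comp_comm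
        (hQi n)).symm
    have hQy : ∀ n p, Q n p (fun _ => y)
        = Complex.exp (L p ζ₀) * (L p y ^ n / n.factorial) := fun n p => by
      change (Complex.exp (L p ζ₀) * (n.factorial : ℂ)⁻¹) • monomialOf n (L p) (fun _ => y) = _
      rw [monomialOf_apply, smul_eq_mul]
      ring
    have hsum : ∀ p, HasSum (fun n => (r * ‖L p‖) ^ n / n.factorial * ‖Complex.exp (L p ζ₀)‖)
        (Real.exp (r * ‖L p‖) * ‖Complex.exp (L p ζ₀)‖) := fun p => by
      rw [Real.exp_eq_exp_ℝ]
      exact (NormedSpace.expSeries_div_hasSum_exp (r * ‖L p‖)).mul_right _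
    simp only [hPy]
    refine hasSum_integral_of_dominated_convergence
      (fun n p => (r * ‖L p‖) ^ n / n.factorial * ‖Complex.exp (L p ζ₀)‖) (fun n => ?_)
      (fun n => Eventually.of_forall fun p => ?_) (Eventually.of_forall fun p => (hsum p).summable)
      ?_ (Eventually.of_forall fun p => ?_)
    · exact (ContinuousMultilinearMap.apply ℂ (fun _ : Fin n => E) ℂ
        (fun _ => y)).continuous.comp_aestronglyMeasurable (hQm n)
    · refine (ContinuousMultilinearMap.le_opNorm _ _).trans (le_trans ?_ (hQn n p))
      rw [Finset.prod_const, Finset.card_univ, Fintype.card_fin]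
      gcongr
    · exact hint.congr (Eventually.of_forall fun p => (hsum p).tsum_eq.symm)
    · simp only [hQy]
      rw [map_add, Complex.exp_add, Complex.exp_eq_exp_ℂ]
      exact (NormedSpace.expSeries_div_hasSum_exp (L p y)).mul_left _

end LaplaceAnalytic

/-! ### Thermal measures, the function on the tube and its boundary values -/

section Thermal

theorem integrable_exp_neg_mul_norm {V : Type*} [NormedAddCommGroup V] [MeasurableSpace V]
    [BorelSpace V] [SecondCountableTopology V] (μ : Measure V) [μ.HasTemperateGrowth] {t : ℝ} (ht : 0 < t) :
    Integrable (fun p => Real.exp (-t * ‖p‖)) μ := by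
  have h := integrable_of_le_of_pow_mul_le (μ := μ) (k := 0) (f := fun p : V => Real.exp (-t * ‖p‖))
    (C₁ := 1) (C₂ := (μ.integrablePower).factorial / t ^ μ.integrablePower)
    (fun p => by
      rw [Real.norm_of_nonneg (Real.exp_nonneg _), Real.exp_le_one_iff]
      nlinarith [norm_nonneg p])
    (fun p => by
      rw [Real.norm_of_nonneg (Real.exp_nonneg _), zero_add]
      have h1 := Real.pow_div_factorial_le_exp (t * ‖p‖) (by positivity) μ.integrablePower
      have h2 : Real.exp (-t * ‖p‖) * Real.exp (t * ‖p‖) = 1 := by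
        rw [← Real.exp_add]
        simp
      rw [le_div_iff₀ (by positivity)]
      rw [div_le_iff₀ (by positivity), mul_pow] at h1
      calc _ = Real.exp (-t * ‖p‖) * (t ^ μ.integrablePower * ‖p‖ ^ μ.integrablePower) := by ring
        _ ≤ Real.exp (-t * ‖p‖) * (Real.exp (t * ‖p‖) * (μ.integrablePower).factorial) := by gcongr
        _ = _ := by rw [← mul_assoc, h2, one_mul])
    (Continuous.aestronglyMeasurable (by fun_prop))
  simpa using h

variable {μ : Measure Spacetime} {β c : ℝ} {e : Spacetime}

/-- A tempered measure that is concentrated where the energy dominates the momentum and that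
satisfies the detailed balance condition `exp(-β⟨p,e⟩) dμ(p) = dμ(-p)`. -/
structure IsThermal (μ : Measure Spacetime) (β c : ℝ) (e : Spacetime) : Prop where
  temperate : μ.HasTemperateGrowth
  sfinite : SFinite μ
  norm_le : ∀ᵐ p ∂μ, ‖p‖ ≤ c * |inner ℝ p e|
  balance : (μ.withDensity fun p => ENNReal.ofReal (Real.exp (-β * inner ℝ p e))) = μ.map Neg.neg

theorem measurable_exp_inner (β : ℝ) (e : Spacetime) :
    Measurable fun p : Spacetime => ENNReal.ofReal (Real.exp (-β * inner ℝ p e)) :=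
  (Continuous.measurable (by fun_prop)).ennreal_ofReal

theorem IsThermal.integrable_mul_exp (hμ : IsThermal μ β c e) {W : Type*} [NormedAddCommGroup W]
    [NormedSpace ℝ W] {g : Spacetime → W} (hg : Integrable g (μ.map Neg.neg)) :
    Integrable (fun p => Real.exp (-β * inner ℝ p e) • g p) μ := by
  rw [← hμ.balance, integrable_withDensity_iff_integrable_smul' (measurable_exp_inner β e)
    (Eventually.of_forall fun p => by simp)] at hg
  simpa [ENNReal.toReal_ofReal (Real.exp_nonneg _)] using hg

theorem IsThermal.integral_mul_exp (hμ : IsThermal μ β c e) {g : Spacetime → ℂ}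
    (hg : Continuous g) :
    ∫ p, Real.exp (-β * inner ℝ p e) • g p ∂μ = ∫ p, g (-p) ∂μ := by
  rw [← integral_map measurable_neg.aemeasurable hg.aestronglyMeasurable, ← hμ.balance,
    integral_withDensity_eq_integral_toReal_smul (measurable_exp_inner β e)
      (Eventually.of_forall fun p => by simp)]
  simp [ENNReal.toReal_ofReal (Real.exp_nonneg _)]

theorem IsThermal.temperate_map_neg (hμ : IsThermal μ β c e) :
    (μ.map Neg.neg).HasTemperateGrowth := by
  obtain ⟨n, hn⟩ := hμ.temperate.exists_integrable
  refine ⟨n, ?_⟩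
  rw [integrable_map_measure (Continuous.aestronglyMeasurable ?_) measurable_neg.aemeasurable]
  · simpa [Function.comp_def] using hn
  · exact Continuous.rpow_const (by fun_prop) fun x => Or.inl (by positivity)

/-- The majorant is uniform in `σ` and usable for thermal measures: the term `1` is handled by `μ`,
and the term `exp(-βx)` by the reflected measure, which is tempered as well. -/
theorem exp_neg_mul_le {β σ x : ℝ} (hσ : 0 ≤ σ) (hσβ : σ ≤ β) :
    Real.exp (-σ * x) ≤ 1 + Real.exp (-β * x) := by
  rcases le_total 0 x with hx | hx
  · have : Real.exp (-σ * x) ≤ 1 := Real.exp_le_one_iff.2 (by nlinarith)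
    linarith [Real.exp_nonneg (-β * x)]
  · have : Real.exp (-σ * x) ≤ Real.exp (-β * x) := Real.exp_le_exp.2 (by nlinarith)
    linarith

theorem IsThermal.integrable_one_add_exp_mul (hμ : IsThermal μ β c e) {g : Spacetime → ℝ}
    (h₁ : Integrable g μ) (h₂ : Integrable g (μ.map Neg.neg)) :
    Integrable (fun p => (1 + Real.exp (-β * inner ℝ p e)) * g p) μ := by
  refine (h₁.add (hμ.integrable_mul_exp h₂)).congr (Eventually.of_forall fun p => ?_)
  simp [add_mul]

/-- The spectral measure has exponential moments inside the strip. -/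
theorem IsThermal.integrable_exp (hμ : IsThermal μ β c e) (hc : 0 < c) {σ : ℝ} (hσ : 0 < σ)
    (hσβ : σ < β) : ∃ r > 0,
      Integrable (fun p => Real.exp (r * ‖p‖) * Real.exp (-σ * inner ℝ p e)) μ := by
  have := hμ.temperate
  have := hμ.temperate_map_neg
  -- `δ` is the distance of `σ` to the ends of the strip, so `exp(δ|x| - σx) ≤ 1 + exp(-βx)` for `x
  -- = ⟨p,e⟩`. Since `‖p‖ ≤ c|x|`, the gain `exp(δ|x|)` exceeds `exp(2r‖p‖)` with `r = δ/(2c)`: one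
  -- half is the moment claimed, the other leaves `exp(-r‖p‖)` for integrability.
  set δ := min σ (β - σ) with hδ
  have hδ0 : 0 < δ := lt_min hσ (sub_pos.2 hσβ)
  refine ⟨δ / (2 * c), by positivity, ?_⟩
  have ht : 0 < δ / (2 * c) := by positivity
  have hi := hμ.integrable_one_add_exp_mul (integrable_exp_neg_mul_norm μ ht)
    (integrable_exp_neg_mul_norm (μ.map Neg.neg) ht)
  refine hi.mono' (Continuous.aestronglyMeasurable (by fun_prop)) ?_
  filter_upwards [hμ.norm_le] with p hp
  rw [Real.norm_of_nonneg (by positivity)]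
  set x : ℝ := inner ℝ p e
  have h1 : 2 * (δ / (2 * c)) * ‖p‖ ≤ δ * |x| := by
    calc 2 * (δ / (2 * c)) * ‖p‖ ≤ 2 * (δ / (2 * c)) * (c * |x|) := by gcongr
      _ = δ * |x| := by field_simp
  have h2 : Real.exp (δ * |x|) * Real.exp (-σ * x) ≤ 1 + Real.exp (-β * x) := by
    rw [← Real.exp_add]
    have hd1 : δ ≤ σ := min_le_left _ _
    have hd2 : δ ≤ β - σ := min_le_right _ _
    rcases abs_cases x with ⟨hx, hx0⟩ | ⟨hx, hx0⟩
    · rw [hx, show δ * x + -σ * x = -(σ - δ) * x by ring]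
      exact exp_neg_mul_le (by linarith) (by linarith)
    · rw [hx, show δ * -x + -σ * x = -(σ + δ) * x by ring]
      exact exp_neg_mul_le (by linarith) (by linarith)
  calc Real.exp (δ / (2 * c) * ‖p‖) * Real.exp (-σ * x)
      = Real.exp (-(δ / (2 * c)) * ‖p‖) * (Real.exp (2 * (δ / (2 * c)) * ‖p‖)
          * Real.exp (-σ * x)) := by
        have h3 : Real.exp (δ / (2 * c) * ‖p‖)
            = Real.exp (-(δ / (2 * c)) * ‖p‖) * Real.exp (2 * (δ / (2 * c)) * ‖p‖) := by
          rw [← Real.exp_add]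
          congr 1
          ring
        rw [h3, mul_assoc]
    _ ≤ Real.exp (-(δ / (2 * c)) * ‖p‖) * (Real.exp (δ * |x|) * Real.exp (-σ * x)) := by
        gcongr
    _ ≤ Real.exp (-(δ / (2 * c)) * ‖p‖) * (1 + Real.exp (-β * x)) := by gcongr
    _ = _ := mul_comm _ _

theorem IsThermal.integrable_exp_inner (hμ : IsThermal μ β c e) (hc : 0 < c) {σ : ℝ} (hσ : 0 < σ)
    (hσβ : σ < β) : Integrable (fun p => Real.exp (-σ * inner ℝ p e)) μ := by
  obtain ⟨r, hr, h⟩ := hμ.integrable_exp hc hσ hσβ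
  refine h.mono' (Continuous.aestronglyMeasurable (by fun_prop)) (Eventually.of_forall fun p => ?_)
  rw [Real.norm_of_nonneg (Real.exp_nonneg _)]
  exact le_mul_of_one_le_left (Real.exp_nonneg _) (Real.one_le_exp (by positivity))

/-- The linear functional `ζ ↦ i ∑ pᵤ ζᵤ` on complexified spacetime. -/
def phase (p : Spacetime) : ComplexSpacetime →L[ℂ] ℂ :=
  ∑ k, (Complex.I * (p k : ℂ)) • EuclideanSpace.proj k

theorem phase_apply (p : Spacetime) (ζ : ComplexSpacetime) :
    phase p ζ = Complex.I * ∑ k, (p k : ℂ) * ζ k := by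
  simp [phase, Finset.mul_sum, mul_assoc]

theorem continuous_phase : Continuous phase := by
  unfold phase
  fun_prop

theorem norm_phase_le (p : Spacetime) : ‖phase p‖ ≤ 4 * ‖p‖ := by
  refine (norm_sum_le _ _).trans ?_
  have h : ∀ k, ‖(Complex.I * (p k : ℂ)) • (EuclideanSpace.proj k : ComplexSpacetime →L[ℂ] ℂ)‖
      ≤ ‖p‖ := fun k => by
    rw [norm_smul, norm_mul, Complex.norm_I, one_mul, Complex.norm_real]
    refine (mul_le_of_le_one_right (norm_nonneg _) ?_).trans (PiLp.norm_apply_le p k)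
    refine ContinuousLinearMap.opNorm_le_bound _ zero_le_one fun ζ => ?_
    rw [one_mul]
    exact PiLp.norm_apply_le ζ k
  refine (Finset.sum_le_sum fun k _ => h k).trans ?_
  simp

theorem phase_tubePoint (p e z : Spacetime) (σ : ℝ) :
    phase p (tubePoint e z σ) = (-σ * inner ℝ p e : ℝ) + inner ℝ p z * Complex.I := by
  rw [phase_apply]
  simp only [tubePoint, PiLp.inner_apply, Fin.sum_univ_four]
  simp
  linear_combination (σ * (e 0 * p 0 + e 1 * p 1 + e 2 * p 2 + e 3 * p 3) : ℂ) * Complex.I_sq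

theorem exp_phase_tubePoint (p e z : Spacetime) (σ : ℝ) :
    Complex.exp (phase p (tubePoint e z σ))
      = (Real.exp (-σ * inner ℝ p e) : ℝ) * Complex.exp (inner ℝ p z * Complex.I) := by
  rw [phase_tubePoint, Complex.exp_add, Complex.ofReal_exp]

theorem norm_exp_phase_tubePoint (p e z : Spacetime) (σ : ℝ) :
    ‖Complex.exp (phase p (tubePoint e z σ))‖ = Real.exp (-σ * inner ℝ p e) := by
  rw [exp_phase_tubePoint, norm_mul, norm_exp_inner_mul_I, mul_one, Complex.norm_real,
    Real.norm_of_nonneg (Real.exp_nonneg _)]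

/-- The Fourier-Laplace transform of a measure. -/
def laplace (μ : Measure Spacetime) (ζ : ComplexSpacetime) : ℂ :=
  ∫ p, Complex.exp (phase p ζ) ∂μ

theorem IsThermal.analyticOnNhd_laplace (hμ : IsThermal μ β c e) (hc : 0 < c) :
    AnalyticOnNhd ℂ (laplace μ) (flatTube β e) := by
  rintro _ ⟨z, σ, hσ, hσβ, rfl⟩
  obtain ⟨r, hr, h⟩ := hμ.integrable_exp hc hσ hσβ
  -- The factor `4` compensates `‖phase p‖ ≤ 4‖p‖`.
  refine analyticAt_integral_cexp (r := r / 4) continuous_phase.aestronglyMeasurable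
    (by positivity) ?_
  refine h.mono' (Continuous.aestronglyMeasurable ?_) (Eventually.of_forall fun p => ?_)
  · have := continuous_phase
    fun_prop
  · rw [Real.norm_of_nonneg (by positivity), norm_exp_phase_tubePoint]
    refine mul_le_mul_of_nonneg_right (Real.exp_le_exp.2 ?_) (Real.exp_nonneg _)
    have := norm_phase_le p
    nlinarith

theorem norm_laplace_tubePoint_le (μ : Measure Spacetime) (e z : Spacetime) (σ : ℝ) :
    ‖laplace μ (tubePoint e z σ)‖ ≤ ∫ p, Real.exp (-σ * inner ℝ p e) ∂μ := by
  refine (norm_integral_le_integral_norm _).trans_eq ?_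
  simp only [norm_exp_phase_tubePoint]

/-- The modulus of the integrand does not depend on `z`, and on `K` it is at most the sum of its
values at the least and the greatest height. So `N = 0` suffices. -/
theorem IsThermal.laplace_bound (hμ : IsThermal μ β c e) (hc : 0 < c) {K : Set ℝ}
    (hK : IsCompact K) (hKβ : K ⊆ Set.Ioo 0 β) : ∃ C > 0, ∃ N : ℕ, ∀ z, ∀ σ ∈ K,
      ‖laplace μ (tubePoint e z σ)‖ ≤ C * (1 + ‖tubePoint e z σ‖) ^ N := by
  rcases K.eq_empty_or_nonempty with rfl | hne
  · exact ⟨1, one_pos, 0, fun z σ hσ => hσ.elim⟩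
  obtain ⟨a, haK, ha⟩ := hK.exists_isLeast hne
  obtain ⟨b, hbK, hb⟩ := hK.exists_isGreatest hne
  have hia := hμ.integrable_exp_inner hc (hKβ haK).1 (hKβ haK).2
  have hib := hμ.integrable_exp_inner hc (hKβ hbK).1 (hKβ hbK).2
  refine ⟨(∫ p, Real.exp (-a * inner ℝ p e) ∂μ) + (∫ p, Real.exp (-b * inner ℝ p e) ∂μ) + 1,
    ?_, 0, fun z σ hσ => ?_⟩
  · have h1 : 0 ≤ ∫ p, Real.exp (-a * inner ℝ p e) ∂μ := integral_nonneg fun p => Real.exp_nonneg _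
    have h2 : 0 ≤ ∫ p, Real.exp (-b * inner ℝ p e) ∂μ := integral_nonneg fun p => Real.exp_nonneg _
    linarith
  · rw [pow_zero, mul_one]
    refine (norm_laplace_tubePoint_le μ e z σ).trans ?_
    have h : ∫ p, Real.exp (-σ * inner ℝ p e) ∂μ
        ≤ ∫ p, (Real.exp (-a * inner ℝ p e) + Real.exp (-b * inner ℝ p e)) ∂μ := by
      refine integral_mono (hμ.integrable_exp_inner hc (hKβ hσ).1 (hKβ hσ).2) (hia.add hib)
        fun p => ?_
      have haσ := ha hσ
      have hσb := hb hσ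
      simp only
      rcases le_total 0 (inner ℝ p e : ℝ) with hx | hx
      · refine le_add_of_le_of_nonneg (Real.exp_le_exp.2 ?_) (Real.exp_nonneg _)
        nlinarith
      · refine le_add_of_nonneg_of_le (Real.exp_nonneg _) (Real.exp_le_exp.2 ?_)
        nlinarith
    rw [integral_add hia hib] at h
    linarith

/-- The tempered distribution `h ↦ ∫ ft h dμ`. -/
def spectralDistribution (μ : Measure Spacetime) [μ.HasTemperateGrowth] : 𝓢'(Spacetime, ℂ) :=
  ContinuousLinearMap.toPointwiseConvergenceCLM _ _ _ _ ((SchwartzMap.integralCLM ℂ μ).comp ftCLM)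

theorem spectralDistribution_apply (μ : Measure Spacetime) [μ.HasTemperateGrowth]
    (h : 𝓢(Spacetime, ℂ)) : spectralDistribution μ h = ∫ p, ft h p ∂μ := by
  have : spectralDistribution μ h = ∫ p, ftCLM h p ∂μ := rfl
  rw [this]
  simp only [ftCLM_apply]

/-- Fubini: smearing in `z` at height `σ` becomes the weight `exp(-σ⟨p,e⟩)` on the momentum side,
and the boundary limits reduce to limits of this weight. -/
theorem integral_laplace_mul [SFinite μ] {σ : ℝ}
    (hi : Integrable (fun p => Real.exp (-σ * inner ℝ p e)) μ) {h : Spacetime → ℂ} (hh : Integrable h) :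
    ∫ z, laplace μ (tubePoint e z σ) * h z = ∫ p, Real.exp (-σ * inner ℝ p e) • ft h p ∂μ := by
  have hprod : Integrable (fun x : Spacetime × Spacetime =>
      Complex.exp (phase x.2 (tubePoint e x.1 σ)) * h x.1) (volume.prod μ) := by
    have h1 : Integrable (fun x : Spacetime × Spacetime =>
        h x.1 * ((Real.exp (-σ * inner ℝ x.2 e) : ℝ) : ℂ)) (volume.prod μ) :=
      hh.mul_prod hi.ofReal
    refine (h1.mul_bdd (c := 1) (g := fun x : Spacetime × Spacetime =>
      Complex.exp (inner ℝ x.2 x.1 * Complex.I)) (Continuous.aestronglyMeasurable (by fun_prop))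
      (Eventually.of_forall fun x => (norm_exp_inner_mul_I _ _).le)).congr
      (Eventually.of_forall fun x => ?_)
    simp only [exp_phase_tubePoint]
    ring
  simp only [laplace, ← integral_mul_const]
  rw [integral_integral_swap hprod]
  refine integral_congr_ae (Eventually.of_forall fun p => ?_)
  simp only [exp_phase_tubePoint]
  rw [ft, ← integral_smul]
  refine integral_congr_ae (Eventually.of_forall fun z => ?_)
  simp only [Complex.real_smul]
  ring

theorem integrable_ft {ρ : Measure Spacetime} [ρ.HasTemperateGrowth] (h : 𝓢(Spacetime, ℂ)) :
    Integrable (ft h) ρ := by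
  have := (ftCLM h).integrable (μ := ρ)
  rwa [show (ftCLM h : Spacetime → ℂ) = ft h from funext fun p => ftCLM_apply h p] at this

/-- Dominated convergence for the Gibbs factor. -/
theorem IsThermal.tendsto_integral_exp_smul_ft (hμ : IsThermal μ β c e) (h : 𝓢(Spacetime, ℂ))
    {l : Filter ℝ} [l.IsCountablyGenerated] {s : ℝ → ℝ} {σ₀ : ℝ} (hs : Tendsto s l (𝓝 σ₀))
    (h0 : ∀ᶠ t in l, 0 ≤ s t ∧ s t ≤ β) :
    Tendsto (fun t => ∫ p, Real.exp (-s t * inner ℝ p e) • ft h p ∂μ) l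
      (𝓝 (∫ p, Real.exp (-σ₀ * inner ℝ p e) • ft h p ∂μ)) := by
  have := hμ.temperate
  have := hμ.temperate_map_neg
  have hc := continuous_ft (h.integrable (μ := volume))
  refine tendsto_integral_filter_of_dominated_convergence
    (fun p => (1 + Real.exp (-β * inner ℝ p e)) * ‖ft h p‖)
    (Eventually.of_forall fun t => Continuous.aestronglyMeasurable (by fun_prop)) ?_
    (hμ.integrable_one_add_exp_mul (integrable_ft h).norm (integrable_ft h).norm) ?_
  · filter_upwards [h0] with t ht
    refine Eventually.of_forall fun p => ?_
    rw [norm_smul, Real.norm_of_nonneg (Real.exp_nonneg _)]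
    exact mul_le_mul_of_nonneg_right (exp_neg_mul_le ht.1 ht.2) (norm_nonneg _)
  · refine Eventually.of_forall fun p => ?_
    refine Tendsto.smul_const ?_ _
    exact (Real.continuous_exp.tendsto _).comp (hs.neg.mul_const _)

theorem ft_reflectSchwartz (h : 𝓢(Spacetime, ℂ)) (p : Spacetime) :
    ft (reflectSchwartz h) p = ft h (-p) := by
  rw [ft, ft, ← integral_neg_eq_self]
  refine integral_congr_ae (Eventually.of_forall fun x => ?_)
  change h (- -x) * _ = _
  simp

theorem IsThermal.tendsto_laplace_zero (hμ : IsThermal μ β c e) [μ.HasTemperateGrowth] (hc : 0 < c)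
    (hβ : 0 < β) (h : 𝓢(Spacetime, ℂ)) :
    Tendsto (fun σ : ℝ => ∫ z, laplace μ (tubePoint e z σ) * h z) (𝓝[>] 0)
      (𝓝 (spectralDistribution μ h)) := by
  have := hμ.sfinite
  have hev : ∀ᶠ σ : ℝ in 𝓝[>] 0, σ ∈ Set.Ioo 0 β := Ioo_mem_nhdsGT hβ
  have h1 := hμ.tendsto_integral_exp_smul_ft h (l := 𝓝[>] (0 : ℝ)) (s := id)
    (tendsto_nhdsWithin_of_tendsto_nhds tendsto_id)
    (hev.mono fun σ hσ => ⟨hσ.1.le, hσ.2.le⟩)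
  rw [spectralDistribution_apply]
  simp only [neg_zero, zero_mul, Real.exp_zero, one_smul, id] at h1
  refine h1.congr' ?_
  filter_upwards [hev] with σ hσ
  exact (integral_laplace_mul (hμ.integrable_exp_inner hc hσ.1 hσ.2) h.integrable).symm

/-- In the limit the weight is `exp(-β⟨p,e⟩)`; detailed balance trades it for `p ↦ -p`, which is the
reflection of the test function. -/
theorem IsThermal.tendsto_laplace_beta (hμ : IsThermal μ β c e) [μ.HasTemperateGrowth] (hc : 0 < c)
    (hβ : 0 < β) (h : 𝓢(Spacetime, ℂ)) :
    Tendsto (fun η : ℝ => ∫ z, laplace μ (tubePoint e z (β - η)) * h z) (𝓝[>] 0)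
      (𝓝 (spectralDistribution μ (reflectSchwartz h))) := by
  have := hμ.sfinite
  have hev : ∀ᶠ σ : ℝ in 𝓝[>] 0, σ ∈ Set.Ioo 0 β := Ioo_mem_nhdsGT hβ
  have hs : Tendsto (fun η : ℝ => β - η) (𝓝[>] 0) (𝓝 β) := by
    have : Tendsto (fun η : ℝ => β - η) (𝓝 0) (𝓝 (β - 0)) := tendsto_const_nhds.sub tendsto_id
    rw [sub_zero] at this
    exact tendsto_nhdsWithin_of_tendsto_nhds this
  have h1 := hμ.tendsto_integral_exp_smul_ft h (l := 𝓝[>] (0 : ℝ)) hs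
    (hev.mono fun σ hσ => ⟨by linarith [hσ.2], by linarith [hσ.1]⟩)
  rw [hμ.integral_mul_exp (continuous_ft h.integrable)] at h1
  rw [spectralDistribution_apply]
  simp only [ft_reflectSchwartz]
  refine h1.congr' ?_
  filter_upwards [hev] with σ hσ
  exact (integral_laplace_mul (hμ.integrable_exp_inner hc (by linarith [hσ.2])
    (by linarith [hσ.1])) h.integrable).symm

end Thermal

/-! ### Locally bounded functionals are distributions -/

section LocallyBounded

variable {V : Type} [NormedAddCommGroup V] [NormedSpace ℝ V]

theorem IsLocallyBounded.continuous {u : 𝓓((⊤ : Opens V), ℂ) →ₗ[ℂ] ℂ} (hu : IsLocallyBounded u) :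
    Continuous u := by
  refine (TestFunction.mkCLM ℂ u (map_add u) (map_smul u) fun K hK => ?_).continuous
  obtain ⟨N, C, hC, h⟩ := hu K K.isCompact
  let A : 𝓓_{K}(V, ℂ) →L[ℂ] ℂ := ContDiffMapSupportedIn.mkCLMtoNormedSpace ℂ
    (fun f => u (TestFunction.ofSupportedIn hK f)) (fun f g => (congrArg u (show
      TestFunction.ofSupportedIn hK (f + g) = TestFunction.ofSupportedIn hK f
        + TestFunction.ofSupportedIn hK g from rfl)).trans (map_add u _ _))
    (fun c f => (congrArg u (show TestFunction.ofSupportedIn hK (c • f)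
      = c • TestFunction.ofSupportedIn hK f from rfl)).trans (map_smul u c _)) ⟨Finset.range (N + 1), C, hC, fun f => by
      refine (h _ f.tsupport_subset).trans (mul_le_mul_of_nonneg_left ?_ hC)
      refine norm_jet_le (apply_nonneg _ _) fun i hi x => ?_
      refine le_trans ?_ (Seminorm.le_finset_sup_apply (Finset.mem_range_succ_iff.2 hi))
      exact ContDiffMapSupportedIn.norm_iteratedFDeriv_apply_le_seminorm_top ℂ⟩
  exact A.continuous

end LocallyBounded

/-! ### The two-point distribution and its pullback to the relative variable -/

section Difference

/-- The Fourier transform with respect to the difference of two spacetime points. -/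
def ftDiff (k : (Fin 2 → Spacetime) → ℂ) (p : Spacetime) : ℂ :=
  ∫ v, k v * Complex.exp (inner ℝ p (v 1 - v 0) * Complex.I)

abbrev TwoPointTest : Type := 𝓓((⊤ : Opens (Fin 2 → Spacetime)), ℂ)

theorem integrable_twoPointTest (k : TwoPointTest) : Integrable k :=
  k.continuous.integrable_of_hasCompactSupport k.hasCompactSupport

theorem integrable_ftDiff_integrand (k : TwoPointTest) (p : Spacetime) :
    Integrable fun v : Fin 2 → Spacetime =>
      k v * Complex.exp (inner ℝ p (v 1 - v 0) * Complex.I) :=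
  (integrable_twoPointTest k).mul_bdd (c := 1) (Continuous.aestronglyMeasurable (by fun_prop))
    (Eventually.of_forall fun v => (norm_exp_inner_mul_I p _).le)

theorem norm_ftDiff_le (k : (Fin 2 → Spacetime) → ℂ) (p : Spacetime) :
    ‖ftDiff k p‖ ≤ ∫ v, ‖k v‖ := by
  refine (norm_integral_le_integral_norm _).trans_eq ?_
  simp only [norm_mul, norm_exp_inner_mul_I, mul_one]

theorem continuous_ftDiff (k : TwoPointTest) : Continuous (ftDiff k) := by
  refine continuous_of_dominated (bound := fun v => ‖k v‖)
    (fun p => (integrable_ftDiff_integrand k p).aestronglyMeasurable)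
    (fun p => Eventually.of_forall fun v => ?_) (integrable_twoPointTest k).norm
    (Eventually.of_forall fun v => by fun_prop)
  rw [norm_mul, norm_exp_inner_mul_I, mul_one]

/-- The pairing `(v, w) ↦ -⟨v₁ - v₀, w⟩`. -/
def diffPairing : (Fin 2 → Spacetime) →L[ℝ] Spacetime →L[ℝ] ℝ :=
  (innerSL ℝ).comp (ContinuousLinearMap.proj (R := ℝ) (φ := fun _ : Fin 2 => Spacetime) 0
    - ContinuousLinearMap.proj (R := ℝ) (φ := fun _ : Fin 2 => Spacetime) 1)

theorem diffPairing_apply (v : Fin 2 → Spacetime) (w : Spacetime) :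
    diffPairing v w = -inner ℝ w (v 1 - v 0) := by
  change inner ℝ (v 0 - v 1) w = _
  rw [real_inner_comm, ← inner_neg_right, neg_sub]

theorem ftDiff_eq_fourierIntegral (k : (Fin 2 → Spacetime) → ℂ) (w : Spacetime) :
    VectorFourier.fourierIntegral Real.fourierChar volume diffPairing.toLinearMap₁₂ k w
      = ftDiff k ((2 * Real.pi) • w) := by
  rw [VectorFourier.fourierIntegral, ftDiff]
  refine integral_congr_ae (Eventually.of_forall fun v => ?_)
  change Real.fourierChar (-(diffPairing v w)) • k v = _
  rw [diffPairing_apply, neg_neg, Circle.smul_def, Real.fourierChar_apply, smul_eq_mul,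
    mul_comm]
  simp [inner_smul_left]

theorem integral_norm_iteratedFDeriv_le {V : Type} [NormedAddCommGroup V] [NormedSpace ℝ V]
    [MeasurableSpace V] [BorelSpace V] {μ : Measure V} [IsFiniteMeasureOnCompacts μ] {K : Set V}
    (hK : IsCompact K) {i N : ℕ} (hi : i ≤ N) {f : 𝓓((⊤ : Opens V), ℂ)} (hf : tsupport f ⊆ K) :
    ∫ x, ‖iteratedFDeriv ℝ i f x‖ ∂μ ≤ μ.real K * ‖jet N f‖ := by
  have h0 : ∀ x ∉ K, ‖iteratedFDeriv ℝ i f x‖ = 0 := fun x hx => by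
    rw [norm_eq_zero]
    by_contra h
    exact hx (hf (support_iteratedFDeriv_subset i h))
  rw [← setIntegral_eq_integral_of_forall_compl_eq_zero h0]
  have h := norm_setIntegral_le_of_norm_le_const (μ := μ) (f := fun x => ‖iteratedFDeriv ℝ i f x‖)
    (C := ‖jet N f‖) hK.measure_lt_top
    fun x _ => by rw [norm_norm]; exact norm_iteratedFDeriv_le_norm_jet hi f x
  rw [mul_comm]
  exact (Real.le_norm_self _).trans h

/-- Integration by parts in the second point alone already gives decay in `p`, since `p` is dual to
the difference of the points. -/
theorem pow_mul_norm_ftDiff_le {K : Set (Fin 2 → Spacetime)} (hK : IsCompact K) (n : ℕ) :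
    ∃ C : ℝ, 0 ≤ C ∧ ∀ k : TwoPointTest, tsupport k ⊆ K → ∀ p,
      ‖p‖ ^ n * ‖ftDiff k p‖ ≤ C * ‖jet n k‖ := by
  refine ⟨(2 * Real.pi) ^ n * 2 ^ n * ((n + 1) * volume.real K), by positivity,
    fun k hk p => ?_⟩
  set w := (2 * Real.pi)⁻¹ • p with hw
  have hp : p = (2 * Real.pi) • w := by
    rw [hw, smul_inv_smul₀ (by positivity)]
  have hcont : ∀ i : ℕ, Continuous (iteratedFDeriv ℝ i k) := fun i =>
    k.contDiff.continuous_iteratedFDeriv (by exact_mod_cast le_top)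
  -- The direction `(0, w)` pairs with `w` to `-‖w‖²` and has norm at most `‖w‖`, so one factor
  -- `‖w‖ⁿ` cancels later.
  have h := VectorFourier.pow_mul_norm_iteratedFDeriv_fourierIntegral_le (μ := volume)
    (K := 0) (N := ⊤) diffPairing k.contDiff
    (fun a b _ _ => (((continuous_norm.pow a).mul (hcont b).norm).integrable_of_hasCompactSupport
      (k.hasCompactSupport.iteratedFDeriv b).norm.mul_left)) (k := 0) (n := n) le_rfl le_top
    ![0, w] w
  rw [norm_iteratedFDeriv_zero, ftDiff_eq_fourierIntegral, ← hp, diffPairing_apply] at h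
  have hnorm : ‖(![0, w] : Fin 2 → Spacetime)‖ ≤ ‖w‖ := by
    refine (pi_norm_le_iff_of_nonneg (norm_nonneg _)).2 fun i => ?_
    fin_cases i <;> simp
  have hin : |-inner ℝ w ((![0, w] : Fin 2 → Spacetime) 1 - (![0, w] : Fin 2 → Spacetime) 0)|
      = ‖w‖ * ‖w‖ := by
    simp [sq]
  have hsum : ∑ x ∈ Finset.range (0 + 1) ×ˢ Finset.range (n + 1),
      ∫ v, ‖v‖ ^ x.1 * ‖iteratedFDeriv ℝ x.2 k v‖ ≤ (n + 1) * volume.real K * ‖jet n k‖ := by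
    rw [zero_add, Finset.range_one, Finset.sum_product, Finset.sum_singleton]
    calc _ ≤ ∑ i ∈ Finset.range (n + 1), volume.real K * ‖jet n k‖ := by
          refine Finset.sum_le_sum fun i hi => ?_
          simp only [pow_zero, one_mul]
          exact integral_norm_iteratedFDeriv_le hK (Finset.mem_range_succ_iff.1 hi) hk
      _ = _ := by
          simp
          ring
  rw [hin, mul_pow] at h
  have h2 : ‖w‖ ^ n * ‖w‖ ^ n * ‖ftDiff k p‖
      ≤ ‖w‖ ^ n * (2 ^ n * ((n + 1) * volume.real K * ‖jet n k‖)) := by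
    refine h.trans ?_
    simp only [pow_zero, mul_one, Nat.cast_zero, mul_zero, zero_add]
    rw [mul_assoc]
    gcongr
  have h3 : ‖w‖ ^ n * ‖ftDiff k p‖ ≤ 2 ^ n * ((n + 1) * volume.real K * ‖jet n k‖) := by
    rcases eq_or_ne (‖w‖ ^ n) 0 with h0 | h0
    · rw [h0, zero_mul]
      positivity
    · rw [mul_assoc] at h2
      exact le_of_mul_le_mul_left h2 (lt_of_le_of_ne (by positivity) h0.symm)
  have hpw : ‖p‖ = 2 * Real.pi * ‖w‖ := by
    rw [hp, norm_smul, Real.norm_of_nonneg (by positivity)]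
  rw [hpw, mul_pow, mul_assoc]
  calc _ ≤ (2 * Real.pi) ^ n * (2 ^ n * ((n + 1) * volume.real K * ‖jet n k‖)) := by gcongr
    _ = _ := by ring

theorem norm_jet_mono {V : Type} [NormedAddCommGroup V] [NormedSpace ℝ V] {M N : ℕ} (h : M ≤ N)
    (f : 𝓓((⊤ : Opens V), ℂ)) : ‖jet M f‖ ≤ ‖jet N f‖ :=
  norm_jet_le (norm_nonneg _) fun _ hi x => norm_iteratedFDeriv_le_norm_jet (hi.trans h) f x

variable (μ : Measure Spacetime) [μ.HasTemperateGrowth]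

theorem integrable_ftDiff (k : TwoPointTest) : Integrable (ftDiff k) μ := by
  obtain ⟨C, -, hC⟩ := pow_mul_norm_ftDiff_le k.hasCompactSupport.isCompact (0 + μ.integrablePower)
  have h := integrable_of_le_of_pow_mul_le (μ := μ) (k := 0) (f := ftDiff k)
    (fun p => norm_ftDiff_le k p) (fun p => hC k subset_rfl p)
    (continuous_ftDiff k).aestronglyMeasurable
  simp only [pow_zero, one_mul] at h
  exact (integrable_norm_iff (continuous_ftDiff k).aestronglyMeasurable).1 h

/-- The linear functional `k ↦ ∫ ftDiff k dμ` on test functions of two points. -/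
def twoPointLinear : TwoPointTest →ₗ[ℂ] ℂ where
  toFun k := ∫ p, ftDiff k p ∂μ
  map_add' k l := by
    rw [← integral_add (integrable_ftDiff μ k) (integrable_ftDiff μ l)]
    refine integral_congr_ae (Eventually.of_forall fun p => ?_)
    simp only [ftDiff]
    rw [← integral_add (integrable_ftDiff_integrand k p) (integrable_ftDiff_integrand l p)]
    refine integral_congr_ae (Eventually.of_forall fun v => ?_)
    exact add_mul _ _ _
  map_smul' a k := by
    rw [RingHom.id_apply, smul_eq_mul, ← integral_const_mul]
    refine integral_congr_ae (Eventually.of_forall fun p => ?_)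
    simp only [ftDiff]
    rw [← integral_const_mul]
    refine integral_congr_ae (Eventually.of_forall fun v => ?_)
    exact mul_assoc _ _ _

theorem isLocallyBounded_twoPointLinear : IsLocallyBounded (twoPointLinear μ) := by
  intro K hK
  set M := μ.integrablePower
  obtain ⟨C₁, hC₁, h₁⟩ := pow_mul_norm_ftDiff_le hK 0
  obtain ⟨C₂, hC₂, h₂⟩ := pow_mul_norm_ftDiff_le hK M
  refine ⟨M, 2 ^ M * (∫ x, (1 + ‖x‖) ^ (-(M : ℝ)) ∂μ) * (C₁ + C₂), ?_, fun k hk => ?_⟩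
  · have : 0 ≤ ∫ x, (1 + ‖x‖) ^ (-(M : ℝ)) ∂μ := integral_nonneg fun x => by positivity
    positivity
  · have h := integral_pow_mul_le_of_le_of_pow_mul_le (μ := μ) (f := ftDiff k) (k := 0)
      (C₁ := C₁ * ‖jet M k‖) (C₂ := C₂ * ‖jet M k‖)
      (fun p => by
        have := h₁ k hk p
        rw [pow_zero, one_mul] at this
        exact this.trans (mul_le_mul_of_nonneg_left (norm_jet_mono (Nat.zero_le M) k) hC₁))
      (fun p => by
        rw [zero_add]
        exact h₂ k hk p)
    simp only [pow_zero, one_mul] at h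
    refine (norm_integral_le_integral_norm _).trans (h.trans_eq ?_)
    ring

/-- The two-point distribution with spectral measure `μ`. -/
def twoPointDistribution : TwoPointTest →L[ℂ] ℂ where
  toLinearMap := twoPointLinear μ
  cont := (isLocallyBounded_twoPointLinear μ).continuous

theorem twoPointDistribution_apply (k : TwoPointTest) :
    twoPointDistribution μ k = ∫ p, ftDiff k p ∂μ := rfl

theorem ftDiff_tensor (f g : Test) (p : Spacetime) :
    ftDiff (tensor ![f, g]) p = ft f (-p) * ft g p := by
  rw [ftDiff, ft, ft, ← integral_prod_mul]
  have hmp := (volume_preserving_finTwoArrow Spacetime)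
  refine Eq.trans ?_ (hmp.integral_comp (MeasurableEquiv.finTwoArrow).measurableEmbedding
    (fun z : Spacetime × Spacetime => f z.1 * Complex.exp (inner ℝ (-p) z.1 * Complex.I)
      * (g z.2 * Complex.exp (inner ℝ p z.2 * Complex.I))))
  refine integral_congr_ae (Eventually.of_forall fun v => ?_)
  simp only [tensor_apply_two]
  change _ = f (v 0) * Complex.exp (inner ℝ (-p) (v 0) * Complex.I)
    * (g (v 1) * Complex.exp (inner ℝ p (v 1) * Complex.I))
  have h : Complex.exp (inner ℝ p (v 1 - v 0) * Complex.I)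
      = Complex.exp (inner ℝ (-p) (v 0) * Complex.I) * Complex.exp (inner ℝ p (v 1) * Complex.I) := by
    rw [← Complex.exp_add, inner_sub_right, inner_neg_left]
    push_cast
    congr 1
    ring
  rw [h]
  ring

/-- `IsRelativeTwoPoint` asks for some distribution with the right values on products. The one built
from `μ` has explicit regularizations, and it need not be compared with the one provided by
`IsState`. -/
theorem isNPointDistribution_twoPoint {m : ℝ} {ω : FieldAlgebra m →ₗ[ℂ] ℂ}
    (hμ : ∀ f g : Test,
      ω (field m (conj f) * field m g) = ∫ p, starRingEnd ℂ (ft f p) * ft g p ∂μ) :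
    IsNPointDistribution ω 2 (twoPointDistribution μ) := by
  intro f
  have hf : f = ![f 0, f 1] := by
    ext i
    fin_cases i <;> rfl
  have h1 : (List.ofFn fun i => field m (f i)).prod = field m (conj (conj (f 0))) * field m (f 1) := by
    rw [conj_conj]
    simp [List.ofFn_succ]
  rw [h1, hμ, hf, twoPointDistribution_apply]
  refine integral_congr_ae (Eventually.of_forall fun p => ?_)
  simp only [ftDiff_tensor, ft_conj]
  simp

/-- The base point enters only through `x 1 - x 0`, which is `z` at `relativePoints q z`. This is
why the pullback does not depend on `q`. -/
theorem ftDiff_reflect (x : Fin 2 → Spacetime) (k : TwoPointTest) (p : Spacetime) :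
    ftDiff (reflect x k) p
      = Complex.exp (inner ℝ p (x 1 - x 0) * Complex.I) * ftDiff k (-p) := by
  have : (volume : Measure (Fin 2 → Spacetime)).IsNegInvariant := by
    have : (volume : Measure Spacetime).IsNegInvariant :=
      Measure.IsAddHaarMeasure.isNegInvariant_of_regular (G := Spacetime) volume
    infer_instance
  rw [ftDiff, ftDiff, ← integral_const_mul,
    ← integral_sub_left_eq_self (fun v : Fin 2 → Spacetime =>
      reflect x k v * Complex.exp (inner ℝ p (v 1 - v 0) * Complex.I)) volume x]
  refine integral_congr_ae (Eventually.of_forall fun v => ?_)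
  change k (x - (x - v)) * _ = _
  simp only [sub_sub_cancel, Pi.sub_apply]
  have h : Complex.exp (inner ℝ p (x 1 - v 1 - (x 0 - v 0)) * Complex.I)
      = Complex.exp (inner ℝ p (x 1 - x 0) * Complex.I)
        * Complex.exp (inner ℝ (-p) (v 1 - v 0) * Complex.I) := by
    rw [← Complex.exp_add, ← add_mul, ← Complex.ofReal_add]
    simp only [inner_sub_right, inner_neg_left]
    congr 3
    ring
  rw [h]
  ring

theorem integral_norm_eq_one {k : TwoPointTest} (h0 : ∀ v, 0 ≤ k v) (h1 : ∫ v, k v = 1) :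
    ∫ v, ‖k v‖ = 1 := by
  have h : ∀ v, ((‖k v‖ : ℝ) : ℂ) = k v := fun v => by
    rw [Complex.norm_of_nonneg' (h0 v)]
  apply Complex.ofReal_injective
  rw [← integral_complex_ofReal]
  simp only [h]
  rw [h1, Complex.ofReal_one]

theorem tendsto_ftDiff_deltaSequence {χ : ℕ → TwoPointTest} (hχ : IsDeltaSequence χ)
    (p : Spacetime) : Tendsto (fun n => ftDiff (χ n) p) atTop (𝓝 1) := by
  obtain ⟨h0, h1, hs⟩ := hχ
  rw [Metric.tendsto_atTop']
  intro ε hε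
  have hcont : Continuous fun v : Fin 2 → Spacetime =>
      Complex.exp (inner ℝ p (v 1 - v 0) * Complex.I) := by fun_prop
  obtain ⟨r, hr, hball⟩ := Metric.continuous_iff.1 hcont 0 (ε / 2) (half_pos hε)
  obtain ⟨n₀, hn₀⟩ := eventually_atTop.1 (hs r hr)
  refine ⟨n₀, fun n hn => lt_of_le_of_lt ?_ (half_lt_self hε)⟩
  have hi := integrable_twoPointTest (χ n)
  rw [dist_eq_norm, ← h1 n, ftDiff, ← integral_sub (integrable_ftDiff_integrand (χ n) p) hi]
  refine (norm_integral_le_of_norm_le (hi.norm.mul_const (ε / 2))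
    (Eventually.of_forall fun v => ?_)).trans_eq ?_
  · rw [← mul_sub_one, norm_mul]
    by_cases hv : χ n v = 0
    · simp [hv]
    · refine mul_le_mul_of_nonneg_left ?_ (norm_nonneg _)
      have h := hball v (hn₀ n hn.le (subset_tsupport _ hv))
      rw [dist_eq_norm] at h
      simpa using h.le
  · rw [integral_mul_const, integral_norm_eq_one (h0 n) (h1 n), one_mul]

/-- By Fubini the regularized pairing is `∫ ftDiff (χ n) (-p) ft h(p) dμ`. The first factor is
bounded by `1` and tends to `1`, so dominated convergence gives `∫ ft h dμ`. -/
theorem isPullback_twoPoint [SFinite μ] (q : Spacetime) :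
    IsPullback (relativePoints q) (twoPointDistribution μ) (spectralDistribution μ) := by
  intro χ hχ h _
  have hX : ∀ n, Continuous fun p => ftDiff (χ n) (-p) := fun n =>
    (continuous_ftDiff (χ n)).comp continuous_neg
  have hX1 : ∀ n p, ‖ftDiff (χ n) p‖ ≤ 1 := fun n p =>
    (norm_ftDiff_le _ p).trans_eq (integral_norm_eq_one (hχ.1 n) (hχ.2.1 n))
  have hrefl : ∀ n z p, ftDiff (reflect (relativePoints q z) (χ n)) p
      = Complex.exp (inner ℝ p z * Complex.I) * ftDiff (χ n) (-p) := fun n z p => by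
    rw [ftDiff_reflect]
    have : relativePoints q z 1 - relativePoints q z 0 = z := by
      simp only [relativePoints, Matrix.cons_val_one, Matrix.cons_val_zero]
      module
    rw [this]
  have hXi : ∀ n, Integrable (fun p => ftDiff (χ n) (-p)) μ := fun n => by
    refine (integrable_ftDiff μ (reflect 0 (χ n))).congr (Eventually.of_forall fun p => ?_)
    simp [ftDiff_reflect]
  have key : ∀ n, ∫ z, twoPointDistribution μ (reflect (relativePoints q z) (χ n)) * h z
      = ∫ p, ftDiff (χ n) (-p) * ft h p ∂μ := fun n => by
    have hprod : Integrable (fun x : Spacetime × Spacetime =>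
        Complex.exp (inner ℝ x.2 x.1 * Complex.I) * ftDiff (χ n) (-x.2) * h x.1)
        (volume.prod μ) := by
      refine ((h.integrable.mul_prod (hXi n)).mul_bdd (c := 1) (g := fun x : Spacetime × Spacetime =>
        Complex.exp (inner ℝ x.2 x.1 * Complex.I)) (Continuous.aestronglyMeasurable (by fun_prop))
        (Eventually.of_forall fun x => (norm_exp_inner_mul_I _ _).le)).congr
        (Eventually.of_forall fun x => ?_)
      simp only
      ring
    simp only [twoPointDistribution_apply, hrefl, ← integral_mul_const]
    rw [integral_integral_swap hprod]
    refine integral_congr_ae (Eventually.of_forall fun p => ?_)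
    simp only
    rw [ft, ← integral_const_mul]
    refine integral_congr_ae (Eventually.of_forall fun z => ?_)
    simp only
    ring
  simp only [key, spectralDistribution_apply]
  have hfc := continuous_ft (h.integrable (μ := volume))
  refine tendsto_integral_of_dominated_convergence (fun p => ‖ft h p‖)
    (fun n => ((hX n).mul hfc).aestronglyMeasurable) (integrable_ft h).norm
    (fun n => Eventually.of_forall fun p => ?_) (Eventually.of_forall fun p => ?_)
  · rw [norm_mul]
    exact mul_le_of_le_one_left (norm_nonneg _) (hX1 n _)
  · have := (tendsto_ftDiff_deltaSequence hχ (-p)).mul_const (ft h p)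
    rwa [one_mul] at this

end Difference

/-- `μ` has the density `‖ft f‖⁻²` relative to the finite measure `‖ft f‖² μ`, for `f` with
zero-free transform. Fubini's theorem requires s-finiteness. -/
theorem sfinite_of_hasTemperateGrowth (μ : Measure Spacetime) [μ.HasTemperateGrowth] :
    SFinite μ := by
  obtain ⟨f, hf⟩ := exists_ft_ne_zero
  have := isFiniteMeasure_ftDensity_of_integrable (integrable_norm_ft_sq (μ := μ) f)
  rw [← withDensity_ftDensity μ hf]
  infer_instance

/-- The spectral measure of the two-point function of a KMS state is thermal. -/
theorem isThermal_of_isKMS {m β : ℝ} {ω : FieldAlgebra m →ₗ[ℂ] ℂ} (hβ : 0 < β) {e : Spacetime}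
    (he : e ∈ timeDirections) (hKMS : IsKMS ω β e) {μ : Measure Spacetime} [μ.HasTemperateGrowth]
    (hμ : ∀ f g : Test,
      ω (field m (conj f) * field m g) = ∫ p, starRingEnd ℂ (ft f p) * ft g p ∂μ) :
    IsThermal μ β (4 * e 0) e where
  temperate := inferInstance
  sfinite := sfinite_of_hasTemperateGrowth μ
  norm_le := by
    filter_upwards [ae_minkowski_eq hμ] with p hp
    exact norm_le_mul_abs_inner he (hp ▸ sq_nonneg m)
  balance := withDensity_exp_eq_map_neg hβ hKMS hμ

end KleinGordon

end

open KleinGordon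
theorem mainTheorem7 (m : ℝ) (hm : 0 ≤ m) (β : ℝ) (hβ : 0 < β)
    (e : Spacetime) (he : e ∈ timeDirections)
    (ω : FieldAlgebra m →ₗ[ℂ] ℂ) (hω : IsState ω) (hKMS : IsKMS ω β e)
    (hinv : IsTranslationInvariant ω) :
    ∃ w : 𝓢'(Spacetime, ℂ), (∀ q, IsRelativeTwoPoint ω q w) ∧
      ∃ F : ComplexSpacetime → ℂ,
        AnalyticOnNhd ℂ F (flatTube β e) ∧
        (∀ K : Set ℝ, IsCompact K → K ⊆ Set.Ioo 0 β → ∃ C > 0, ∃ N : ℕ,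
          ∀ z, ∀ σ ∈ K, ‖F (tubePoint e z σ)‖ ≤ C * (1 + ‖tubePoint e z σ‖) ^ N) ∧
        (∀ h : 𝓢(Spacetime, ℂ),
          Tendsto (fun σ : ℝ => ∫ z, F (tubePoint e z σ) * h z) (𝓝[>] 0) (𝓝 (w h))) ∧
        (∀ h : 𝓢(Spacetime, ℂ),
          Tendsto (fun η : ℝ => ∫ z, F (tubePoint e z (β - η)) * h z) (𝓝[>] 0)
            (𝓝 (w (reflectSchwartz h)))) := by
  obtain ⟨μ, _, hμ⟩ := exists_twoPoint_measure hω hinv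
  have ht := isThermal_of_isKMS hβ he hKMS hμ
  have hc : 0 < 4 * e 0 := mul_pos four_pos he.1.1
  have := ht.sfinite
  exact ⟨spectralDistribution μ,
    fun q => ⟨twoPointDistribution μ, isNPointDistribution_twoPoint μ hμ, isPullback_twoPoint μ q⟩,
    laplace μ, ht.analyticOnNhd_laplace hc, fun K hK hKβ => ht.laplace_bound hc hK hKβ,
    fun h => ht.tendsto_laplace_zero hc hβ h, fun h => ht.tendsto_laplace_beta hc hβ h⟩
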